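/- **Setting.** Let $P_\pm:(0,\infty)\to[0,\infty)$ be smooth and strictly increasing with $1/P_\pm'\in L^\infty_{loc}((0,\infty))$ (equivalently, $P_\pm'>0$), let $g,\ell,m>0$, and put $h_\pm(z)=\int_1^z P_\pm'(r)r^{-1}dr$. Let $\rho_0^\pm>0$ satisfy $P_+(\rho_0^+)=P_-(\rho_0^-)$ and $P_-(\rho_0^-)>P_+(\rho_0^-)$ (so $\rho_0^+>\rho_0^-$), and assume $h_-(\rho_0^-)+gm\in h_-((0,\infty))$, $h_+(\rho_0^+)-g\ell\in h_+((0,\infty))$. Let $\rho_0(x_3)=h_\pm^{-1}(h_\pm(\rho_0^\pm)-gx_3)$ for $x_3\in(0,\ell)$, respectively $x_3\in(-m,0)$, and write $P'(\rho_0)$ for $P_\pm'(\rho_0)$ there. Let $\Omega_+=\mathbb R^2\times(0,\ell)$, $\Omega_-=\mathbb R^2\times(-m,0)$, $I_+=(0,\ell)$, $I_-=(-m,0)$, and let $[\![u]\!]$ be the jump $u_+-u_-$ of the boundary values on $\{x_3=0\}$. The *linearized equations* in $\Omega_\pm$ are $$\partial_t\eta=v,\qquad \partial_tq+\rho_0\operatorname{div}v=0,\qquad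 \rho_0\partial_tv+\nabla(P'(\rho_0)q)=-gq\,e_3-g\rho_0\nabla\eta_3,$$ with jump conditions $[\![v_3]\!]=0$, $[\![P'(\rho_0)q]\!]=0$ on $\{x_3=0\}$ and boundary conditions $v_3=0$ on $\{x_3=-m\}$ and $\{x_3=\ell\}$. **Sobolev norms.** With $\hat u(\xi,x_3)=\int_{\mathbb R^2}u(x',x_3)e^{-ix'\cdot\xi}dx'$ (extended to $L^2$), $\|u\|_{H^k}^2=\sum_\pm\sum_{j=0}^k\int_{\mathbb R^2\times I_\pm}(1+|\xi|^2)^{k-j}|\partial_{x_3}^j\hat u|^2\,d\xi\,dx_3$; for vector fields sum over the components. $H^k(\Omega)$ is the corresponding piecewise Sobolev space. **Normal modes.** For $r>0$ let $-\lambda(r)^2$ be the infimum of $$E_r(\varphi,\psi)=\tfrac12\int_{-m}^{\ell}P'(\rho_0)\rho_0(\psi'+r\varphi)^2-2gr\rho_0\varphi\psi\,dx_3$$ over all real $(\varphi,\psi)\in L^2((-m,\ell))\times H^1_0((-m,\ell))$ with $\tfrac12\int_{-m}^\ell\rho_0(\varphi^2+\psi^2)=1$, where $\lambda(r)\ge 0$.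 A *normal mode* at frequency $r$ is a minimizer $(\varphi,\psi)$, with $\varphi$ continuous on $(-m,0)$ and on $(0,\ell)$. A *family of normal modes* is a choice of a normal mode $(\varphi(r,\cdot),\psi(r,\cdot))$ for every $r>0$ such that $\varphi(r,x_3)$, $\psi(r,x_3)$ are Borel measurable in $r$ for each $x_3\in(-m,\ell)\setminus\{0\}$. Given such a family put, for $\xi\in\mathbb R^2\setminus\{0\}$, $$(\varphi,\theta)(\xi,x_3)=\varphi(|\xi|,x_3)\,\xi/|\xi|,\qquad \psi(\xi,x_3)=\psi(|\xi|,x_3),\qquad \hat w=-i\varphi e_1-i\theta e_2+\psi e_3 .$$ **Theorem.** Families of normal modes exist. There are constants $C_0,C_1,C_2>0$ and $\bar C_k>0$ ($k\in\mathbb N$), depending only on $\rho_0^\pm,P_\pm,g,m,\ell$, such that $\lambda(r)^2\ge C_1r-C_2$ for $r\ge C_0$, and the following holds for every family of normal modes. Let $\max\{C_0,2C_2/C_1\}<R_1\le R_2<R_3<\infty$ and let $f\in C_c^\infty(\mathbb R^2)$ be real-valued and radial with $\operatorname{supp}f\subset\{R_2\le|\xi|\le R_3\}$. For $x=(x',x_3)\in\Omega_+\cup\Omega_-$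 and $t\in\mathbb R$ the integrals $$\eta(x,t)=\frac1{4\pi^2}\int_{\mathbb R^2}f(\xi)\hat w(\xi,x_3)e^{\lambda(|\xi|)t}e^{ix'\cdot\xi}d\xi,\qquad v(x,t)=\frac1{4\pi^2}\int_{\mathbb R^2}\lambda(|\xi|)f(\xi)\hat w(\xi,x_3)e^{\lambda(|\xi|)t}e^{ix'\cdot\xi}d\xi,$$ $$q(x,t)=-\frac{\rho_0(x_3)}{4\pi^2}\int_{\mathbb R^2}f(\xi)\bigl(\xi_1\varphi+\xi_2\theta+\partial_{x_3}\psi\bigr)(\xi,x_3)e^{\lambda(|\xi|)t}e^{ix'\cdot\xi}d\xi$$ converge absolutely, and: 1. $\eta,v,q$ are real-valued, continuously differentiable in $(x,t)$ on $(\Omega_+\cup\Omega_-)\times\mathbb R$, and solve the linearized equations with the jump and boundary conditions for all $t\in\mathbb R$ (boundary values being limits from inside the respective fluid). 2. If $R\in SO(3)$ fixes $e_3$, then $\eta(Rx,t)=R\eta(x,t)$, $v(Rx,t)=Rv(x,t)$, $q(Rx,t)=q(x,t)$. 3. For every $k\in\mathbb N$, $$\|\eta(0)\|_{H^k}+\|v(0)\|_{H^k}+\|q(0)\|_{H^k}\le\bar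 C_k\Bigl(\int_{\mathbb R^2}(1+|\xi|^2)^{k+1}|f(\xi)|^2d\xi\Bigr)^{1/2}<\infty .$$ 4. $\sqrt{C_1R_2-C_2}>0$, and for every $k\in\mathbb N$, $t>0$ we have $\eta(t),v(t),q(t)\in H^k(\Omega)$ and, for each $u\in\{\eta,v,q\}$, $$e^{t\sqrt{C_1R_2-C_2}}\|u(0)\|_{H^k}\le\|u(t)\|_{H^k}\le e^{t\sqrt{gR_3}}\|u(0)\|_{H^k}.$$ -/

import Mathlib

open Real Set Filter Topology MeasureTheory
open scoped ENNReal ContDiff Matrix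

noncomputable section

namespace RayleighTaylor

/-- Horizontal vectors and horizontal frequencies. -/
abbrev Plane := EuclideanSpace ℝ (Fin 2)

/-- Points `x = (x 0, x 1, x 2)` of physical space; the third coordinate `x 2` is vertical. -/
abbrev Space := Fin 3 → ℝ

/-- Admissible barotropic pressure laws on `(0, ∞)`. For a smooth law, local boundedness of `1 / P'`
on `(0, ∞)` says exactly that `P'` does not vanish there, i.e. (`P` being increasing) that it is
positive. -/
structure PressureLaw (P : ℝ → ℝ) : Prop where
  nonneg : ∀ z, 0 < z → 0 ≤ P z
  smooth : ContDiffOn ℝ ∞ P (Ioi 0)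
  strictMono : StrictMonoOn P (Ioi 0)
  deriv_pos : ∀ z, 0 < z → 0 < deriv P z

/-- The enthalpy `h(z) = ∫₁ᶻ P'(r) / r dr` of a pressure law. -/
def enthalpy (P : ℝ → ℝ) (z : ℝ) : ℝ := ∫ r in (1 : ℝ)..z, deriv P r / r

/-- The parameters of a Rayleigh-Taylor steady state in the slab `-m < x₃ < ℓ`: pressure laws
`Pp`, `Pm` of the upper and lower fluid, gravity `g`, and the densities `rhoP`, `rhoM` of the upper
and lower fluid at the interface `x₃ = 0`. -/
structure Params where
  Pp : ℝ → ℝ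
  Pm : ℝ → ℝ
  g : ℝ
  ℓ : ℝ
  m : ℝ
  rhoP : ℝ
  rhoM : ℝ
  law_p : PressureLaw Pp
  law_m : PressureLaw Pm
  g_pos : 0 < g
  ℓ_pos : 0 < ℓ
  m_pos : 0 < m
  rhoM_pos : 0 < rhoM
  rhoP_pos : 0 < rhoP
  /-- The lower density is chosen so that the upper fluid is heavier at the interface. -/
  unstable : Pp rhoM < Pm rhoM
  /-- Continuity of the pressure; it determines `rhoP`. -/
  pressure_eq : Pp rhoP = Pm rhoM
  /-- The steady density profile exists down to the bottom ... -/
  bottom : enthalpy Pm rhoM + g * m ∈ enthalpy Pm '' Ioi 0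
  /-- ... and up to the top. -/
  top : enthalpy Pp rhoP - g * ℓ ∈ enthalpy Pp '' Ioi 0

variable (S : Params)

/-- The steady density `ρ₀(x₃) = h±⁻¹(h±(ρ₀±) - g x₃)` (the value at `x₃ = 0` is immaterial). -/
def rho (s : ℝ) : ℝ :=
  if s < 0 then Function.invFunOn (enthalpy S.Pm) (Ioi 0) (enthalpy S.Pm S.rhoM - S.g * s)
  else Function.invFunOn (enthalpy S.Pp) (Ioi 0) (enthalpy S.Pp S.rhoP - S.g * s)

/-- The coefficient `P'(ρ₀(x₃))`, i.e. `P±'(ρ₀(x₃))` in the upper / lower fluid. -/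
def dP (s : ℝ) : ℝ :=
  if s < 0 then deriv S.Pm (rho S s) else deriv S.Pp (rho S s)

/-! ### The variational problem for the normal modes -/

/-- `φ ∈ L²((-m, ℓ))`. -/
def IsL2 (φ : ℝ → ℝ) : Prop := MemLp φ 2 (volume.restrict (Ioo (-S.m) S.ℓ))

/-- `ψ ∈ H¹₀((-m, ℓ))` with weak derivative `d`: `ψ` is a primitive of `d ∈ L²((-m, ℓ))` and
vanishes at both endpoints. -/
structure IsH10 (ψ d : ℝ → ℝ) : Prop where
  memLp : IsL2 S d
  primitive : ∀ s ∈ Icc (-S.m) S.ℓ, ψ s = ∫ τ in (-S.m)..s, d τ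
  top_eq_zero : ψ S.ℓ = 0

/-- The energy `E(φ, ψ)` at frequency `r = |ξ|`, where `d = ψ'`. -/
def energyE (r : ℝ) (φ ψ d : ℝ → ℝ) : ℝ :=
  (1 / 2) * ∫ s in (-S.m)..S.ℓ,
    (dP S s * rho S s * (d s + r * φ s) ^ 2 - 2 * S.g * rho S s * r * ψ s * φ s)

/-- The constraint functional `J(φ, ψ)`. -/
def constraintJ (φ ψ : ℝ → ℝ) : ℝ :=
  (1 / 2) * ∫ s in (-S.m)..S.ℓ, rho S s * ((φ s) ^ 2 + (ψ s) ^ 2)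

/-- `(φ, ψ)`, with `d = ψ'`, lies in the constraint set
`{(φ, ψ) ∈ L² × H¹₀ : J(φ, ψ) = 1}`. -/
structure IsAdmissible (φ ψ d : ℝ → ℝ) : Prop where
  memL2 : IsL2 S φ
  memH10 : IsH10 S ψ d
  constraint : constraintJ S φ ψ = 1

/-- `μ(r) = inf E` over the constraint set. -/
def mu (r : ℝ) : ℝ :=
  sInf {e : ℝ | ∃ φ ψ d : ℝ → ℝ, IsAdmissible S φ ψ d ∧ e = energyE S r φ ψ d}

/-- The growth rate `λ(r) = √(-μ(r))`. -/
def growthRate (r : ℝ) : ℝ := √(-mu S r)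

/-- `(φ, ψ)` is a normal mode at frequency `r`: a minimizer of `E` over the constraint set, where
the representative of the `L²` function `φ` is the one that is continuous in each fluid. -/
structure IsMode (r : ℝ) (φ ψ : ℝ → ℝ) : Prop where
  admissible : IsAdmissible S φ ψ (deriv ψ)
  minimal : energyE S r φ ψ (deriv ψ) = mu S r
  cont_lower : ContinuousOn φ (Ioo (-S.m) 0)
  cont_upper : ContinuousOn φ (Ioo 0 S.ℓ)

/-- A choice of one normal mode `(φ r, ψ r)` for every frequency `r > 0`, measurable in `r`
(a mode is at best unique up to its sign, so measurability of the choice has to be said). -/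
structure IsModeFamily (φ ψ : ℝ → ℝ → ℝ) : Prop where
  mode : ∀ r, 0 < r → IsMode S r (φ r) (ψ r)
  meas_φ : ∀ s ∈ Ioo (-S.m) S.ℓ, s ≠ 0 → Measurable fun r : Ioi (0 : ℝ) => φ r s
  meas_ψ : ∀ s ∈ Ioo (-S.m) S.ℓ, s ≠ 0 → Measurable fun r : Ioi (0 : ℝ) => ψ r s

/-! ### Fourier synthesis -/

/-- The first two components `(φ, θ)(ξ, x₃) = R⁻¹ (φ(|ξ|, x₃), 0)`, where `R` is the rotation with
`R ξ = (|ξ|, 0)`; that is, `φ(|ξ|, x₃) ξ / |ξ|`. -/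
def horiz (φ : ℝ → ℝ → ℝ) (ξ : Plane) (s : ℝ) (j : Fin 2) : ℝ := φ ‖ξ‖ s * (ξ j / ‖ξ‖)

/-- `ŵ(ξ, x₃) = -i φ(ξ, x₃) e₁ - i θ(ξ, x₃) e₂ + ψ(|ξ|, x₃) e₃`. -/
def wHat (φ ψ : ℝ → ℝ → ℝ) (ξ : Plane) (s : ℝ) : Fin 3 → ℂ :=
  ![-Complex.I * (horiz φ ξ s 0 : ℂ), -Complex.I * (horiz φ ξ s 1 : ℂ), (ψ ‖ξ‖ s : ℂ)]

/-- `e^{λ(|ξ|) t} e^{i x'·ξ}`. -/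
def wave (ξ : Plane) (x : Space) (t : ℝ) : ℂ :=
  (Real.exp (growthRate S ‖ξ‖ * t) : ℂ) *
    Complex.exp (Complex.I * ((x 0 * ξ 0 + x 1 * ξ 1 : ℝ) : ℂ))

/-- The integrands of the three Fourier syntheses, as functions of `ξ`. -/
def etaIntegrand (φ ψ : ℝ → ℝ → ℝ) (f : Plane → ℝ) (x : Space) (t : ℝ) (ξ : Plane) : Fin 3 → ℂ :=
  ((f ξ : ℂ) * wave S ξ x t) • wHat φ ψ ξ (x 2)

def vIntegrand (φ ψ : ℝ → ℝ → ℝ) (f : Plane → ℝ) (x : Space) (t : ℝ) (ξ : Plane) : Fin 3 → ℂ :=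
  ((growthRate S ‖ξ‖ : ℂ) * (f ξ : ℂ) * wave S ξ x t) • wHat φ ψ ξ (x 2)

def qIntegrand (φ ψ : ℝ → ℝ → ℝ) (f : Plane → ℝ) (x : Space) (t : ℝ) (ξ : Plane) : ℂ :=
  (f ξ : ℂ) *
    ((ξ 0 * horiz φ ξ (x 2) 0 + ξ 1 * horiz φ ξ (x 2) 1 + deriv (ψ ‖ξ‖) (x 2) : ℝ) : ℂ) *
    wave S ξ x t

/-- `η(x,t) = (4π²)⁻¹ ∫ f(ξ) ŵ(ξ,x₃) e^{λ(|ξ|)t} e^{i x'·ξ} dξ`. -/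
def etaSynth (φ ψ : ℝ → ℝ → ℝ) (f : Plane → ℝ) (x : Space) (t : ℝ) : Fin 3 → ℂ :=
  ((1 / (4 * π ^ 2) : ℝ) : ℂ) • ∫ ξ : Plane, etaIntegrand S φ ψ f x t ξ

/-- `v(x,t) = (4π²)⁻¹ ∫ λ(|ξ|) f(ξ) ŵ(ξ,x₃) e^{λ(|ξ|)t} e^{i x'·ξ} dξ`. -/
def vSynth (φ ψ : ℝ → ℝ → ℝ) (f : Plane → ℝ) (x : Space) (t : ℝ) : Fin 3 → ℂ :=
  ((1 / (4 * π ^ 2) : ℝ) : ℂ) • ∫ ξ : Plane, vIntegrand S φ ψ f x t ξ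

/-- `q(x,t) = -(ρ₀(x₃)/4π²) ∫ f(ξ) (ξ₁ φ + ξ₂ θ + ∂_{x₃} ψ)(ξ,x₃) e^{λ(|ξ|)t} e^{i x'·ξ} dξ`. -/
def qSynth (φ ψ : ℝ → ℝ → ℝ) (f : Plane → ℝ) (x : Space) (t : ℝ) : ℂ :=
  ((-(rho S (x 2)) / (4 * π ^ 2) : ℝ) : ℂ) * ∫ ξ : Plane, qIntegrand S φ ψ f x t ξ

/-! ### The linearized equations -/

/-- The upper fluid domain `ℝ² × (0, ℓ)`. -/
def upperFluid : Set Space := {x | x 2 ∈ Ioo 0 S.ℓ}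

/-- The lower fluid domain `ℝ² × (-m, 0)`. -/
def lowerFluid : Set Space := {x | x 2 ∈ Ioo (-S.m) 0}

/-- The partial derivative `∂ᵢ u (x)`. -/
def pd (i : Fin 3) (u : Space → ℝ) (x : Space) : ℝ := fderiv ℝ u x (Pi.single i 1)

/-- `(η, v, q)` is a classical solution, for all times, of the equations linearized about the steady
state in the two fluids, with the jump conditions `[v₃] = 0`, `[P'(ρ₀) q] = 0` on `x₃ = 0` and the
boundary conditions `v₃ = 0` on `x₃ = -m` and `x₃ = ℓ`. Boundary values are limits from inside the
respective fluid. -/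
structure IsLinearizedSolution (η v : Space → ℝ → Space) (q : Space → ℝ → ℝ) : Prop where
  regular_η : ContDiffOn ℝ 1 (fun p : Space × ℝ => η p.1 p.2) ((upperFluid S ∪ lowerFluid S) ×ˢ univ)
  regular_v : ContDiffOn ℝ 1 (fun p : Space × ℝ => v p.1 p.2) ((upperFluid S ∪ lowerFluid S) ×ˢ univ)
  regular_q : ContDiffOn ℝ 1 (fun p : Space × ℝ => q p.1 p.2) ((upperFluid S ∪ lowerFluid S) ×ˢ univ)
  flow : ∀ x ∈ upperFluid S ∪ lowerFluid S, ∀ t, deriv (fun τ => η x τ) t = v x t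
  mass : ∀ x ∈ upperFluid S ∪ lowerFluid S, ∀ t,
    deriv (fun τ => q x τ) t + rho S (x 2) * ∑ i, pd i (fun y => v y t i) x = 0
  momentum : ∀ x ∈ upperFluid S ∪ lowerFluid S, ∀ t, ∀ i : Fin 3,
    rho S (x 2) * deriv (fun τ => v x τ i) t + pd i (fun y => dP S (y 2) * q y t) x
      = -(S.g * q x t * (if i = 2 then 1 else 0))
        - S.g * rho S (x 2) * pd i (fun y => η y t 2) x
  jump_velocity : ∀ y : Space, y 2 = 0 → ∀ t, ∃ a : ℝ,
    Tendsto (fun x => v x t 2) (𝓝[upperFluid S] y) (𝓝 a) ∧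
    Tendsto (fun x => v x t 2) (𝓝[lowerFluid S] y) (𝓝 a)
  jump_pressure : ∀ y : Space, y 2 = 0 → ∀ t, ∃ a : ℝ,
    Tendsto (fun x => dP S (x 2) * q x t) (𝓝[upperFluid S] y) (𝓝 a) ∧
    Tendsto (fun x => dP S (x 2) * q x t) (𝓝[lowerFluid S] y) (𝓝 a)
  boundary_top : ∀ y : Space, y 2 = S.ℓ → ∀ t,
    Tendsto (fun x => v x t 2) (𝓝[upperFluid S] y) (𝓝 0)
  boundary_bottom : ∀ y : Space, y 2 = -S.m → ∀ t,
    Tendsto (fun x => v x t 2) (𝓝[lowerFluid S] y) (𝓝 0)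

/-! ### Piecewise Sobolev norms -/

/-- Real test functions `Φ ∈ C_c^∞(ℝ² × I)`. -/
structure IsTest (I : Set ℝ) (Φ : Plane × ℝ → ℝ) : Prop where
  smooth : ContDiff ℝ ∞ Φ
  compact : HasCompactSupport Φ
  support : tsupport Φ ⊆ univ ×ˢ I

/-- Lebesgue measure on `ℝ² × I`. -/
def slab (I : Set ℝ) : Measure (Plane × ℝ) := volume.restrict (univ ×ˢ I)

/-- `U ∈ L²` is the horizontal Fourier transform `∫ u(x', x₃) e^{-i x'·ξ} dx'` of
`u ∈ L²(ℝ² × I)`; for functions that are merely `L²` this is meant by duality. -/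
structure IsHorizontalFourier (I : Set ℝ) (u : Plane × ℝ → ℝ) (U : Plane × ℝ → ℂ) : Prop where
  memLp_u : MemLp u 2 (slab I)
  memLp_U : MemLp U 2 (slab I)
  duality : ∀ Φ, IsTest I Φ →
    ∫ p, U p * (Φ p : ℂ) ∂(slab I) =
      ∫ p, (u p : ℂ) * (∫ ξ : Plane,
        (Φ (ξ, p.2) : ℂ) * Complex.exp (-Complex.I * ((inner ℝ p.1 ξ : ℝ) : ℂ))) ∂(slab I)

/-- `G` is the weak derivative `∂_{x₃} F` on `ℝ² × I`. -/
def IsWeakVertDeriv (I : Set ℝ) (F G : Plane × ℝ → ℂ) : Prop :=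
  ∀ Φ, IsTest I Φ →
    ∫ p, G p * (Φ p : ℂ) ∂(slab I) =
      -∫ p, F p * ((fderiv ℝ Φ p (0, 1) : ℝ) : ℂ) ∂(slab I)

/-- `U j = ∂_{x₃}^j û` on `ℝ² × I` for `j ≤ k`, all of them in `L²`. -/
structure IsHkTransform (k : ℕ) (I : Set ℝ) (u : Plane × ℝ → ℝ) (U : ℕ → Plane × ℝ → ℂ) :
    Prop where
  fourier : IsHorizontalFourier I u (U 0)
  memLp : ∀ j ≤ k, MemLp (U j) 2 (slab I)
  weak : ∀ j < k, IsWeakVertDeriv I (U j) (U (j + 1))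

/-- The squared norm of `u` in `H^k(ℝ² × I)`,
`∑_{j ≤ k} ∫ (1 + |ξ|²)^{k-j} |∂_{x₃}^j û(ξ, x₃)|² dξ dx₃`. The transforms `U j` are unique almost
everywhere if they exist; the value is `∞` exactly if `u` is not in `H^k`. -/
def hkSqOn (k : ℕ) (I : Set ℝ) (u : Plane × ℝ → ℝ) : ℝ≥0∞ :=
  ⨅ (U : ℕ → Plane × ℝ → ℂ) (_ : IsHkTransform k I u U),
    ∑ j ∈ Finset.range (k + 1),
      ∫⁻ p, ENNReal.ofReal ((1 + ‖p.1‖ ^ 2) ^ (k - j)) * ‖U j p‖ₑ ^ 2 ∂(slab I)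

/-- The squared norm of a scalar function in the piecewise Sobolev space `H^k(Ω)`. -/
def hkSq (k : ℕ) (u : Space → ℝ) : ℝ≥0∞ :=
  hkSqOn k (Ioo 0 S.ℓ) (fun p => u ![p.1 0, p.1 1, p.2]) +
    hkSqOn k (Ioo (-S.m) 0) (fun p => u ![p.1 0, p.1 1, p.2])

/-- The piecewise `H^k(Ω)` norm of a scalar function; `u ∈ H^k(Ω)` iff it is finite. -/
def hkNorm (k : ℕ) (u : Space → ℝ) : ℝ≥0∞ := hkSq S k u ^ (1 / 2 : ℝ)

/-- The piecewise `H^k(Ω)` norm of a vector field. -/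
def hkNormVec (k : ℕ) (w : Space → Space) : ℝ≥0∞ :=
  (∑ i, hkSq S k (fun x => w x i)) ^ (1 / 2 : ℝ)

/-- The weighted norm `(∫ (1 + |ξ|²)^{k+1} |f(ξ)|² dξ)^{1/2}`. -/
def weightNorm (k : ℕ) (f : Plane → ℝ) : ℝ≥0∞ :=
  (∫⁻ ξ : Plane, ENNReal.ofReal ((1 + ‖ξ‖ ^ 2) ^ (k + 1) * |f ξ| ^ 2)) ^ (1 / 2 : ℝ)

/-- Growth between the exponential rates `a` and `b`, for a norm `N` as a function of time. -/
def GrowsBetween (a b : ℝ) (N : ℝ → ℝ≥0∞) (t : ℝ) : Prop :=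
  ENNReal.ofReal (Real.exp (t * a)) * N 0 ≤ N t ∧
    N t ≤ ENNReal.ofReal (Real.exp (t * b)) * N 0

end RayleighTaylor

end

open RayleighTaylor

noncomputable section

namespace RayleighTaylor

/-! ### The steady state -/

section SteadyState

variable {P : ℝ → ℝ}

/-! The horizontal Fourier transform decouples the linearized equations. At frequency `ξ` they
become, for a solution growing like `e^{λt}`, the Euler-Lagrange equations of `E_r` under `J = 1`
with multiplier `-λ²`, where `r = |ξ|`. The theorem therefore reduces to a one-dimensional
variational problem, studied with explicit control in `r`, followed by superposition of its
minimizers.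

Variational part. Dropping the square in `E_r` gives `E_r ≥ -g r J`, hence `λ² ≤ g r`. Testing with
`φ = -ψ'/r` removes the compression `ψ' + rφ` and leaves `g ∫ ρ₀ ψ ψ'`. For a narrow hat `ψ` centred
at the interface this is close to `g (ρ₀⁻ - ρ₀⁺)/2 < 0`, because the upper fluid is heavier. A hat
of width `1/r` has `J = O(1/r)`, so `λ² ≥ C₁ r - C₂` (`mu_neg`, `exists_growth_bound`). Minimizers
exist by weak compactness, and `μ < 0` prevents loss of mass (`exists_minimizer`).

ODE part. With the pressure variable `p = P'(ρ₀) ρ₀ (ψ' + rφ)` the Euler-Lagrange equations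
determine `φ` algebraically and turn into a linear first order system for `(ψ, p)`
(`euler_lagrange`). Both unknowns are continuous across the interface; this is exactly the two jump
conditions. Since `ψ` vanishes at the bottom, a solution is determined by `p(-m)`. Normalized
solutions depend continuously on `(r²/λ², λ²)`, a Borel function of `r`; this produces a measurable
family (`exists_family`).

Estimates. For large `r` the bounds `κ r ≤ λ² ≤ g r` make all coefficients of the system `O(r)`. A
vertical derivative of `a ψ + b p` is thus again such a combination at the price of one power of `r`
(`exists_symbol_chain`), which matches the weights of the Sobolev norm. The square integral of `(ψ,
p)` is `O(r)` (`ModeData.exists_integral_bound`), whence the single additional power of `1 + |ξ|²`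
in the bound for the initial data.

Superposition. All fields are integrals over an annulus of bounded amplitudes times plane waves, so
they may be differentiated under the integral, and the equations become pointwise identities between
amplitudes (`IsPacket.isLinearizedSolution`). By Plancherel the horizontal transform of such a field
is its amplitude (`IsAmp.isHorizontalFourier`). Time evolution multiplies this amplitude by
`e^{λ(|ξ|)t}`, and the two-sided growth bound follows from the bounds for `λ` on the annulus.
Rotation equivariance is a change of variables in `ξ`. -/

theorem PressureLaw.contDiffOn_deriv (h : PressureLaw P) : ContDiffOn ℝ ∞ (deriv P) (Ioi 0) :=
  h.smooth.deriv_of_isOpen isOpen_Ioi (by simp)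

theorem PressureLaw.contDiffOn_deriv_div (h : PressureLaw P) :
    ContDiffOn ℝ ∞ (fun r => deriv P r / r) (Ioi 0) :=
  h.contDiffOn_deriv.div contDiffOn_id fun _ hx => ne_of_gt hx

theorem PressureLaw.hasDerivAt_enthalpy (h : PressureLaw P) {z : ℝ} (hz : 0 < z) :
    HasDerivAt (enthalpy P) (deriv P z / z) z := by
  have hc := h.contDiffOn_deriv_div.continuousOn
  refine intervalIntegral.integral_hasDerivAt_right ?_ ?_ ?_
  · apply ContinuousOn.intervalIntegrable
    refine hc.mono fun x hx => ?_
    exact lt_of_lt_of_le (lt_min one_pos hz) hx.1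
  · exact hc.stronglyMeasurableAtFilter isOpen_Ioi z hz
  · exact hc.continuousAt (Ioi_mem_nhds hz)

theorem PressureLaw.contDiffOn_enthalpy (h : PressureLaw P) :
    ContDiffOn ℝ ∞ (enthalpy P) (Ioi 0) := by
  rw [contDiffOn_infty_iff_deriv_of_isOpen isOpen_Ioi]
  refine ⟨fun z hz => (h.hasDerivAt_enthalpy hz).differentiableAt.differentiableWithinAt, ?_⟩
  exact h.contDiffOn_deriv_div.congr fun z hz => (h.hasDerivAt_enthalpy hz).deriv

theorem PressureLaw.strictMonoOn_enthalpy (h : PressureLaw P) :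
    StrictMonoOn (enthalpy P) (Ioi 0) := by
  apply strictMonoOn_of_deriv_pos (convex_Ioi 0) h.contDiffOn_enthalpy.continuousOn
  intro z hz
  rw [interior_Ioi] at hz
  rw [(h.hasDerivAt_enthalpy hz).deriv]
  exact div_pos (h.deriv_pos z hz) hz

/-- The inverse function theorem applies because `h' = P'/z > 0`. The positivity clause keeps the
local inverse in the domain on which the enthalpy is injective, so that it can be identified with
the global inverse. -/
theorem PressureLaw.exists_local_inverse (h : PressureLaw P) {z : ℝ} (hz : 0 < z) :
    ∃ k : ℝ → ℝ, ContDiffAt ℝ ∞ k (enthalpy P z) ∧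
      ∀ᶠ y in 𝓝 (enthalpy P z), 0 < k y ∧ enthalpy P (k y) = y := by
  have hd := h.hasDerivAt_enthalpy hz
  have hne : deriv P z / z ≠ 0 := (div_pos (h.deriv_pos z hz) hz).ne'
  have hc : ContDiffAt ℝ ∞ (enthalpy P) z := h.contDiffOn_enthalpy.contDiffAt (Ioi_mem_nhds hz)
  have hf : HasFDerivAt (enthalpy P)
      ((ContinuousLinearEquiv.unitsEquivAut ℝ (Units.mk0 _ hne) : ℝ ≃L[ℝ] ℝ) : ℝ →L[ℝ] ℝ) z :=
    hd.hasFDerivAt_equiv hne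
  have hn : (∞ : WithTop ℕ∞) ≠ 0 := by simp
  have hs := hc.hasStrictFDerivAt' hf hn
  have hinv : ContDiffAt ℝ ∞ (hs.localInverse _ _ _) (enthalpy P z) := hc.to_localInverse hf hn
  refine ⟨hs.localInverse _ _ _, hinv, ?_⟩
  have h0 : hs.localInverse _ _ _ (enthalpy P z) = z := hs.localInverse_apply_image
  have := hinv.continuousAt.eventually (p := fun w => 0 < w) (by rw [h0]; exact Ioi_mem_nhds hz)
  filter_upwards [this, hs.eventually_right_inverse] with y h1 h2 using ⟨h1, h2⟩

/-- The steady density of one fluid with interface density `z`. -/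
def rhoOf (P : ℝ → ℝ) (z g s : ℝ) : ℝ :=
  Function.invFunOn (enthalpy P) (Ioi 0) (enthalpy P z - g * s)

/-- The heights at which the steady density of one fluid is defined. -/
def heights (P : ℝ → ℝ) (z g : ℝ) : Set ℝ := {s | enthalpy P z - g * s ∈ enthalpy P '' Ioi 0}

variable {z g : ℝ}

theorem rhoOf_pos {s : ℝ} (hs : s ∈ heights P z g) : 0 < rhoOf P z g s :=
  Function.invFunOn_mem hs

theorem enthalpy_rhoOf {s : ℝ} (hs : s ∈ heights P z g) :
    enthalpy P (rhoOf P z g s) = enthalpy P z - g * s :=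
  Function.invFunOn_eq hs

/-- Injectivity of the enthalpy on `(0, ∞)` leaves `Function.invFunOn` no choice, so it coincides
near `s` with the smooth local inverse. The same neighbourhood shows that the admissible heights
form an open set. -/
theorem PressureLaw.rhoOf_eventuallyEq (h : PressureLaw P) {s : ℝ} (hs : s ∈ heights P z g) :
    ∃ k : ℝ → ℝ, ContDiffAt ℝ ∞ k s ∧ rhoOf P z g =ᶠ[𝓝 s] k ∧ heights P z g ∈ 𝓝 s := by
  obtain ⟨k, hk, hk'⟩ := h.exists_local_inverse (rhoOf_pos hs)
  rw [enthalpy_rhoOf hs] at hk hk'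
  have hc : ContDiffAt ℝ ∞ (fun s : ℝ => enthalpy P z - g * s) s := by fun_prop
  have hk2 := hc.continuousAt.eventually hk'
  refine ⟨_, hk.comp s hc, ?_, ?_⟩
  · filter_upwards [hk2] with t ht
    have hmem : t ∈ heights P z g := ⟨_, ht.1, ht.2⟩
    exact h.strictMonoOn_enthalpy.injOn (rhoOf_pos hmem) ht.1 (by
      rw [enthalpy_rhoOf hmem]; exact ht.2.symm)
  · filter_upwards [hk2] with t ht
    exact ⟨_, ht.1, ht.2⟩

theorem PressureLaw.isOpen_heights (h : PressureLaw P) : IsOpen (heights P z g) :=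
  isOpen_iff_mem_nhds.2 fun _ hs => (h.rhoOf_eventuallyEq hs).choose_spec.2.2

theorem PressureLaw.contDiffOn_rhoOf (h : PressureLaw P) :
    ContDiffOn ℝ ∞ (rhoOf P z g) (heights P z g) := fun s hs => by
  obtain ⟨k, hk, he, -⟩ := h.rhoOf_eventuallyEq hs
  exact (hk.congr_of_eventuallyEq he).contDiffWithinAt

/-- Differentiating `h(ρ) = const - g s` yields hydrostatic balance, `P'(ρ) ρ' = -g ρ`. -/
theorem PressureLaw.hasDerivAt_rhoOf (h : PressureLaw P) {s : ℝ} (hs : s ∈ heights P z g) :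
    HasDerivAt (rhoOf P z g) (-(g * rhoOf P z g s / deriv P (rhoOf P z g s))) s := by
  have hd : DifferentiableAt ℝ (rhoOf P z g) s :=
    (h.contDiffOn_rhoOf.contDiffAt (h.isOpen_heights.mem_nhds hs)).differentiableAt (by simp)
  have h1 := (h.hasDerivAt_enthalpy (rhoOf_pos hs)).comp s hd.hasDerivAt
  have h2 : HasDerivAt (fun s : ℝ => enthalpy P z - g * s) (-g) s := by
    simpa using ((hasDerivAt_id s).const_mul g).const_sub (enthalpy P z)
  have h3 := h1.unique (h2.congr_of_eventuallyEq (by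
    filter_upwards [h.isOpen_heights.mem_nhds hs] with t ht using enthalpy_rhoOf ht))
  have hp := rhoOf_pos hs
  have hp' := h.deriv_pos _ hp
  have h4 : -(g * rhoOf P z g s / deriv P (rhoOf P z g s)) = deriv (rhoOf P z g) s := by
    have h5 : deriv P (rhoOf P z g s) * deriv (rhoOf P z g) s = -g * rhoOf P z g s := by
      rw [← h3]
      field_simp
    rw [← neg_div, div_eq_iff hp'.ne']
    linarith
  rw [h4]
  exact hd.hasDerivAt

theorem PressureLaw.rhoOf_zero (h : PressureLaw P) (hz : 0 < z) : rhoOf P z g 0 = z := by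
  have h0 : (0 : ℝ) ∈ heights P z g := ⟨z, hz, by simp⟩
  exact h.strictMonoOn_enthalpy.injOn (rhoOf_pos h0) hz (by rw [enthalpy_rhoOf h0]; simp)

/-- The image of `(0, ∞)` under the enthalpy is an interval and `s ↦ h(z) - g s` is monotone.
Consequently the conditions at the interface and at the outer wall cover the whole closed layer, and
the coefficients are smooth slightly beyond it. -/
theorem PressureLaw.ordConnected_heights (h : PressureLaw P) {a b : ℝ} (ha : a ∈ heights P z g)
    (hb : b ∈ heights P z g) : Icc a b ⊆ heights P z g := by
  have hc : (enthalpy P '' Ioi 0).OrdConnected :=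
    ((isPreconnected_Ioi).image _ h.contDiffOn_enthalpy.continuousOn).ordConnected
  intro s hs
  rcases le_total 0 g with hg | hg
  · exact hc.out hb ha ⟨by nlinarith [hs.2], by nlinarith [hs.1]⟩
  · exact hc.out ha hb ⟨by nlinarith [hs.1], by nlinarith [hs.2]⟩

end SteadyState

/-! ### The two fluid layers and bounds for their coefficients. -/

variable (S : Params)

/-- One of the two fluids, with its coefficients extended smoothly beyond the closed layer. -/
structure Layer where
  a : ℝ
  b : ℝ
  J : Set ℝ
  ρ : ℝ → ℝ
  D : ℝ → ℝ
  lt : a < b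
  isOpen : IsOpen J
  subset : Icc a b ⊆ J
  smooth_ρ : ContDiffOn ℝ ∞ ρ J
  smooth_D : ContDiffOn ℝ ∞ D J
  ρ_pos : ∀ s ∈ J, 0 < ρ s
  D_pos : ∀ s ∈ J, 0 < D s
  hasDerivAt_ρ : ∀ s ∈ J, HasDerivAt ρ (-(S.g * ρ s / D s)) s
  rho_eq : ∀ s ∈ Ioo a b, rho S s = ρ s
  dP_eq : ∀ s ∈ Ioo a b, dP S s = D s
  mem : ∀ s ∈ Ioo a b, s ∈ Ioo (-S.m) S.ℓ ∧ s ≠ 0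

/-- The upper fluid. -/
def upperLayer : Layer S where
  a := 0
  b := S.ℓ
  J := heights S.Pp S.rhoP S.g
  ρ := rhoOf S.Pp S.rhoP S.g
  D := fun s => deriv S.Pp (rhoOf S.Pp S.rhoP S.g s)
  lt := S.ℓ_pos
  isOpen := S.law_p.isOpen_heights
  subset := S.law_p.ordConnected_heights ⟨S.rhoP, S.rhoP_pos, by simp⟩ S.top
  smooth_ρ := S.law_p.contDiffOn_rhoOf
  smooth_D := S.law_p.contDiffOn_deriv.comp S.law_p.contDiffOn_rhoOf fun _ hs => rhoOf_pos hs
  ρ_pos := fun _ hs => rhoOf_pos hs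
  D_pos := fun _ hs => S.law_p.deriv_pos _ (rhoOf_pos hs)
  hasDerivAt_ρ := fun _ hs => S.law_p.hasDerivAt_rhoOf hs
  rho_eq := fun s hs => by simp [rho, rhoOf, not_lt.2 hs.1.le]
  dP_eq := fun s hs => by simp [dP, rho, rhoOf, not_lt.2 hs.1.le]
  mem := fun s hs => ⟨⟨(neg_lt_zero.2 S.m_pos).trans hs.1, hs.2⟩, hs.1.ne'⟩

/-- The lower fluid. -/
def lowerLayer : Layer S where
  a := -S.m
  b := 0
  J := heights S.Pm S.rhoM S.g
  ρ := rhoOf S.Pm S.rhoM S.g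
  D := fun s => deriv S.Pm (rhoOf S.Pm S.rhoM S.g s)
  lt := neg_lt_zero.2 S.m_pos
  isOpen := S.law_m.isOpen_heights
  subset := S.law_m.ordConnected_heights (by simpa [heights] using S.bottom)
    ⟨S.rhoM, S.rhoM_pos, by simp⟩
  smooth_ρ := S.law_m.contDiffOn_rhoOf
  smooth_D := S.law_m.contDiffOn_deriv.comp S.law_m.contDiffOn_rhoOf fun _ hs => rhoOf_pos hs
  ρ_pos := fun _ hs => rhoOf_pos hs
  D_pos := fun _ hs => S.law_m.deriv_pos _ (rhoOf_pos hs)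
  hasDerivAt_ρ := fun _ hs => S.law_m.hasDerivAt_rhoOf hs
  rho_eq := fun s hs => by simp [rho, rhoOf, hs.2]
  dP_eq := fun s hs => by simp [dP, rho, rhoOf, hs.2]
  mem := fun s hs => ⟨⟨hs.1, hs.2.trans S.ℓ_pos⟩, hs.2.ne⟩

theorem upperLayer_ρ_zero : (upperLayer S).ρ 0 = S.rhoP := S.law_p.rhoOf_zero S.rhoP_pos

theorem lowerLayer_ρ_zero : (lowerLayer S).ρ 0 = S.rhoM := S.law_m.rhoOf_zero S.rhoM_pos

/-- This inequality is the source of the instability: it gives the interface contribution to the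
energy its negative sign. -/
theorem rhoM_lt_rhoP : S.rhoM < S.rhoP :=
  (S.law_p.strictMono.lt_iff_lt S.rhoM_pos S.rhoP_pos).1 (by rw [S.pressure_eq]; exact S.unstable)

theorem rho_of_nonneg {s : ℝ} (hs : 0 ≤ s) : rho S s = (upperLayer S).ρ s := by
  simp [rho, rhoOf, upperLayer, not_lt.2 hs]

theorem rho_of_neg {s : ℝ} (hs : s < 0) : rho S s = (lowerLayer S).ρ s := by
  simp [rho, rhoOf, lowerLayer, hs]

theorem dP_of_nonneg {s : ℝ} (hs : 0 ≤ s) : dP S s = (upperLayer S).D s := by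
  simp [dP, rho, rhoOf, upperLayer, not_lt.2 hs]

theorem dP_of_neg {s : ℝ} (hs : s < 0) : dP S s = (lowerLayer S).D s := by
  simp [dP, rho, rhoOf, lowerLayer, hs]

theorem Layer.exists_bounds {S : Params} (L : Layer S) : ∃ c C : ℝ, 0 < c ∧ ∀ s ∈ Icc L.a L.b,
    (c ≤ L.ρ s ∧ L.ρ s ≤ C) ∧ (c ≤ L.D s ∧ L.D s ≤ C) := by
  have hne : (Icc L.a L.b).Nonempty := nonempty_Icc.2 L.lt.le
  have h1 := L.smooth_ρ.continuousOn.mono L.subset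
  have h2 := L.smooth_D.continuousOn.mono L.subset
  obtain ⟨x1, hx1, m1⟩ := isCompact_Icc.exists_isMinOn hne h1
  obtain ⟨x2, hx2, m2⟩ := isCompact_Icc.exists_isMaxOn hne h1
  obtain ⟨x3, hx3, m3⟩ := isCompact_Icc.exists_isMinOn hne h2
  obtain ⟨x4, hx4, m4⟩ := isCompact_Icc.exists_isMaxOn hne h2
  exact ⟨min (L.ρ x1) (L.D x3), max (L.ρ x2) (L.D x4),
    lt_min (L.ρ_pos _ (L.subset hx1)) (L.D_pos _ (L.subset hx3)), fun s hs =>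
    ⟨⟨(min_le_left _ _).trans (m1 hs), (m2 hs).trans (le_max_left _ _)⟩,
      (min_le_right _ _).trans (m3 hs), (m4 hs).trans (le_max_right _ _)⟩⟩

theorem exists_coeff_bounds : ∃ c C : ℝ, 0 < c ∧ ∀ s ∈ Icc (-S.m) S.ℓ,
    (c ≤ rho S s ∧ rho S s ≤ C) ∧ (c ≤ dP S s ∧ dP S s ≤ C) := by
  obtain ⟨c1, C1, h1, H1⟩ := (upperLayer S).exists_bounds
  obtain ⟨c2, C2, h2, H2⟩ := (lowerLayer S).exists_bounds
  refine ⟨min c1 c2, max C1 C2, lt_min h1 h2, fun s hs => ?_⟩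
  rcases lt_or_ge s 0 with h | h
  · rw [rho_of_neg S h, dP_of_neg S h]
    have := H2 s ⟨hs.1, h.le⟩
    exact ⟨⟨(min_le_right _ _).trans this.1.1, this.1.2.trans (le_max_right _ _)⟩,
      (min_le_right _ _).trans this.2.1, this.2.2.trans (le_max_right _ _)⟩
  · rw [rho_of_nonneg S h, dP_of_nonneg S h]
    have := H1 s ⟨h, hs.2⟩
    exact ⟨⟨(min_le_left _ _).trans this.1.1, this.1.2.trans (le_max_left _ _)⟩,
      (min_le_left _ _).trans this.2.1, this.2.2.trans (le_max_left _ _)⟩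

/-- A lower bound for the coefficients. -/
def cmin : ℝ := (exists_coeff_bounds S).choose

/-- An upper bound for the coefficients. -/
def cmax : ℝ := (exists_coeff_bounds S).choose_spec.choose

theorem cmin_pos : 0 < cmin S := (exists_coeff_bounds S).choose_spec.choose_spec.1

theorem cmin_le_rho {s : ℝ} (hs : s ∈ Icc (-S.m) S.ℓ) : cmin S ≤ rho S s :=
  ((exists_coeff_bounds S).choose_spec.choose_spec.2 s hs).1.1

theorem rho_le_cmax {s : ℝ} (hs : s ∈ Icc (-S.m) S.ℓ) : rho S s ≤ cmax S :=
  ((exists_coeff_bounds S).choose_spec.choose_spec.2 s hs).1.2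

theorem cmin_le_dP {s : ℝ} (hs : s ∈ Icc (-S.m) S.ℓ) : cmin S ≤ dP S s :=
  ((exists_coeff_bounds S).choose_spec.choose_spec.2 s hs).2.1

theorem dP_le_cmax {s : ℝ} (hs : s ∈ Icc (-S.m) S.ℓ) : dP S s ≤ cmax S :=
  ((exists_coeff_bounds S).choose_spec.choose_spec.2 s hs).2.2

theorem cmin_le_cmax : cmin S ≤ cmax S := by
  have h : (0 : ℝ) ∈ Icc (-S.m) S.ℓ := ⟨by linarith [S.m_pos], S.ℓ_pos.le⟩
  exact (cmin_le_rho S h).trans (rho_le_cmax S h)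

theorem cmax_pos : 0 < cmax S := (cmin_pos S).trans_le (cmin_le_cmax S)

/-- At the interface the coefficients take the values of the upper fluid, so they are continuous
from the right everywhere. Right derivatives of solutions therefore exist also at the interface, and
Grönwall's inequality needs no more. -/
theorem continuousWithinAt_coeff {s : ℝ} (hs : s ∈ Ico (-S.m) S.ℓ) :
    ContinuousWithinAt (rho S) (Ici s) s ∧ ContinuousWithinAt (dP S) (Ici s) s := by
  rcases lt_or_ge s 0 with h | h
  · have hJ := (lowerLayer S).isOpen.mem_nhds ((lowerLayer S).subset ⟨hs.1, h.le⟩)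
    have hev : ∀ᶠ t in 𝓝 s, t < 0 := Iio_mem_nhds h
    refine ⟨ContinuousAt.continuousWithinAt ?_, ContinuousAt.continuousWithinAt ?_⟩
    · refine ((lowerLayer S).smooth_ρ.continuousOn.continuousAt hJ).congr ?_
      filter_upwards [hev] with t ht using (rho_of_neg S ht).symm
    · refine ((lowerLayer S).smooth_D.continuousOn.continuousAt hJ).congr ?_
      filter_upwards [hev] with t ht using (dP_of_neg S ht).symm
  · have hJ := (upperLayer S).isOpen.mem_nhds ((upperLayer S).subset ⟨h, hs.2.le⟩)
    refine ⟨?_, ?_⟩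
    · refine ((upperLayer S).smooth_ρ.continuousOn.continuousAt hJ).continuousWithinAt.congr ?_ ?_
      · exact fun t ht => rho_of_nonneg S (h.trans ht)
      · exact rho_of_nonneg S h
    · refine ((upperLayer S).smooth_D.continuousOn.continuousAt hJ).continuousWithinAt.congr ?_ ?_
      · exact fun t ht => dP_of_nonneg S (h.trans ht)
      · exact dP_of_nonneg S h

/-- Lebesgue measure on `(-m, ℓ)`. -/
abbrev vert : Measure ℝ := volume.restrict (Ioo (-S.m) S.ℓ)

theorem neg_m_lt_ℓ : -S.m < S.ℓ := by linarith [S.m_pos, S.ℓ_pos]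

theorem aestronglyMeasurable_vert_of_layers {f : ℝ → ℝ} (h1 : ContinuousOn f (Ioo (-S.m) 0))
    (h2 : ContinuousOn f (Ioo 0 S.ℓ)) : AEStronglyMeasurable f (vert S) := by
  have h3 := (h1.aestronglyMeasurable (μ := volume) measurableSet_Ioo)
  have h4 := (h2.aestronglyMeasurable (μ := volume) measurableSet_Ioo)
  have := aestronglyMeasurable_union_iff.2 ⟨h3, h4⟩
  have h5 : Ioo (-S.m) S.ℓ =ᵐ[volume] (Ioo (-S.m) 0 ∪ Ioo 0 S.ℓ : Set ℝ) := by
    have : Ioo (-S.m) S.ℓ \ {0} = (Ioo (-S.m) 0 ∪ Ioo 0 S.ℓ : Set ℝ) := by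
      ext s
      simp only [Set.mem_sdiff, mem_Ioo, mem_singleton_iff, mem_union]
      constructor
      · rintro ⟨⟨h1, h2⟩, h3⟩
        rcases lt_or_gt_of_ne h3 with h | h
        · exact Or.inl ⟨h1, h⟩
        · exact Or.inr ⟨h, h2⟩
      · rintro (⟨h1, h2⟩ | ⟨h1, h2⟩)
        · exact ⟨⟨h1, h2.trans S.ℓ_pos⟩, h2.ne⟩
        · exact ⟨⟨(neg_lt_zero.2 S.m_pos).trans h1, h2⟩, h1.ne'⟩
    rw [← this]
    exact (sdiff_null_ae_eq_self (measure_singleton 0)).symm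
  rwa [vert, Measure.restrict_congr_set h5]

theorem aestronglyMeasurable_rho : AEStronglyMeasurable (rho S) (vert S) :=
  aestronglyMeasurable_vert_of_layers S
    (((lowerLayer S).smooth_ρ.continuousOn.mono (Ioo_subset_Icc_self.trans
      (lowerLayer S).subset)).congr fun _ hs => (lowerLayer S).rho_eq _ hs)
    (((upperLayer S).smooth_ρ.continuousOn.mono (Ioo_subset_Icc_self.trans
      (upperLayer S).subset)).congr fun _ hs => (upperLayer S).rho_eq _ hs)

theorem aestronglyMeasurable_dP : AEStronglyMeasurable (dP S) (vert S) :=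
  aestronglyMeasurable_vert_of_layers S
    (((lowerLayer S).smooth_D.continuousOn.mono (Ioo_subset_Icc_self.trans
      (lowerLayer S).subset)).congr fun _ hs => (lowerLayer S).dP_eq _ hs)
    (((upperLayer S).smooth_D.continuousOn.mono (Ioo_subset_Icc_self.trans
      (upperLayer S).subset)).congr fun _ hs => (upperLayer S).dP_eq _ hs)

end RayleighTaylor

end

noncomputable section

namespace RayleighTaylor

variable (S : Params)

/-! ### The energy as a quadratic form -/

theorem integral_vert (f : ℝ → ℝ) : ∫ s in (-S.m)..S.ℓ, f s = ∫ s, f s ∂(vert S) := by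
  rw [intervalIntegral.integral_of_le (neg_m_lt_ℓ S).le, integral_Ioc_eq_integral_Ioo]

theorem ae_vert_mem : ∀ᵐ s ∂(vert S), s ∈ Ioo (-S.m) S.ℓ := ae_restrict_mem measurableSet_Ioo

variable {S}

theorem IsL2.bdd_mul {b f : ℝ → ℝ} {C : ℝ} (hb : AEStronglyMeasurable b (vert S))
    (hC : ∀ s ∈ Ioo (-S.m) S.ℓ, |b s| ≤ C) (hf : IsL2 S f) : IsL2 S fun s => b s * f s := by
  refine MemLp.of_le_mul (c := C) hf (hb.mul hf.1) ?_
  filter_upwards [ae_vert_mem S] with s hs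
  rw [Real.norm_eq_abs, abs_mul]
  exact mul_le_mul_of_nonneg_right (hC s hs) (abs_nonneg _)

theorem abs_rho_le {s : ℝ} (hs : s ∈ Ioo (-S.m) S.ℓ) : |rho S s| ≤ cmax S := by
  rw [abs_of_nonneg ((cmin_pos S).le.trans (cmin_le_rho S (Ioo_subset_Icc_self hs)))]
  exact rho_le_cmax S (Ioo_subset_Icc_self hs)

theorem abs_dP_le {s : ℝ} (hs : s ∈ Ioo (-S.m) S.ℓ) : |dP S s| ≤ cmax S := by
  rw [abs_of_nonneg ((cmin_pos S).le.trans (cmin_le_dP S (Ioo_subset_Icc_self hs)))]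
  exact dP_le_cmax S (Ioo_subset_Icc_self hs)

theorem rho_pos {s : ℝ} (hs : s ∈ Icc (-S.m) S.ℓ) : 0 < rho S s :=
  (cmin_pos S).trans_le (cmin_le_rho S hs)

theorem dP_pos {s : ℝ} (hs : s ∈ Icc (-S.m) S.ℓ) : 0 < dP S s :=
  (cmin_pos S).trans_le (cmin_le_dP S hs)

theorem IsL2.rho_mul {f : ℝ → ℝ} (hf : IsL2 S f) : IsL2 S fun s => rho S s * f s :=
  hf.bdd_mul (aestronglyMeasurable_rho S) fun _ => abs_rho_le

theorem IsL2.dP_mul {f : ℝ → ℝ} (hf : IsL2 S f) : IsL2 S fun s => dP S s * f s :=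
  hf.bdd_mul (aestronglyMeasurable_dP S) fun _ => abs_dP_le

theorem IsL2.add {f g : ℝ → ℝ} (hf : IsL2 S f) (hg : IsL2 S g) : IsL2 S fun s => f s + g s :=
  MemLp.add hf hg

theorem IsL2.sub {f g : ℝ → ℝ} (hf : IsL2 S f) (hg : IsL2 S g) : IsL2 S fun s => f s - g s :=
  MemLp.sub hf hg

theorem IsL2.const_mul {f : ℝ → ℝ} (hf : IsL2 S f) (c : ℝ) : IsL2 S fun s => c * f s :=
  MemLp.const_mul hf c

theorem IsL2.integrable_mul {f g : ℝ → ℝ} (hf : IsL2 S f) (hg : IsL2 S g) :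
    Integrable (fun s => f s * g s) (vert S) := MemLp.integrable_mul hf hg

theorem IsL2.integrable {f : ℝ → ℝ} (hf : IsL2 S f) : Integrable f (vert S) :=
  MemLp.integrable (by norm_num) hf

theorem isL2_const (c : ℝ) : IsL2 S fun _ => c := memLp_const c

theorem IsL2.intervalIntegrable {f : ℝ → ℝ} (hf : IsL2 S f) :
    IntervalIntegrable f volume (-S.m) S.ℓ := by
  rw [intervalIntegrable_iff_integrableOn_Ioo_of_le (neg_m_lt_ℓ S).le]
  exact hf.integrable

theorem IsL2.intervalIntegrable' {f : ℝ → ℝ} (hf : IsL2 S f) {a b : ℝ}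
    (ha : a ∈ Icc (-S.m) S.ℓ) (hb : b ∈ Icc (-S.m) S.ℓ) : IntervalIntegrable f volume a b := by
  refine hf.intervalIntegrable.mono_set ?_
  rw [uIcc_of_le (neg_m_lt_ℓ S).le]
  exact (convex_Icc _ _).ordConnected.uIcc_subset ha hb

theorem isL2_of_continuousOn {f : ℝ → ℝ} (hf : ContinuousOn f (Icc (-S.m) S.ℓ)) : IsL2 S f := by
  obtain ⟨C, hC⟩ := isCompact_Icc.exists_bound_of_continuousOn hf
  refine MemLp.of_bound ((hf.mono Ioo_subset_Icc_self).aestronglyMeasurable measurableSet_Ioo) C ?_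
  filter_upwards [ae_vert_mem S] with s hs using hC s (Ioo_subset_Icc_self hs)

theorem continuousOn_primitive_of_isL2 {f : ℝ → ℝ} (hf : IsL2 S f) :
    ContinuousOn (fun s => ∫ τ in (-S.m)..s, f τ) (Icc (-S.m) S.ℓ) := by
  have := intervalIntegral.continuousOn_primitive_interval' hf.intervalIntegrable
    (a := -S.m) left_mem_uIcc
  rwa [uIcc_of_le (neg_m_lt_ℓ S).le] at this

theorem IsH10.continuousOn {ψ d : ℝ → ℝ} (h : IsH10 S ψ d) : ContinuousOn ψ (Icc (-S.m) S.ℓ) :=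
  (continuousOn_primitive_of_isL2 h.memLp).congr h.primitive

theorem IsH10.isL2 {ψ d : ℝ → ℝ} (h : IsH10 S ψ d) : IsL2 S ψ := isL2_of_continuousOn h.continuousOn

theorem IsH10.add_mul {ψ d ψ' d' : ℝ → ℝ} (h : IsH10 S ψ d) (h' : IsH10 S ψ' d') (c : ℝ) :
    IsH10 S (fun s => ψ s + c * ψ' s) (fun s => d s + c * d' s) where
  memLp := h.memLp.add (h'.memLp.const_mul c)
  primitive s hs := by
    have h0 : -S.m ∈ Icc (-S.m) S.ℓ := ⟨le_rfl, (neg_m_lt_ℓ S).le⟩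
    rw [intervalIntegral.integral_add (h.memLp.intervalIntegrable' h0 hs)
      ((h'.memLp.const_mul c).intervalIntegrable' h0 hs), intervalIntegral.integral_const_mul,
      h.primitive s hs, h'.primitive s hs]
  top_eq_zero := by rw [h.top_eq_zero, h'.top_eq_zero]; ring

theorem isH10_zero : IsH10 S (fun _ => 0) (fun _ => 0) where
  memLp := isL2_const 0
  primitive s hs := by simp
  top_eq_zero := rfl

theorem IsH10.const_mul {ψ d : ℝ → ℝ} (h : IsH10 S ψ d) (c : ℝ) :
    IsH10 S (fun s => c * ψ s) (fun s => c * d s) := by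
  simpa using isH10_zero.add_mul h c

/-- The integrand of the bilinear form of `2 (E - μ J)`. -/
def formDensity (S : Params) (r μ : ℝ) (φ ψ d φ' ψ' d' : ℝ → ℝ) (s : ℝ) : ℝ :=
  dP S s * (rho S s * ((d s + r * φ s) * (d' s + r * φ' s)))
    - S.g * r * (rho S s * (ψ s * φ' s) + rho S s * (φ s * ψ' s))
    - μ * (rho S s * (φ s * φ' s) + rho S s * (ψ s * ψ' s))

/-- The bilinear form of `2 (E - μ J)`. -/
def form (S : Params) (r μ : ℝ) (φ ψ d φ' ψ' d' : ℝ → ℝ) : ℝ :=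
  ∫ s, formDensity S r μ φ ψ d φ' ψ' d' s ∂(vert S)

theorem integrable_formDensity {r μ : ℝ} {φ ψ d φ' ψ' d' : ℝ → ℝ} (hφ : IsL2 S φ) (hψ : IsL2 S ψ)
    (hd : IsL2 S d) (hφ' : IsL2 S φ') (hψ' : IsL2 S ψ') (hd' : IsL2 S d') :
    Integrable (formDensity S r μ φ ψ d φ' ψ' d') (vert S) := by
  have key : ∀ {f g : ℝ → ℝ}, IsL2 S f → IsL2 S g →
      Integrable (fun s => rho S s * (f s * g s)) (vert S) := fun hf hg => by
    simpa only [mul_assoc] using hf.rho_mul.integrable_mul hg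
  refine Integrable.sub (Integrable.sub ?_ ?_) ?_
  · simpa only [mul_assoc] using
      ((hd.add (hφ.const_mul r)).rho_mul.dP_mul).integrable_mul (hd'.add (hφ'.const_mul r))
  · exact ((key hψ hφ').add (key hφ hψ')).const_mul _
  · exact ((key hφ hφ').add (key hψ hψ')).const_mul _

theorem energyE_sub_eq_form {r μ : ℝ} {φ ψ d : ℝ → ℝ} (hφ : IsL2 S φ) (hψ : IsL2 S ψ)
    (hd : IsL2 S d) :
    energyE S r φ ψ d - μ * constraintJ S φ ψ = (1 / 2) * form S r μ φ ψ d φ ψ d := by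
  have h0 := integrable_formDensity (r := r) (μ := 0) hφ hψ hd hφ hψ hd
  have h1 : Integrable (fun s => rho S s * (φ s ^ 2 + ψ s ^ 2)) (vert S) := by
    have := (hφ.rho_mul.integrable_mul hφ).add (hψ.rho_mul.integrable_mul hψ)
    refine this.congr (ae_of_all _ fun s => ?_)
    simp only [Pi.add_apply]
    ring
  have e1 : energyE S r φ ψ d = 1 / 2 * ∫ s, formDensity S r 0 φ ψ d φ ψ d s ∂(vert S) := by
    rw [energyE, integral_vert]
    congr 1
    refine integral_congr_ae (ae_of_all _ fun s => ?_)
    simp only [formDensity]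
    ring
  have e2 : form S r μ φ ψ d φ ψ d = ∫ s, formDensity S r 0 φ ψ d φ ψ d s ∂(vert S)
      - μ * ∫ s, rho S s * (φ s ^ 2 + ψ s ^ 2) ∂(vert S) := by
    rw [form, ← integral_const_mul, ← integral_sub h0 (h1.const_mul μ)]
    refine integral_congr_ae (ae_of_all _ fun s => ?_)
    simp only [formDensity]
    ring
  rw [e1, e2, constraintJ, integral_vert]
  ring

theorem form_add_mul {r μ : ℝ} {φ ψ d φ' ψ' d' : ℝ → ℝ} (hφ : IsL2 S φ) (hψ : IsL2 S ψ)
    (hd : IsL2 S d) (hφ' : IsL2 S φ') (hψ' : IsL2 S ψ') (hd' : IsL2 S d') (t : ℝ) :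
    form S r μ (fun s => φ s + t * φ' s) (fun s => ψ s + t * ψ' s) (fun s => d s + t * d' s)
      (fun s => φ s + t * φ' s) (fun s => ψ s + t * ψ' s) (fun s => d s + t * d' s) =
    form S r μ φ ψ d φ ψ d + (2 * t) * form S r μ φ ψ d φ' ψ' d'
      + t ^ 2 * form S r μ φ' ψ' d' φ' ψ' d' := by
  have h1 := integrable_formDensity (r := r) (μ := μ) hφ hψ hd hφ hψ hd
  have h2 := integrable_formDensity (r := r) (μ := μ) hφ hψ hd hφ' hψ' hd'
  have h3 := integrable_formDensity (r := r) (μ := μ) hφ' hψ' hd' hφ' hψ' hd'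
  have h4 : Integrable (fun s => formDensity S r μ φ ψ d φ ψ d s
      + 2 * t * formDensity S r μ φ ψ d φ' ψ' d' s) (vert S) := h1.add (h2.const_mul _)
  simp only [form]
  rw [← integral_const_mul, ← integral_const_mul, ← integral_add h1 (h2.const_mul _),
    ← integral_add h4 (h3.const_mul _)]
  refine integral_congr_ae (ae_of_all _ fun s => ?_)
  simp only [formDensity]
  ring

/-! ### Boundedness below of the energy and the first variation. -/

theorem constraintJ_nonneg (φ ψ : ℝ → ℝ) : 0 ≤ constraintJ S φ ψ := by
  rw [constraintJ, integral_vert]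
  refine mul_nonneg (by norm_num) (integral_nonneg_of_ae ?_)
  filter_upwards [ae_vert_mem S] with s hs
  have := rho_pos (Ioo_subset_Icc_self hs)
  simp only [Pi.zero_apply]
  positivity

/-- The compression square is nonnegative, and `2 r φ ψ ≤ |r| (φ² + ψ²)` bounds the gravity term by
the density of `J`. This becomes `λ² ≤ g r`. -/
theorem energyE_ge {r : ℝ} {φ ψ d : ℝ → ℝ} (hφ : IsL2 S φ) (hψ : IsL2 S ψ) (hd : IsL2 S d) :
    -(S.g * |r|) * constraintJ S φ ψ ≤ energyE S r φ ψ d := by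
  have h := energyE_sub_eq_form (r := r) (μ := -(S.g * |r|)) hφ hψ hd
  have : 0 ≤ form S r (-(S.g * |r|)) φ ψ d φ ψ d := by
    refine integral_nonneg_of_ae ?_
    filter_upwards [ae_vert_mem S] with s hs
    have h1 := rho_pos (Ioo_subset_Icc_self hs)
    have h2 := dP_pos (Ioo_subset_Icc_self hs)
    have h3 := S.g_pos
    simp only [Pi.zero_apply, formDensity]
    have h4 : 0 ≤ dP S s * (rho S s * ((d s + r * φ s) * (d s + r * φ s))) := by
      have := mul_self_nonneg (d s + r * φ s)
      positivity
    have h5 : 0 ≤ |r| * (φ s * φ s + ψ s * ψ s) - 2 * r * (ψ s * φ s) := by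
      rcases abs_cases r with ⟨h, h'⟩ | ⟨h, h'⟩ <;> rw [h]
      · nlinarith [mul_nonneg h' (mul_self_nonneg (φ s - ψ s))]
      · nlinarith [mul_nonneg (neg_nonneg.2 h'.le) (mul_self_nonneg (φ s + ψ s))]
    have h6 : 0 ≤ S.g * rho S s * (|r| * (φ s * φ s + ψ s * ψ s) - 2 * r * (ψ s * φ s)) := by
      positivity
    linarith
  linarith

theorem bddBelow_energy (r : ℝ) :
    BddBelow {e : ℝ | ∃ φ ψ d : ℝ → ℝ, IsAdmissible S φ ψ d ∧ e = energyE S r φ ψ d} := by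
  refine ⟨-(S.g * |r|), ?_⟩
  rintro e ⟨φ, ψ, d, h, rfl⟩
  simpa [h.constraint] using energyE_ge (r := r) h.memL2 h.memH10.isL2 h.memH10.memLp

theorem mu_le_energyE {r : ℝ} {φ ψ d : ℝ → ℝ} (h : IsAdmissible S φ ψ d) :
    mu S r ≤ energyE S r φ ψ d :=
  csInf_le (bddBelow_energy r) ⟨φ, ψ, d, h, rfl⟩

theorem form_smul {r μ : ℝ} {φ ψ d : ℝ → ℝ} (t : ℝ) :
    form S r μ (fun s => t * φ s) (fun s => t * ψ s) (fun s => t * d s)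
      (fun s => t * φ s) (fun s => t * ψ s) (fun s => t * d s) =
    t ^ 2 * form S r μ φ ψ d φ ψ d := by
  simp only [form]
  rw [← integral_const_mul]
  refine integral_congr_ae (ae_of_all _ fun s => ?_)
  simp only [formDensity]
  ring

theorem constraintJ_smul {φ ψ : ℝ → ℝ} (t : ℝ) :
    constraintJ S (fun s => t * φ s) (fun s => t * ψ s) = t ^ 2 * constraintJ S φ ψ := by
  have h : ∀ s, rho S s * ((t * φ s) ^ 2 + (t * ψ s) ^ 2)
      = t ^ 2 * (rho S s * (φ s ^ 2 + ψ s ^ 2)) := fun s => by ring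
  simp only [constraintJ, h, intervalIntegral.integral_const_mul]
  ring

theorem IsAdmissible.of_pos {φ ψ d : ℝ → ℝ} (hφ : IsL2 S φ) (hψ : IsH10 S ψ d)
    (hJ : 0 < constraintJ S φ ψ) :
    IsAdmissible S (fun s => (√(constraintJ S φ ψ))⁻¹ * φ s)
      (fun s => (√(constraintJ S φ ψ))⁻¹ * ψ s) (fun s => (√(constraintJ S φ ψ))⁻¹ * d s) where
  memL2 := hφ.const_mul _
  memH10 := hψ.const_mul _
  constraint := by
    rw [constraintJ_smul, inv_pow, Real.sq_sqrt hJ.le, inv_mul_cancel₀ hJ.ne']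

/-- Both functionals are homogeneous of degree two, so a pair with `J > 0` can be rescaled to
satisfy the constraint. If `J = 0` no rescaling is possible, and the lower bound of the energy takes
over. -/
theorem form_mu_nonneg {r : ℝ} {φ ψ d : ℝ → ℝ} (hφ : IsL2 S φ) (hψ : IsH10 S ψ d) :
    0 ≤ form S r (mu S r) φ ψ d φ ψ d := by
  rcases (constraintJ_nonneg (S := S) φ ψ).eq_or_lt with hJ | hJ
  · have h := energyE_sub_eq_form (r := r) (μ := mu S r) hφ hψ.isL2 hψ.memLp
    have h2 := energyE_ge (r := r) hφ hψ.isL2 hψ.memLp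
    rw [← hJ] at h h2
    linarith
  · have ha := IsAdmissible.of_pos hφ hψ hJ
    have h1 := mu_le_energyE (r := r) ha
    have h2 := energyE_sub_eq_form (r := r) (μ := mu S r) ha.memL2 ha.memH10.isL2 ha.memH10.memLp
    rw [ha.constraint, form_smul] at h2
    have h3 : 0 < (√(constraintJ S φ ψ))⁻¹ ^ 2 := by positivity
    have h4 : 0 ≤ (√(constraintJ S φ ψ))⁻¹ ^ 2 * form S r (mu S r) φ ψ d φ ψ d := by linarith
    exact nonneg_of_mul_nonneg_right h4 h3

theorem mu_mul_constraintJ_le {r : ℝ} {φ ψ d : ℝ → ℝ} (hφ : IsL2 S φ) (hψ : IsH10 S ψ d) :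
    mu S r * constraintJ S φ ψ ≤ energyE S r φ ψ d := by
  have h := energyE_sub_eq_form (r := r) (μ := mu S r) hφ hψ.isL2 hψ.memLp
  linarith [form_mu_nonneg (r := r) hφ hψ]

/-- The first variation at a minimizer vanishes. -/
theorem form_eq_zero_of_minimal {r : ℝ} {φ ψ d φ' ψ' d' : ℝ → ℝ} (h : IsAdmissible S φ ψ d)
    (hmin : energyE S r φ ψ d = mu S r) (hφ' : IsL2 S φ') (hψ' : IsH10 S ψ' d') :
    form S r (mu S r) φ ψ d φ' ψ' d' = 0 := by
  have h0 : form S r (mu S r) φ ψ d φ ψ d = 0 := by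
    have := energyE_sub_eq_form (r := r) (μ := mu S r) h.memL2 h.memH10.isL2 h.memH10.memLp
    rw [hmin, h.constraint] at this
    linarith
  have key : ∀ t : ℝ, 0 ≤ (2 * t) * form S r (mu S r) φ ψ d φ' ψ' d'
      + t ^ 2 * form S r (mu S r) φ' ψ' d' φ' ψ' d' := fun t => by
    have := form_add_mul (r := r) (μ := mu S r) h.memL2 h.memH10.isL2 h.memH10.memLp hφ'
      hψ'.isL2 hψ'.memLp t
    have h2 := form_mu_nonneg (r := r) (h.memL2.add (hφ'.const_mul t)) (h.memH10.add_mul hψ' t)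
    rw [h0] at this
    linarith
  generalize form S r (mu S r) φ ψ d φ' ψ' d' = A at key ⊢
  have hB := form_mu_nonneg (r := r) hφ' hψ'
  generalize form S r (mu S r) φ' ψ' d' φ' ψ' d' = B at key hB
  by_contra hA
  -- The quadratic `2tA + t²B` is strictly negative at this `t` unless `A = 0`; the summand `1`
  -- covers `B = 0`.
  have h1 := key (-A / (B + 1))
  have hB1 : 0 < B + 1 := by linarith
  have : 2 * (-A / (B + 1)) * A + (-A / (B + 1)) ^ 2 * B
      = -(A ^ 2 * (B + 2)) / (B + 1) ^ 2 := by
    field_simp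
    ring
  rw [this] at h1
  have h2 : 0 < A ^ 2 * (B + 2) / (B + 1) ^ 2 := by positivity
  rw [neg_div] at h1
  linarith

end RayleighTaylor

end

noncomputable section

namespace RayleighTaylor

variable (S : Params)

/-! ### Negativity of the infimum -/

/-- The slope `-gρ/P'(ρ)` is bounded on the closed layer. Near the interface the density may thus be
replaced by its one-sided limit with an error linear in the distance. -/
theorem Layer.exists_lipschitz {S : Params} (L : Layer S) :
    ∃ K : ℝ, 0 ≤ K ∧ ∀ s ∈ Icc L.a L.b, ∀ t ∈ Icc L.a L.b, |L.ρ s - L.ρ t| ≤ K * |s - t| := by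
  obtain ⟨c, C, hc, h⟩ := L.exists_bounds
  have ha : L.a ∈ Icc L.a L.b := ⟨le_rfl, L.lt.le⟩
  have hC : 0 < C := hc.trans_le ((h _ ha).1.1.trans (h _ ha).1.2)
  have hg := S.g_pos
  refine ⟨S.g * C / c, by positivity, fun s hs t ht => ?_⟩
  refine (convex_Icc L.a L.b).norm_image_sub_le_of_norm_hasDerivWithin_le
    (f' := fun s => -(S.g * L.ρ s / L.D s))
    (fun x hx => (L.hasDerivAt_ρ x (L.subset hx)).hasDerivWithinAt) (fun x hx => ?_) ht hs
  have h1 := L.ρ_pos x (L.subset hx)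
  have h2 := L.D_pos x (L.subset hx)
  rw [norm_neg, Real.norm_eq_abs, abs_of_nonneg (by positivity)]
  have h3 := (h x hx).1.2
  have h4 := (h x hx).2.1
  gcongr

theorem exists_interface_bound : ∃ K : ℝ, 0 ≤ K ∧
    (∀ s ∈ Ico (-S.m) 0, rho S s ≤ S.rhoM + K * |s|) ∧
    (∀ s ∈ Icc 0 S.ℓ, S.rhoP - K * |s| ≤ rho S s) := by
  obtain ⟨K1, h1, H1⟩ := (lowerLayer S).exists_lipschitz
  obtain ⟨K2, h2, H2⟩ := (upperLayer S).exists_lipschitz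
  refine ⟨max K1 K2, h1.trans (le_max_left _ _), fun s hs => ?_, fun s hs => ?_⟩
  · have := H1 s ⟨hs.1, hs.2.le⟩ 0 ⟨(neg_lt_zero.2 S.m_pos).le, le_rfl⟩
    rw [lowerLayer_ρ_zero, sub_zero] at this
    rw [rho_of_neg S hs.2]
    have h3 := mul_le_mul_of_nonneg_right (le_max_left K1 K2) (abs_nonneg s)
    linarith [le_abs_self ((lowerLayer S).ρ s - S.rhoM)]
  · have := H2 s hs 0 ⟨le_rfl, S.ℓ_pos.le⟩
    rw [upperLayer_ρ_zero, sub_zero] at this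
    rw [rho_of_nonneg S hs.1]
    have h3 := mul_le_mul_of_nonneg_right (le_max_right K1 K2) (abs_nonneg s)
    linarith [neg_abs_le ((upperLayer S).ρ s - S.rhoP)]

/-- The hat function of half-width `δ`. -/
def hat (δ s : ℝ) : ℝ := max 0 (1 - |s| / δ)

/-- The right derivative of the hat function. -/
def hatD (δ s : ℝ) : ℝ := if s < -δ then 0 else if s < 0 then δ⁻¹ else if s < δ then -δ⁻¹ else 0

variable {δ : ℝ}

theorem hat_nonneg (δ s : ℝ) : 0 ≤ hat δ s := le_max_left _ _

theorem hat_zero : hat δ 0 = 1 := by simp [hat]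

theorem hat_of_le {s : ℝ} (hδ : 0 < δ) (h : δ ≤ |s|) : hat δ s = 0 := by
  refine max_eq_left ?_
  rw [sub_nonpos, le_div_iff₀ hδ]
  linarith

theorem hat_le_one (hδ : 0 < δ) (s : ℝ) : hat δ s ≤ 1 :=
  max_le zero_le_one (sub_le_self _ (by positivity))

theorem continuous_hat : Continuous (hat δ) := by
  unfold hat
  fun_prop

theorem measurable_hatD : Measurable (hatD δ) := by
  unfold hatD
  refine Measurable.ite measurableSet_Iio measurable_const (Measurable.ite measurableSet_Iio
    measurable_const (Measurable.ite measurableSet_Iio measurable_const measurable_const))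

theorem abs_hatD_le (hδ : 0 < δ) (s : ℝ) : |hatD δ s| ≤ δ⁻¹ := by
  have : 0 < δ⁻¹ := by positivity
  unfold hatD
  split_ifs <;> simp [abs_of_pos hδ, hδ.le]

/-- Right derivatives at the corners are enough, since the fundamental theorem of calculus is
applied in its version for continuous functions with an integrable right derivative. -/
theorem hasDerivWithinAt_hat (hδ : 0 < δ) (s : ℝ) :
    HasDerivWithinAt (hat δ) (hatD δ s) (Ioi s) s := by
  unfold hatD
  split_ifs with h1 h2 h3
  · refine ((hasDerivAt_const s (0 : ℝ)).congr_of_eventuallyEq ?_).hasDerivWithinAt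
    filter_upwards [Iio_mem_nhds h1] with t ht
    have ht : t < -δ := ht
    exact hat_of_le hδ (by rw [abs_of_neg (by linarith)]; linarith)
  · have hd : HasDerivAt (fun t : ℝ => 1 + t * δ⁻¹) δ⁻¹ s := by
      simpa using ((hasDerivAt_id s).mul_const δ⁻¹).const_add 1
    have key : ∀ t, -δ ≤ t → t ≤ 0 → hat δ t = 1 + t * δ⁻¹ := fun t h h' => by
      rw [hat, abs_of_nonpos h', max_eq_right]
      · rw [neg_div, sub_neg_eq_add, div_eq_mul_inv]
      · rw [sub_nonneg, div_le_one hδ]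
        linarith
    refine hd.hasDerivWithinAt.congr_of_eventuallyEq ?_ (key s (not_lt.1 h1) h2.le)
    filter_upwards [self_mem_nhdsWithin, nhdsWithin_le_nhds (Iio_mem_nhds h2)] with t ht ht'
    exact key t ((not_lt.1 h1).trans (le_of_lt ht)) (le_of_lt ht')
  · have hd : HasDerivAt (fun t : ℝ => 1 - t * δ⁻¹) (-δ⁻¹) s := by
      simpa using ((hasDerivAt_id s).mul_const δ⁻¹).const_sub 1
    have key : ∀ t, 0 ≤ t → t ≤ δ → hat δ t = 1 - t * δ⁻¹ := fun t h h' => by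
      rw [hat, abs_of_nonneg h, max_eq_right]
      · rw [div_eq_mul_inv]
      · rw [sub_nonneg, div_le_one hδ]
        linarith
    refine hd.hasDerivWithinAt.congr_of_eventuallyEq ?_ (key s (not_lt.1 h2) h3.le)
    filter_upwards [self_mem_nhdsWithin, nhdsWithin_le_nhds (Iio_mem_nhds h3)] with t ht ht'
    exact key t ((not_lt.1 h2).trans (le_of_lt ht)) (le_of_lt ht')
  · have key : ∀ t, δ ≤ t → hat δ t = 0 := fun t h =>
      hat_of_le hδ (h.trans (le_abs_self t))
    refine (hasDerivWithinAt_const s _ (0 : ℝ)).congr_of_eventuallyEq ?_ (key s (not_lt.1 h3))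
    filter_upwards [self_mem_nhdsWithin] with t ht
    exact key t ((not_lt.1 h3).trans (le_of_lt ht))

theorem isL2_hatD (hδ : 0 < δ) : IsL2 S (hatD δ) :=
  MemLp.of_bound measurable_hatD.aestronglyMeasurable δ⁻¹ (ae_of_all _ fun s => by
    rw [Real.norm_eq_abs]
    exact abs_hatD_le hδ s)

theorem isH10_hat (hδ : 0 < δ) (hm : δ ≤ S.m) (hℓ : δ ≤ S.ℓ) : IsH10 S (hat δ) (hatD δ) where
  memLp := isL2_hatD S hδ
  primitive s hs := by
    rw [intervalIntegral.integral_eq_sub_of_hasDeriv_right (f := hat δ) continuous_hat.continuousOn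
      (fun t _ => hasDerivWithinAt_hat hδ t)
      ((isL2_hatD S hδ).intervalIntegrable' ⟨le_rfl, (neg_m_lt_ℓ S).le⟩ hs),
      hat_of_le hδ (s := -S.m), sub_zero]
    rwa [abs_neg, abs_of_pos S.m_pos]
  top_eq_zero := hat_of_le hδ (by rwa [abs_of_pos S.ℓ_pos])

theorem integral_hat_mul_hatD (hδ : 0 < δ) {a b : ℝ} (ha : a ∈ Icc (-S.m) S.ℓ)
    (hb : b ∈ Icc (-S.m) S.ℓ) :
    ∫ s in a..b, hat δ s * hatD δ s = (hat δ b ^ 2 - hat δ a ^ 2) / 2 := by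
  have hint : IsL2 S fun s => hat δ s * hatD δ s :=
    (isL2_hatD S hδ).bdd_mul (C := 1) continuous_hat.aestronglyMeasurable fun s _ => by
      rw [abs_of_nonneg (hat_nonneg δ s)]
      exact hat_le_one hδ s
  rw [intervalIntegral.integral_eq_sub_of_hasDeriv_right (f := fun s => hat δ s ^ 2 / 2)
    ((continuous_hat.pow 2).div_const 2).continuousOn (fun t _ => ?_)
    (hint.intervalIntegrable' ha hb)]
  · ring
  · have := ((hasDerivWithinAt_hat hδ t).pow 2).div_const 2
    refine this.congr_deriv ?_
    ring

/-- The energy of the test pair with `φ = -ψ'/r`. -/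
theorem energyE_hat {r : ℝ} (hr : 0 < r) (hδ : 0 < δ) (hm : δ ≤ S.m) (hℓ : δ ≤ S.ℓ) {K : ℝ}
    (hK : 0 ≤ K) (h1 : ∀ s ∈ Ico (-S.m) 0, rho S s ≤ S.rhoM + K * |s|)
    (h2 : ∀ s ∈ Icc 0 S.ℓ, S.rhoP - K * |s| ≤ rho S s) :
    energyE S r (fun s => -r⁻¹ * hatD δ s) (hat δ) (hatD δ)
      ≤ S.g / 2 * (S.rhoM - S.rhoP + 2 * K * δ) := by
  have h0 : (0 : ℝ) ∈ Icc (-S.m) S.ℓ := ⟨(neg_lt_zero.2 S.m_pos).le, S.ℓ_pos.le⟩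
  have ha : -S.m ∈ Icc (-S.m) S.ℓ := ⟨le_rfl, (neg_m_lt_ℓ S).le⟩
  have hb : S.ℓ ∈ Icc (-S.m) S.ℓ := ⟨(neg_m_lt_ℓ S).le, le_rfl⟩
  have hL : IsL2 S fun s => hat δ s * hatD δ s :=
    (isL2_hatD S hδ).bdd_mul (C := 1) continuous_hat.aestronglyMeasurable fun s _ => by
      rw [abs_of_nonneg (hat_nonneg δ s)]
      exact hat_le_one hδ s
  -- The choice `φ = -ψ'/r` annihilates `ψ' + rφ`, and the gravity term becomes `g ∫ ρ₀ ψ ψ'`.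
  have e : energyE S r (fun s => -r⁻¹ * hatD δ s) (hat δ) (hatD δ)
      = S.g * ∫ s in (-S.m)..S.ℓ, rho S s * (hat δ s * hatD δ s) := by
    rw [energyE, ← intervalIntegral.integral_const_mul, ← intervalIntegral.integral_const_mul]
    refine intervalIntegral.integral_congr fun s _ => ?_
    field_simp
    ring
  -- Since `ψψ'` is nonnegative below and nonpositive above the interface, a one-sided bound for the
  -- density suffices in each layer. Within the support it differs from the interface value by at
  -- most `K δ`, and `∫ ψψ'` equals `1/2` below and `-1/2` above.
  have hlow : ∫ s in (-S.m)..0, rho S s * (hat δ s * hatD δ s) ≤ (S.rhoM + K * δ) * (1 / 2) := by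
    have e2 := integral_hat_mul_hatD S hδ ha h0
    rw [hat_zero, hat_of_le hδ (s := -S.m) (by rwa [abs_neg, abs_of_pos S.m_pos])] at e2
    have e3 : ∫ s in (-S.m)..0, (S.rhoM + K * δ) * (hat δ s * hatD δ s)
        = (S.rhoM + K * δ) * (1 / 2) := by
      rw [intervalIntegral.integral_const_mul, e2]
      norm_num
    rw [← e3]
    refine intervalIntegral.integral_mono_on_of_le_Ioo (by linarith [S.m_pos])
      (hL.rho_mul.intervalIntegrable' ha h0) ((hL.const_mul _).intervalIntegrable' ha h0)
      fun s hs => ?_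
    have hD : 0 ≤ hatD δ s := by
      unfold hatD
      split_ifs <;> first | positivity | linarith [hs.2]
    rcases le_or_gt δ |s| with h | h
    · simp [hat_of_le hδ h]
    · refine mul_le_mul_of_nonneg_right ((h1 s ⟨hs.1.le, hs.2⟩).trans ?_)
        (mul_nonneg (hat_nonneg _ _) hD)
      gcongr
  have hup : ∫ s in (0 : ℝ)..S.ℓ, rho S s * (hat δ s * hatD δ s)
      ≤ (S.rhoP - K * δ) * (-(1 / 2)) := by
    have e2 := integral_hat_mul_hatD S hδ h0 hb
    rw [hat_zero, hat_of_le hδ (s := S.ℓ) (by rwa [abs_of_pos S.ℓ_pos])] at e2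
    have e3 : ∫ s in (0 : ℝ)..S.ℓ, (S.rhoP - K * δ) * (hat δ s * hatD δ s)
        = (S.rhoP - K * δ) * (-(1 / 2)) := by
      rw [intervalIntegral.integral_const_mul, e2]
      norm_num
    rw [← e3]
    refine intervalIntegral.integral_mono_on_of_le_Ioo S.ℓ_pos.le
      (hL.rho_mul.intervalIntegrable' h0 hb) ((hL.const_mul _).intervalIntegrable' h0 hb)
      fun s hs => ?_
    have hi : 0 < δ⁻¹ := by positivity
    have hD : hatD δ s ≤ 0 := by
      unfold hatD
      split_ifs <;> linarith [hs.1]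
    rcases le_or_gt δ |s| with h | h
    · simp [hat_of_le hδ h]
    · refine mul_le_mul_of_nonpos_right (le_trans ?_ (h2 s ⟨hs.1.le, hs.2.le⟩))
        (mul_nonpos_of_nonneg_of_nonpos (hat_nonneg _ _) hD)
      gcongr
  rw [e, ← intervalIntegral.integral_add_adjacent_intervals
    (hL.rho_mul.intervalIntegrable' ha h0) (hL.rho_mul.intervalIntegrable' h0 hb)]
  have hg := S.g_pos
  calc _ ≤ S.g * ((S.rhoM + K * δ) * (1 / 2) + (S.rhoP - K * δ) * (-(1 / 2))) := by gcongr
    _ = _ := by ring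

/-- The pair lives on an interval of length `2δ`, where `|ψ| ≤ 1` and `|φ| ≤ 1/(rδ)`. With `δ = 1/r`
the bound is `2 cmax / r`. -/
theorem constraintJ_hat_le {r : ℝ} (hr : 0 < r) (hδ : 0 < δ) :
    constraintJ S (fun s => -r⁻¹ * hatD δ s) (hat δ) ≤ cmax S * δ * (1 + (r * δ)⁻¹ ^ 2) := by
  have hC := cmax_pos S
  set c := cmax S * (1 + (r * δ)⁻¹ ^ 2) with hc
  have hcpos : 0 ≤ c := by positivity
  have key : ∫ s, rho S s * ((-r⁻¹ * hatD δ s) ^ 2 + hat δ s ^ 2) ∂(vert S)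
      ≤ ∫ s, (Icc (-δ) δ).indicator (fun _ => c) s ∂(vert S) := by
    refine integral_mono_of_nonneg ?_ ((integrable_const c).indicator measurableSet_Icc) ?_
    · filter_upwards [ae_vert_mem S] with s hs
      have := rho_pos (Ioo_subset_Icc_self hs)
      simp only [Pi.zero_apply]
      positivity
    · filter_upwards [ae_vert_mem S] with s hs
      by_cases h : s ∈ Icc (-δ) δ
      · rw [indicator_of_mem h, hc]
        have h1 := rho_le_cmax S (Ioo_subset_Icc_self hs)
        have h2 := abs_hatD_le hδ s
        have h3 : hatD δ s ^ 2 ≤ δ⁻¹ ^ 2 := sq_le_sq' (abs_le.1 h2).1 (abs_le.1 h2).2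
        have h4 : hat δ s ^ 2 ≤ 1 := pow_le_one₀ (hat_nonneg δ s) (hat_le_one hδ s)
        have h5 : (-r⁻¹ * hatD δ s) ^ 2 + hat δ s ^ 2 ≤ 1 + (r * δ)⁻¹ ^ 2 := by
          rw [mul_pow, neg_sq, mul_inv, mul_pow]
          have : r⁻¹ ^ 2 * hatD δ s ^ 2 ≤ r⁻¹ ^ 2 * δ⁻¹ ^ 2 := by gcongr
          linarith
        gcongr
      · rw [indicator_of_notMem h]
        rw [mem_Icc, ← abs_le, not_le] at h
        have h1 : hatD δ s = 0 := by
          unfold hatD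
          rcases lt_abs.1 h with h | h
          · rw [if_neg (by linarith), if_neg (by linarith), if_neg (by linarith)]
          · rw [if_pos (by linarith)]
        simp [h1, hat_of_le hδ h.le]
  have hle : ∫ s, (Icc (-δ) δ).indicator (fun _ => c) s ∂(vert S) ≤ 2 * δ * c := by
    rw [integral_indicator_const _ measurableSet_Icc, smul_eq_mul]
    refine mul_le_mul_of_nonneg_right ?_ hcpos
    rw [Measure.real, Measure.restrict_apply measurableSet_Icc]
    refine ENNReal.toReal_le_of_le_ofReal (by positivity) ?_
    refine (measure_mono inter_subset_left).trans ?_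
    rw [Real.volume_Icc]
    exact ENNReal.ofReal_le_ofReal (by linarith)
  rw [constraintJ, integral_vert]
  calc _ ≤ 1 / 2 * (2 * δ * c) := by gcongr; exact key.trans hle
    _ = _ := by rw [hc]; ring

theorem mu_neg {r : ℝ} (hr : 0 < r) : mu S r < 0 := by
  obtain ⟨K, hK, h1, h2⟩ := exists_interface_bound S
  have hj := rhoM_lt_rhoP S
  -- This width fits into both layers and keeps the error `2Kδ` below the density jump.
  set δ := min (min S.m S.ℓ) ((S.rhoP - S.rhoM) / (4 * (K + 1))) with hδ
  have hpos : 0 < (S.rhoP - S.rhoM) / (4 * (K + 1)) := by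
    apply div_pos <;> linarith
  have hδ0 : 0 < δ := lt_min (lt_min S.m_pos S.ℓ_pos) hpos
  have hm : δ ≤ S.m := (min_le_left _ _).trans (min_le_left _ _)
  have hℓ : δ ≤ S.ℓ := (min_le_left _ _).trans (min_le_right _ _)
  have h3 : δ * (4 * (K + 1)) ≤ S.rhoP - S.rhoM :=
    (le_div_iff₀ (by linarith)).1 (min_le_right _ _)
  have h4 := energyE_hat S hr hδ0 hm hℓ hK h1 h2
  have h5 := mu_mul_constraintJ_le (r := r) ((isL2_hatD S hδ0).const_mul (-r⁻¹))
    (isH10_hat S hδ0 hm hℓ)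
  have h6 := constraintJ_nonneg (S := S) (fun s => -r⁻¹ * hatD δ s) (hat δ)
  have h7 : S.g / 2 * (S.rhoM - S.rhoP + 2 * K * δ) < 0 :=
    mul_neg_of_pos_of_neg (half_pos S.g_pos) (by nlinarith)
  by_contra h
  have := mul_nonneg (not_lt.1 h) h6
  linarith

theorem growthRate_sq {r : ℝ} (hr : 0 < r) : growthRate S r ^ 2 = -mu S r :=
  Real.sq_sqrt (by linarith [mu_neg S hr])

theorem growthRate_pos {r : ℝ} (hr : 0 < r) : 0 < growthRate S r :=
  Real.sqrt_pos.2 (by linarith [mu_neg S hr])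

/-- The real `sInf` of the empty set is `0`, so a competitor has to be exhibited before lower bounds
pass to the infimum; the rescaled pair `(1, 0)` serves. -/
theorem nonempty_energy (r : ℝ) :
    {e : ℝ | ∃ φ ψ d : ℝ → ℝ, IsAdmissible S φ ψ d ∧ e = energyE S r φ ψ d}.Nonempty := by
  have h := IsAdmissible.of_pos (S := S) (φ := fun _ => 1) (isL2_const 1) isH10_zero (by
    rw [constraintJ, integral_vert]
    refine mul_pos (by norm_num) ?_
    have h1 : ∫ _, cmin S ∂(vert S) ≤ ∫ s, rho S s * ((1 : ℝ) ^ 2 + 0 ^ 2) ∂(vert S) := by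
      refine integral_mono_ae (integrable_const _) ?_ ?_
      · have := (isL2_const (S := S) 1).rho_mul.integrable
        refine this.congr (ae_of_all _ fun s => ?_)
        simp
      · filter_upwards [ae_vert_mem S] with s hs
        simpa using cmin_le_rho S (Ioo_subset_Icc_self hs)
    refine lt_of_lt_of_le ?_ h1
    rw [integral_const, smul_eq_mul]
    refine mul_pos ?_ (cmin_pos S)
    simp only [Measure.real, Measure.restrict_apply_univ, Real.volume_Ioo]
    rw [ENNReal.toReal_ofReal (by linarith [S.m_pos, S.ℓ_pos])]
    linarith [S.m_pos, S.ℓ_pos])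
  exact ⟨_, _, _, _, h, rfl⟩

theorem neg_mul_le_mu (r : ℝ) : -(S.g * |r|) ≤ mu S r := by
  refine le_csInf (nonempty_energy S r) ?_
  rintro e ⟨φ, ψ, d, h, rfl⟩
  simpa [h.constraint] using energyE_ge (r := r) h.memL2 h.memH10.isL2 h.memH10.memLp

theorem growthRate_sq_le {r : ℝ} (hr : 0 < r) : growthRate S r ^ 2 ≤ S.g * r := by
  rw [growthRate_sq S hr]
  have := neg_mul_le_mu S r
  rw [abs_of_pos hr] at this
  linarith

/-- With hats of width `1/r` the energy stays below a negative constant up to an `O(1/r)` error,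
while `J` is at most `2 cmax / r`. The quotient forces linear growth of `λ²`. -/
theorem exists_growth_bound : ∃ C₀ C₁ C₂ : ℝ, 1 ≤ C₀ ∧ 0 < C₁ ∧ 0 < C₂ ∧
    ∀ r, C₀ ≤ r → C₁ * r - C₂ ≤ growthRate S r ^ 2 := by
  obtain ⟨K, hK, h1, h2⟩ := exists_interface_bound S
  have hj := sub_pos.2 (rhoM_lt_rhoP S)
  have hC := cmax_pos S
  have hg := S.g_pos
  -- The threshold makes a hat of width `1/r` fit into both layers. The calculation yields `K` in
  -- the third constant; `K + 1` only ensures that it is positive.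
  refine ⟨max 1 (max S.m⁻¹ S.ℓ⁻¹), S.g * (S.rhoP - S.rhoM) / (4 * cmax S),
    S.g * (K + 1) / (2 * cmax S), le_max_left _ _, by positivity, by positivity, fun r hr => ?_⟩
  have hr1 : 1 ≤ r := (le_max_left _ _).trans hr
  have hr0 : 0 < r := by linarith
  have hm : r⁻¹ ≤ S.m := inv_le_of_inv_le₀ S.m_pos
    (((le_max_left _ _).trans (le_max_right _ _)).trans hr)
  have hℓ : r⁻¹ ≤ S.ℓ := inv_le_of_inv_le₀ S.ℓ_pos
    (((le_max_right _ _).trans (le_max_right _ _)).trans hr)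
  have hδ0 : 0 < r⁻¹ := inv_pos.2 hr0
  have h4 := energyE_hat S hr0 hδ0 hm hℓ hK h1 h2
  have h5 := mu_mul_constraintJ_le (r := r) ((isL2_hatD S hδ0).const_mul (-r⁻¹))
    (isH10_hat S hδ0 hm hℓ)
  have h6 := constraintJ_hat_le S hr0 hδ0
  rw [mul_inv_cancel₀ hr0.ne'] at h6
  have h7 : growthRate S r ^ 2 * constraintJ S (fun s => -r⁻¹ * hatD r⁻¹ s) (hat r⁻¹)
      ≤ growthRate S r ^ 2 * (cmax S * r⁻¹ * (1 + (1 : ℝ)⁻¹ ^ 2)) := by gcongr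
  rw [growthRate_sq S hr0] at h7 ⊢
  have h8 : S.g / 2 * (S.rhoP - S.rhoM - 2 * K * r⁻¹) ≤ -mu S r * (2 * cmax S * r⁻¹) := by
    have e1 : 1 + (1 : ℝ)⁻¹ ^ 2 = 2 := by norm_num
    rw [e1] at h7
    linarith
  have h9 : S.g / 2 * (S.rhoP - S.rhoM - 2 * K * r⁻¹) * (r / (2 * cmax S)) ≤ -mu S r := by
    calc _ ≤ -mu S r * (2 * cmax S * r⁻¹) * (r / (2 * cmax S)) := by gcongr
      _ = _ := by field_simp
  refine le_trans ?_ h9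
  have e : S.g / 2 * (S.rhoP - S.rhoM - 2 * K * r⁻¹) * (r / (2 * cmax S))
      = S.g * (S.rhoP - S.rhoM) / (4 * cmax S) * r - S.g * K / (2 * cmax S) := by
    field_simp
    ring
  rw [e]
  gcongr
  linarith

/-- The infimum depends upper semicontinuously, hence measurably, on the frequency. -/
theorem measurable_mu : Measurable (mu S) := by
  refine measurable_of_Iio fun a => IsOpen.measurableSet ?_
  have : mu S ⁻¹' Iio a = ⋃ (φ : ℝ → ℝ) (ψ : ℝ → ℝ) (d : ℝ → ℝ) (_ : IsAdmissible S φ ψ d),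
      {r | energyE S r φ ψ d < a} := by
    ext r
    simp only [mem_preimage, mem_Iio, mem_iUnion, mem_ofPred_eq]
    constructor
    · intro h
      obtain ⟨e, ⟨φ, ψ, d, ha, rfl⟩, he⟩ := exists_lt_of_csInf_lt (nonempty_energy S r) h
      exact ⟨φ, ψ, d, ha, he⟩
    · rintro ⟨φ, ψ, d, ha, he⟩
      exact (mu_le_energyE ha).trans_lt he
  rw [this]
  refine isOpen_iUnion fun φ => isOpen_iUnion fun ψ => isOpen_iUnion fun d =>
    isOpen_iUnion fun h => ?_
  have hφ := h.memL2
  have hψ := h.memH10.isL2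
  have hd := h.memH10.memLp
  -- For a fixed pair the energy is a quadratic polynomial in the frequency, so each sublevel set in
  -- the union is open.
  have e : ∀ r, energyE S r φ ψ d = 1 / 2 * (∫ s, rho S s * (dP S s * d s) * d s ∂(vert S)
      + r * ∫ s, (rho S s * (dP S s * (2 * d s)) - rho S s * (2 * S.g * ψ s)) * φ s ∂(vert S)
      + r ^ 2 * ∫ s, rho S s * (dP S s * φ s) * φ s ∂(vert S)) := fun r => by
    have i1 := hd.dP_mul.rho_mul.integrable_mul hd
    have i2 := ((hd.const_mul 2).dP_mul.rho_mul.sub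
      (hψ.const_mul (2 * S.g)).rho_mul).integrable_mul hφ
    have i3 := hφ.dP_mul.rho_mul.integrable_mul hφ
    rw [← integral_const_mul, ← integral_const_mul, ← integral_add i1 (i2.const_mul r),
      ← integral_add (f := fun s => _ + _) (i1.add (i2.const_mul r)) (i3.const_mul _), energyE,
      integral_vert]
    congr 1
    refine integral_congr_ae (ae_of_all _ fun s => ?_)
    simp only
    ring
  simp only [e]
  exact isOpen_lt (by fun_prop) continuous_const

theorem measurable_growthRate : Measurable (growthRate S) := (measurable_mu S).neg.sqrt

end RayleighTaylor

end

noncomputable section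

namespace RayleighTaylor

variable {S : Params}

/-! ### Existence of minimizers -/

theorem inner_toLp_eq {u v : ℝ → ℝ} (hu : IsL2 S u) (hv : IsL2 S v) :
    inner ℝ (MemLp.toLp u hu) (MemLp.toLp v hv) = ∫ s, u s * v s ∂(vert S) := by
  rw [MeasureTheory.L2.inner_def]
  refine integral_congr_ae ?_
  filter_upwards [MemLp.coeFn_toLp hu, MemLp.coeFn_toLp hv] with s h1 h2
  rw [h1, h2, real_inner_eq_re_inner]
  simp [mul_comm]

theorem abs_integral_mul_le {u v : ℝ → ℝ} (hu : IsL2 S u) (hv : IsL2 S v) :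
    |∫ s, u s * v s ∂(vert S)| ≤ √(∫ s, u s * u s ∂(vert S)) * √(∫ s, v s * v s ∂(vert S)) := by
  rw [← inner_toLp_eq hu hv, ← inner_toLp_eq hu hu, ← inner_toLp_eq hv hv,
    ← norm_eq_sqrt_real_inner, ← norm_eq_sqrt_real_inner]
  exact abs_real_inner_le_norm _ _

/-- Bounded sequences in `L²` have weakly convergent subsequences: Riesz representation carries the
sequence into the dual, where the sequential Banach-Alaoglu theorem applies. -/
theorem exists_weak_subseq (f : ℕ → ℝ → ℝ) (hf : ∀ n, IsL2 S (f n)) (C : ℝ)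
    (hC : ∀ n, ∫ s, f n s * f n s ∂(vert S) ≤ C) :
    ∃ F, IsL2 S F ∧ ∃ σ : ℕ → ℕ, StrictMono σ ∧ ∀ g, IsL2 S g →
      Tendsto (fun n => ∫ s, f (σ n) s * g s ∂(vert S)) atTop (𝓝 (∫ s, F s * g s ∂(vert S))) := by
  -- This instance gives separability of `L²`, needed for sequential compactness in the weak-*
  -- topology.
  have : Fact ((2 : ℝ≥0∞) ≠ ⊤) := ⟨by norm_num⟩
  let L : ℕ → WeakDual ℝ (Lp ℝ 2 (vert S)) := fun n =>
    StrongDual.toWeakDual (InnerProductSpace.toDual ℝ _ (MemLp.toLp (f n) (hf n)))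
  have hmem : ∀ n, L n ∈ WeakDual.toStrongDual ⁻¹'
      Metric.closedBall (0 : StrongDual ℝ (Lp ℝ 2 (vert S))) (√C) := fun n => by
    simp only [mem_preimage, mem_closedBall_zero_iff]
    change ‖InnerProductSpace.toDual ℝ _ (MemLp.toLp (f n) (hf n))‖ ≤ √C
    rw [LinearIsometryEquiv.norm_map]
    refine Real.le_sqrt_of_sq_le ?_
    rw [← real_inner_self_eq_norm_sq, inner_toLp_eq]
    exact hC n
  obtain ⟨l, -, σ, hσ, hl⟩ := WeakDual.isSeqCompact_closedBall ℝ _ 0 (√C) hmem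
  set F := (InnerProductSpace.toDual ℝ (Lp ℝ 2 (vert S))).symm (WeakDual.toStrongDual l) with hF
  refine ⟨F, Lp.memLp F, σ, hσ, fun g hg => ?_⟩
  have h1 := ((WeakDual.eval_continuous (MemLp.toLp g hg)).tendsto l).comp hl
  have h2 : l (MemLp.toLp g hg) = ∫ s, F s * g s ∂(vert S) := by
    have : l (MemLp.toLp g hg) = inner ℝ F (MemLp.toLp g hg) := by
      rw [hF, InnerProductSpace.toDual_symm_apply]
      rfl
    rw [this, ← inner_toLp_eq (Lp.memLp F) hg, Lp.toLp_coeFn]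
  rw [h2] at h1
  refine h1.congr fun n => ?_
  rw [← inner_toLp_eq (hf _) hg]
  rfl

theorem energyE_eq {r : ℝ} {φ ψ d : ℝ → ℝ} (hφ : IsL2 S φ) (hψ : IsL2 S ψ) (hd : IsL2 S d) :
    energyE S r φ ψ d = 1 / 2 * ∫ s, (d s + r * φ s) * (dP S s * (rho S s * (d s + r * φ s)))
      ∂(vert S) - S.g * r * ∫ s, rho S s * ψ s * φ s ∂(vert S) := by
  have he : IsL2 S fun s => d s + r * φ s := hd.add (hφ.const_mul r)
  rw [energyE, integral_vert, ← integral_const_mul, ← integral_const_mul, ← integral_const_mul,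
    ← integral_sub ((he.integrable_mul he.rho_mul.dP_mul).const_mul _)
      ((hψ.rho_mul.integrable_mul hφ).const_mul _)]
  refine integral_congr_ae (ae_of_all _ fun s => ?_)
  simp only
  ring

theorem constraintJ_eq {φ ψ : ℝ → ℝ} (hφ : IsL2 S φ) (hψ : IsL2 S ψ) :
    constraintJ S φ ψ = 1 / 2 * (∫ s, φ s * (rho S s * φ s) ∂(vert S)
      + ∫ s, ψ s * (rho S s * ψ s) ∂(vert S)) := by
  rw [constraintJ, integral_vert,
    ← integral_add (hφ.integrable_mul hφ.rho_mul) (hψ.integrable_mul hψ.rho_mul)]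
  congr 1
  refine integral_congr_ae (ae_of_all _ fun s => ?_)
  simp only
  ring

theorem integral_sq_le {f : ℝ → ℝ} (hf : IsL2 S f) :
    cmin S * ∫ s, f s * f s ∂(vert S) ≤ ∫ s, f s * (rho S s * f s) ∂(vert S) := by
  rw [← integral_const_mul]
  refine integral_mono_ae ((hf.integrable_mul hf).const_mul _) (hf.integrable_mul hf.rho_mul) ?_
  filter_upwards [ae_vert_mem S] with s hs
  have := cmin_le_rho S (Ioo_subset_Icc_self hs)
  nlinarith [mul_self_nonneg (f s)]

theorem integral_sq_le' {f : ℝ → ℝ} (hf : IsL2 S f) :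
    cmin S ^ 2 * ∫ s, f s * f s ∂(vert S) ≤ ∫ s, f s * (dP S s * (rho S s * f s)) ∂(vert S) := by
  rw [← integral_const_mul]
  refine integral_mono_ae ((hf.integrable_mul hf).const_mul _)
    (hf.integrable_mul hf.rho_mul.dP_mul) ?_
  filter_upwards [ae_vert_mem S] with s hs
  have h1 := cmin_le_rho S (Ioo_subset_Icc_self hs)
  have h2 := cmin_le_dP S (Ioo_subset_Icc_self hs)
  have h3 := cmin_pos S
  have h4 : cmin S * cmin S ≤ dP S s * rho S s := mul_le_mul h2 h1 h3.le (h3.le.trans h2)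
  nlinarith [mul_self_nonneg (f s)]

theorem integral_sq_nonneg (f : ℝ → ℝ) : 0 ≤ ∫ s, f s * f s ∂(vert S) :=
  integral_nonneg fun s => mul_self_nonneg (f s)

theorem IsAdmissible.integral_φ_sq_le {φ ψ d : ℝ → ℝ} (h : IsAdmissible S φ ψ d) :
    ∫ s, φ s * φ s ∂(vert S) ≤ 2 / cmin S := by
  have h1 := constraintJ_eq h.memL2 h.memH10.isL2
  rw [h.constraint] at h1
  have h2 := integral_sq_le h.memL2
  have h3 := integral_sq_le h.memH10.isL2
  have h4 := mul_nonneg (cmin_pos S).le (integral_sq_nonneg (S := S) ψ)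
  rw [le_div_iff₀ (cmin_pos S)]
  linarith

theorem IsAdmissible.integral_ψ_sq_le {φ ψ d : ℝ → ℝ} (h : IsAdmissible S φ ψ d) :
    ∫ s, ψ s * ψ s ∂(vert S) ≤ 2 / cmin S := by
  have h1 := constraintJ_eq h.memL2 h.memH10.isL2
  rw [h.constraint] at h1
  have h2 := integral_sq_le h.memL2
  have h3 := integral_sq_le h.memH10.isL2
  have h4 := mul_nonneg (cmin_pos S).le (integral_sq_nonneg (S := S) φ)
  rw [le_div_iff₀ (cmin_pos S)]
  linarith

/-- Control of the compression `ψ' + r φ` by the energy. -/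
theorem IsAdmissible.integral_compression_sq_le {r : ℝ} (hr : 0 ≤ r) {φ ψ d : ℝ → ℝ}
    (h : IsAdmissible S φ ψ d) :
    cmin S ^ 2 * ∫ s, (d s + r * φ s) * (d s + r * φ s) ∂(vert S)
      ≤ 2 * energyE S r φ ψ d + 2 * (S.g * r) := by
  have hφ := h.memL2
  have hψ := h.memH10.isL2
  have h1 := energyE_eq (r := r) hφ hψ h.memH10.memLp
  have h2 := integral_sq_le' (h.memH10.memLp.add (hφ.const_mul r))
  have h3 := constraintJ_eq hφ hψ
  rw [h.constraint] at h3
  have h4 : ∫ s, rho S s * ψ s * φ s ∂(vert S) ≤ 1 := by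
    have : ∫ s, rho S s * ψ s * φ s ∂(vert S) ≤ ∫ s, 1 / 2 * (φ s * (rho S s * φ s)
        + ψ s * (rho S s * ψ s)) ∂(vert S) := by
      refine integral_mono_ae (hψ.rho_mul.integrable_mul hφ)
        (((hφ.integrable_mul hφ.rho_mul).add (hψ.integrable_mul hψ.rho_mul)).const_mul _) ?_
      filter_upwards [ae_vert_mem S] with s hs
      have := rho_pos (Ioo_subset_Icc_self hs)
      nlinarith [mul_nonneg this.le (mul_self_nonneg (φ s - ψ s))]
    rw [integral_const_mul, integral_add (hφ.integrable_mul hφ.rho_mul)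
      (hψ.integrable_mul hψ.rho_mul)] at this
    linarith
  have hg := S.g_pos
  have h5 : S.g * r * ∫ s, rho S s * ψ s * φ s ∂(vert S) ≤ S.g * r * 1 := by gcongr
  linarith

theorem primitive_eq_integral_indicator {d : ℝ → ℝ} {s : ℝ} (hs : s ∈ Icc (-S.m) S.ℓ) :
    ∫ τ in (-S.m)..s, d τ = ∫ τ, d τ * (Ioo (-S.m) s).indicator (fun _ => 1) τ ∂(vert S) := by
  have : (fun τ => d τ * (Ioo (-S.m) s).indicator (fun _ => 1) τ)
      = (Ioo (-S.m) s).indicator d := by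
    ext τ
    by_cases h : τ ∈ Ioo (-S.m) s <;> simp [h]
  rw [this, integral_indicator measurableSet_Ioo, Measure.restrict_restrict measurableSet_Ioo,
    inter_eq_left.2 (Ioo_subset_Ioo_right hs.2), intervalIntegral.integral_of_le hs.1,
    integral_Ioc_eq_integral_Ioo]

theorem isL2_indicator {s : ℝ} : IsL2 S ((Ioo (-S.m) s).indicator fun _ => 1) :=
  (isL2_const 1).indicator measurableSet_Ioo

theorem IsH10.abs_le {ψ d : ℝ → ℝ} (h : IsH10 S ψ d) {s : ℝ} (hs : s ∈ Icc (-S.m) S.ℓ) :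
    |ψ s| ≤ √(∫ s, d s * d s ∂(vert S)) * √(S.ℓ + S.m) := by
  rw [h.primitive s hs, primitive_eq_integral_indicator hs]
  refine (abs_integral_mul_le h.memLp isL2_indicator).trans ?_
  gcongr
  have : ∫ τ, (Ioo (-S.m) s).indicator (fun _ => (1 : ℝ)) τ *
      (Ioo (-S.m) s).indicator (fun _ => 1) τ ∂(vert S) ≤ ∫ τ, 1 ∂(vert S) := by
    refine integral_mono (isL2_indicator.integrable_mul isL2_indicator) (integrable_const _) ?_
    intro τ
    by_cases h : τ ∈ Ioo (-S.m) s <;> simp [h]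
  refine this.trans_eq ?_
  rw [integral_const, smul_eq_mul, mul_one]
  simp only [Measure.real, Measure.restrict_apply_univ, Real.volume_Ioo]
  rw [ENNReal.toReal_ofReal (by linarith [S.m_pos, S.ℓ_pos])]
  ring

/-- Expand `b (f - h)² ≥ 0`. The left side is affine in `f` and passes to weak limits, which turns
this inequality into weak lower semicontinuity of the quadratic integral. -/
theorem quadratic_tangent {b f h : ℝ → ℝ} (hf : IsL2 S f) (hh : IsL2 S h)
    (hbf : IsL2 S fun s => b s * f s) (hbh : IsL2 S fun s => b s * h s)
    (hb : ∀ s ∈ Ioo (-S.m) S.ℓ, 0 ≤ b s) :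
    2 * ∫ s, f s * (b s * h s) ∂(vert S) - ∫ s, h s * (b s * h s) ∂(vert S)
      ≤ ∫ s, f s * (b s * f s) ∂(vert S) := by
  rw [← integral_const_mul, ← integral_sub ((hf.integrable_mul hbh).const_mul 2)
    (hh.integrable_mul hbh)]
  refine integral_mono_ae (((hf.integrable_mul hbh).const_mul 2).sub (hh.integrable_mul hbh))
    (hf.integrable_mul hbf) ?_
  filter_upwards [ae_vert_mem S] with s hs
  nlinarith [mul_nonneg (hb s hs) (mul_self_nonneg (f s - h s))]

/-- The direct method, applied to `φ` and the compression `e = ψ' + rφ`, both bounded in `L²` along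
a minimizing sequence. The convex parts are weakly lower semicontinuous. The indefinite term `ρ₀ ψ
φ` converges because `ψ` converges strongly. The constraint could only drop in the limit, and
negativity of the infimum excludes this. -/
theorem exists_minimizer {r : ℝ} (hr : 0 < r) :
    ∃ φ ψ d : ℝ → ℝ, IsAdmissible S φ ψ d ∧ energyE S r φ ψ d = mu S r := by
  have hg := S.g_pos
  have hc := cmin_pos S
  have hex : ∀ n : ℕ, ∃ φ ψ d : ℝ → ℝ, IsAdmissible S φ ψ d ∧
      energyE S r φ ψ d < mu S r + 1 / ((n : ℝ) + 1) := fun n => by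
    obtain ⟨e, ⟨φ, ψ, d, h, rfl⟩, he⟩ := exists_lt_of_csInf_lt (nonempty_energy S r)
      (lt_add_of_pos_right (mu S r) (Nat.one_div_pos_of_nat (α := ℝ) (n := n)))
    exact ⟨φ, ψ, d, h, he⟩
  choose φ ψ d hadm hen using hex
  have heL : ∀ n, IsL2 S fun s => d n s + r * φ n s := fun n =>
    (hadm n).memH10.memLp.add ((hadm n).memL2.const_mul r)
  have hebd : ∀ n, ∫ s, (d n s + r * φ n s) * (d n s + r * φ n s) ∂(vert S)
      ≤ (2 + 2 * (S.g * r)) / cmin S ^ 2 := fun n => by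
    have h1 := (hadm n).integral_compression_sq_le hr.le
    have h2 : 1 / ((n : ℝ) + 1) ≤ 1 := by
      rw [div_le_one (by positivity)]
      linarith [Nat.cast_nonneg (α := ℝ) n]
    rw [le_div_iff₀ (by positivity)]
    linarith [hen n, mu_neg S hr]
  obtain ⟨Φ, hΦ, σ, hσ, hwφ⟩ := exists_weak_subseq φ (fun n => (hadm n).memL2) _
    fun n => (hadm n).integral_φ_sq_le
  obtain ⟨e, he, τ, hτ, hwe⟩ := exists_weak_subseq (fun n s => d (σ n) s + r * φ (σ n) s)
    (fun n => heL _) _ fun n => hebd _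
  set κ : ℕ → ℕ := fun n => σ (τ n) with hκ
  have hκt : Tendsto κ atTop atTop := hσ.tendsto_atTop.comp hτ.tendsto_atTop
  have hwφ' : ∀ f, IsL2 S f → Tendsto (fun n => ∫ s, φ (κ n) s * f s ∂(vert S)) atTop
      (𝓝 (∫ s, Φ s * f s ∂(vert S))) := fun f hf => (hwφ f hf).comp hτ.tendsto_atTop
  have hwe' : ∀ f, IsL2 S f →
      Tendsto (fun n => ∫ s, (d (κ n) s + r * φ (κ n) s) * f s ∂(vert S)) atTop
      (𝓝 (∫ s, e s * f s ∂(vert S))) := hwe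
  have hdL : IsL2 S fun s => e s - r * Φ s := he.sub (hΦ.const_mul r)
  have hwd : ∀ f, IsL2 S f → Tendsto (fun n => ∫ s, d (κ n) s * f s ∂(vert S)) atTop
      (𝓝 (∫ s, (e s - r * Φ s) * f s ∂(vert S))) := fun f hf => by
    have h1 := (hwe' f hf).sub ((hwφ' f hf).const_mul r)
    have e1 : ∫ s, (e s - r * Φ s) * f s ∂(vert S)
        = ∫ s, e s * f s ∂(vert S) - r * ∫ s, Φ s * f s ∂(vert S) := by
      rw [← integral_const_mul, ← integral_sub (he.integrable_mul hf)
        ((hΦ.integrable_mul hf).const_mul r)]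
      congr 1
      ext s
      ring
    rw [e1]
    refine h1.congr fun n => ?_
    rw [← integral_const_mul, ← integral_sub ((heL _).integrable_mul hf)
      (((hadm _).memL2.integrable_mul hf).const_mul r)]
    congr 1
    ext s
    ring
  set Ψ : ℝ → ℝ := fun s => ∫ τ in (-S.m)..s, (e τ - r * Φ τ) with hΨ
  -- The value of `ψₙ` at `s` is the pairing of its derivative with the indicator of `(-m, s)`, so
  -- weak convergence of the derivatives gives pointwise convergence.
  have hpt : ∀ s ∈ Icc (-S.m) S.ℓ, Tendsto (fun n => ψ (κ n) s) atTop (𝓝 (Ψ s)) := fun s hs => by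
    rw [hΨ]
    simp only
    rw [primitive_eq_integral_indicator hs]
    refine (hwd _ isL2_indicator).congr fun n => ?_
    rw [(hadm _).memH10.primitive s hs, primitive_eq_integral_indicator hs]
  have hH : IsH10 S Ψ fun s => e s - r * Φ s := by
    refine ⟨hdL, fun _ _ => rfl, ?_⟩
    have hmem : S.ℓ ∈ Icc (-S.m) S.ℓ := ⟨(neg_m_lt_ℓ S).le, le_rfl⟩
    have := hpt S.ℓ hmem
    simp only [(hadm _).memH10.top_eq_zero] at this
    exact (tendsto_nhds_unique this tendsto_const_nhds)
  have hΨL := hH.isL2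
  -- strong convergence of `ψ`
  obtain ⟨M, hM⟩ : ∃ M, ∀ n, ∀ s ∈ Icc (-S.m) S.ℓ, |ψ n s - Ψ s| ≤ M := by
    obtain ⟨B, hB⟩ := isCompact_Icc.exists_bound_of_continuousOn hH.continuousOn
    refine ⟨√(2 * ((2 + 2 * (S.g * r)) / cmin S ^ 2) + 2 * (r ^ 2 * (2 / cmin S)))
      * √(S.ℓ + S.m) + B, fun n s hs => ?_⟩
    refine (abs_sub _ _).trans (add_le_add (((hadm n).memH10.abs_le hs).trans ?_) (hB s hs))
    gcongr
    have h1 : ∫ s, d n s * d n s ∂(vert S) ≤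
        ∫ s, (2 * ((d n s + r * φ n s) * (d n s + r * φ n s)) + 2 * (r ^ 2 * (φ n s * φ n s)))
          ∂(vert S) := by
      refine integral_mono ((hadm n).memH10.memLp.integrable_mul (hadm n).memH10.memLp)
        ((((heL n).integrable_mul (heL n)).const_mul 2).add
          ((((hadm n).memL2.integrable_mul (hadm n).memL2).const_mul (r ^ 2)).const_mul 2)) ?_
      intro s
      nlinarith [mul_self_nonneg (d n s + 2 * (r * φ n s))]
    rw [integral_add (((heL n).integrable_mul (heL n)).const_mul 2)
      ((((hadm n).memL2.integrable_mul (hadm n).memL2).const_mul (r ^ 2)).const_mul 2),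
      integral_const_mul, integral_const_mul, integral_const_mul] at h1
    refine h1.trans ?_
    have h2 := hebd n
    have h3 := (hadm n).integral_φ_sq_le
    gcongr
  have hδL : ∀ n, IsL2 S fun s => ψ n s - Ψ s := fun n => (hadm n).memH10.isL2.sub hΨL
  have hδ : Tendsto (fun n => ∫ s, (ψ (κ n) s - Ψ s) * (ψ (κ n) s - Ψ s) ∂(vert S)) atTop
      (𝓝 0) := by
    have : (0 : ℝ) = ∫ _, 0 ∂(vert S) := by simp
    rw [this]
    refine tendsto_integral_of_dominated_convergence (fun _ => M * M)
      (fun n => ((hδL _).integrable_mul (hδL _)).1) (integrable_const _) (fun n => ?_) ?_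
    · filter_upwards [ae_vert_mem S] with s hs
      have := hM (κ n) s (Ioo_subset_Icc_self hs)
      rw [Real.norm_eq_abs, abs_mul]
      exact mul_le_mul this this (abs_nonneg _) ((abs_nonneg _).trans this)
    · filter_upwards [ae_vert_mem S] with s hs
      have h1 := (hpt s (Ioo_subset_Icc_self hs)).sub_const (Ψ s)
      rw [sub_self] at h1
      simpa using h1.mul h1
  -- By Cauchy-Schwarz, a sequence tending strongly to zero pairs to zero with any bounded sequence.
  have hcross : ∀ f : ℕ → ℝ → ℝ, (∀ n, IsL2 S (f n)) → ∀ C : ℝ,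
      (∀ n, ∫ s, f n s * f n s ∂(vert S) ≤ C) →
      Tendsto (fun n => ∫ s, (ψ (κ n) s - Ψ s) * f n s ∂(vert S)) atTop (𝓝 0) := by
    intro f hf C hC
    have h1 : Tendsto (fun n => √(∫ s, (ψ (κ n) s - Ψ s) * (ψ (κ n) s - Ψ s) ∂(vert S)) * √C)
        atTop (𝓝 0) := by simpa using hδ.sqrt.mul_const (√C)
    refine squeeze_zero_norm (fun n => ?_) h1
    refine (abs_integral_mul_le (hδL _) (hf n)).trans ?_
    gcongr
    exact hC n
  have hrhoφ : ∀ n, ∫ s, (rho S s * φ n s) * (rho S s * φ n s) ∂(vert S)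
      ≤ cmax S ^ 2 * (2 / cmin S) := fun n => by
    have h1 : ∫ s, (rho S s * φ n s) * (rho S s * φ n s) ∂(vert S)
        ≤ ∫ s, cmax S ^ 2 * (φ n s * φ n s) ∂(vert S) := by
      refine integral_mono_ae ((hadm n).memL2.rho_mul.integrable_mul (hadm n).memL2.rho_mul)
        (((hadm n).memL2.integrable_mul (hadm n).memL2).const_mul _) ?_
      filter_upwards [ae_vert_mem S] with s hs
      have h1 := rho_le_cmax S (Ioo_subset_Icc_self hs)
      have h2 := (rho_pos (Ioo_subset_Icc_self hs)).le
      have h3 : rho S s ^ 2 ≤ cmax S ^ 2 := by gcongr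
      nlinarith [mul_le_mul_of_nonneg_right h3 (mul_self_nonneg (φ n s))]
    rw [integral_const_mul] at h1
    have h2 := (hadm n).integral_φ_sq_le
    exact h1.trans (by gcongr)
  -- lower semicontinuity
  have hE : energyE S r Φ Ψ (fun s => e s - r * Φ s) ≤ mu S r := by
    have hlim : Tendsto (fun n => 1 / 2 * (2 * ∫ s, (d (κ n) s + r * φ (κ n) s) *
          (dP S s * rho S s * e s) ∂(vert S) - ∫ s, e s * (dP S s * rho S s * e s) ∂(vert S))
        - S.g * r * (∫ s, φ (κ n) s * (rho S s * Ψ s) ∂(vert S)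
          + ∫ s, (ψ (κ n) s - Ψ s) * (rho S s * φ (κ n) s) ∂(vert S))) atTop
        (𝓝 (1 / 2 * (2 * ∫ s, e s * (dP S s * rho S s * e s) ∂(vert S)
          - ∫ s, e s * (dP S s * rho S s * e s) ∂(vert S))
        - S.g * r * (∫ s, Φ s * (rho S s * Ψ s) ∂(vert S) + 0))) := by
      have h1 := hwe' (fun s => dP S s * rho S s * e s)
        (by simpa only [mul_assoc] using he.rho_mul.dP_mul)
      have h2 := hwφ' _ hΨL.rho_mul
      have h3 := hcross (fun n s => rho S s * φ (κ n) s) (fun n => (hadm _).memL2.rho_mul) _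
        fun n => hrhoφ _
      exact (((h1.const_mul 2).sub_const _).const_mul _).sub ((h2.add h3).const_mul _)
    have hup : Tendsto (fun n => mu S r + 1 / ((κ n : ℝ) + 1)) atTop (𝓝 (mu S r + 0)) :=
      (tendsto_one_div_add_atTop_nhds_zero_nat.comp hκt).const_add _
    have hle := le_of_tendsto_of_tendsto' hlim hup fun n => ?_
    · rw [energyE_eq hΦ hΨL hdL]
      have e1 : ∀ s, e s - r * Φ s + r * Φ s = e s := fun s => by ring
      simp only [e1]
      have e2 : ∫ s, e s * (dP S s * (rho S s * e s)) ∂(vert S)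
          = ∫ s, e s * (dP S s * rho S s * e s) ∂(vert S) := by simp only [mul_assoc]
      have e3 : ∫ s, rho S s * Ψ s * Φ s ∂(vert S) = ∫ s, Φ s * (rho S s * Ψ s) ∂(vert S) := by
        congr 1
        ext s
        ring
      rw [e2, e3]
      linarith
    · refine le_trans ?_ (hen (κ n)).le
      rw [energyE_eq (hadm _).memL2 (hadm _).memH10.isL2 (hadm _).memH10.memLp]
      have h1 := quadratic_tangent (b := fun s => dP S s * rho S s) (heL (κ n)) he
        (by simpa only [mul_assoc] using (heL (κ n)).rho_mul.dP_mul)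
        (by simpa only [mul_assoc] using he.rho_mul.dP_mul)
        fun s hs => (mul_pos (dP_pos (Ioo_subset_Icc_self hs))
          (rho_pos (Ioo_subset_Icc_self hs))).le
      have h2 : ∫ s, rho S s * ψ (κ n) s * φ (κ n) s ∂(vert S)
          = ∫ s, φ (κ n) s * (rho S s * Ψ s) ∂(vert S)
          + ∫ s, (ψ (κ n) s - Ψ s) * (rho S s * φ (κ n) s) ∂(vert S) := by
        rw [← integral_add ((hadm _).memL2.integrable_mul hΨL.rho_mul)
          ((hδL _).integrable_mul (hadm _).memL2.rho_mul)]
        congr 1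
        ext s
        ring
      rw [h2]
      simp only [mul_assoc] at h1 ⊢
      linarith
  have hJ : constraintJ S Φ Ψ ≤ 1 := by
    have hlim : Tendsto (fun n => 1 / 2 * ((2 * ∫ s, φ (κ n) s * (rho S s * Φ s) ∂(vert S)
          - ∫ s, Φ s * (rho S s * Φ s) ∂(vert S))
        + (2 * ∫ s, (ψ (κ n) s - Ψ s) * (rho S s * Ψ s) ∂(vert S)
          + ∫ s, Ψ s * (rho S s * Ψ s) ∂(vert S)))) atTop
        (𝓝 (1 / 2 * ((2 * ∫ s, Φ s * (rho S s * Φ s) ∂(vert S)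
          - ∫ s, Φ s * (rho S s * Φ s) ∂(vert S))
        + (2 * 0 + ∫ s, Ψ s * (rho S s * Ψ s) ∂(vert S))))) := by
      have h2 := hwφ' _ hΦ.rho_mul
      have h3 := hcross (fun n s => rho S s * Ψ s) (fun n => hΨL.rho_mul) _ fun n => le_rfl
      exact (((h2.const_mul 2).sub_const _).add ((h3.const_mul 2).add_const _)).const_mul _
    have hle := le_of_tendsto' hlim (b := 1) fun n => ?_
    · rw [constraintJ_eq hΦ hΨL]
      linarith
    · have hcon := (hadm (κ n)).constraint
      rw [constraintJ_eq (hadm _).memL2 (hadm _).memH10.isL2] at hcon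
      have hb : ∀ s ∈ Ioo (-S.m) S.ℓ, 0 ≤ rho S s := fun s hs =>
        (rho_pos (Ioo_subset_Icc_self hs)).le
      have h1 := quadratic_tangent (hadm (κ n)).memL2 hΦ (hadm (κ n)).memL2.rho_mul hΦ.rho_mul hb
      have h4 := quadratic_tangent (hadm (κ n)).memH10.isL2 hΨL (hadm (κ n)).memH10.isL2.rho_mul
        hΨL.rho_mul hb
      have h5 : ∫ s, (ψ (κ n) s - Ψ s) * (rho S s * Ψ s) ∂(vert S)
          = ∫ s, ψ (κ n) s * (rho S s * Ψ s) ∂(vert S)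
            - ∫ s, Ψ s * (rho S s * Ψ s) ∂(vert S) := by
        rw [← integral_sub ((hadm _).memH10.isL2.integrable_mul hΨL.rho_mul)
          (hΨL.integrable_mul hΨL.rho_mul)]
        congr 1
        ext s
        ring
      rw [h5]
      linarith
  have hge := mu_mul_constraintJ_le (r := r) hΦ hH
  have hneg := mu_neg S hr
  -- From `μ J ≤ E ≤ μ` and `μ < 0` follows `J ≥ 1`.
  have hJ1 : constraintJ S Φ Ψ = 1 := by
    refine le_antisymm hJ ?_
    nlinarith
  refine ⟨Φ, Ψ, fun s => e s - r * Φ s, ⟨hΦ, hH, hJ1⟩, le_antisymm hE ?_⟩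
  rw [hJ1] at hge
  linarith

end RayleighTaylor

end

noncomputable section

namespace RayleighTaylor

variable {S : Params}

/-! ### The Euler-Lagrange equations -/

/-- `φ` in terms of `ψ`, the pressure `p = P'(ρ₀) ρ₀ (ψ' + r φ)` and `k = λ²`. -/
def phiOf (S : Params) (r k s y p : ℝ) : ℝ := r / k * (S.g * y - (rho S s)⁻¹ * p)

/-- The right hand side of the equation for `ψ'`. -/
def slopePsi (S : Params) (r k s y p : ℝ) : ℝ :=
  -(S.g * (r ^ 2 / k)) * y + ((dP S s)⁻¹ * (rho S s)⁻¹ + r ^ 2 / k * (rho S s)⁻¹) * p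

/-- The right hand side of the equation for `p'`. -/
def slopeP (S : Params) (r k s y p : ℝ) : ℝ :=
  (k - S.g ^ 2 * (r ^ 2 / k)) * (rho S s * y) + S.g * (r ^ 2 / k) * p

theorem slopePsi_eq (r k s y p : ℝ) :
    slopePsi S r k s y p = (dP S s)⁻¹ * (rho S s)⁻¹ * p - r * phiOf S r k s y p := by
  unfold slopePsi phiOf
  ring

theorem slopeP_eq (r k : ℝ) {s : ℝ} (hs : s ∈ Icc (-S.m) S.ℓ) (y p : ℝ) :
    slopeP S r k s y p = k * (rho S s * y) - S.g * r * (rho S s * phiOf S r k s y p) := by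
  unfold slopeP phiOf
  have := (rho_pos hs).ne'
  field_simp
  ring

/-- The first order system satisfied by `ψ` and `p`. -/
structure IsModeSol (S : Params) (r : ℝ) (ψ p : ℝ → ℝ) : Prop where
  cont_ψ : ContinuousOn ψ (Icc (-S.m) S.ℓ)
  cont_p : ContinuousOn p (Icc (-S.m) S.ℓ)
  top : ψ S.ℓ = 0
  prim_ψ : ∀ s ∈ Icc (-S.m) S.ℓ,
    ψ s = ∫ τ in (-S.m)..s, slopePsi S r (growthRate S r ^ 2) τ (ψ τ) (p τ)
  prim_p : ∀ s ∈ Icc (-S.m) S.ℓ,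
    p s = p (-S.m) + ∫ τ in (-S.m)..s, slopeP S r (growthRate S r ^ 2) τ (ψ τ) (p τ)

theorem IsL2.congr_ae {f g : ℝ → ℝ} (hf : IsL2 S f) (h : f =ᵐ[vert S] g) : IsL2 S g :=
  (memLp_congr_ae h).1 hf

theorem IsL2.rho_inv_mul {f : ℝ → ℝ} (hf : IsL2 S f) : IsL2 S fun s => (rho S s)⁻¹ * f s :=
  hf.bdd_mul (C := (cmin S)⁻¹) (aestronglyMeasurable_rho S).aemeasurable.inv.aestronglyMeasurable
    fun s hs => by
      have h := rho_pos (Ioo_subset_Icc_self hs)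
      have h2 := cmin_le_rho S (Ioo_subset_Icc_self hs)
      have h3 := cmin_pos S
      rw [abs_of_pos (by positivity)]
      gcongr

theorem IsL2.dP_inv_mul {f : ℝ → ℝ} (hf : IsL2 S f) : IsL2 S fun s => (dP S s)⁻¹ * f s :=
  hf.bdd_mul (C := (cmin S)⁻¹) (aestronglyMeasurable_dP S).aemeasurable.inv.aestronglyMeasurable
    fun s hs => by
      have h := dP_pos (Ioo_subset_Icc_self hs)
      have h2 := cmin_le_dP S (Ioo_subset_Icc_self hs)
      have h3 := cmin_pos S
      rw [abs_of_pos (by positivity)]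
      gcongr

theorem isL2_slopePsi {r k : ℝ} {ψ p : ℝ → ℝ} (hψ : IsL2 S ψ) (hp : IsL2 S p) :
    IsL2 S fun s => slopePsi S r k s (ψ s) (p s) := by
  refine ((hψ.const_mul (-(S.g * (r ^ 2 / k)))).add (hp.rho_inv_mul.dP_inv_mul.add
    (hp.rho_inv_mul.const_mul (r ^ 2 / k)))).congr_ae (ae_of_all _ fun s => ?_)
  simp only [slopePsi]
  ring

theorem isL2_slopeP {r k : ℝ} {ψ p : ℝ → ℝ} (hψ : IsL2 S ψ) (hp : IsL2 S p) :
    IsL2 S fun s => slopeP S r k s (ψ s) (p s) :=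
  (hψ.rho_mul.const_mul _).add (hp.const_mul _)

/-- Integration by parts for absolutely continuous primitives; the boundary terms vanish because `X`
is zero at both ends. -/
theorem integral_mul_eq_neg_primitive {q X χ : ℝ → ℝ} (hq : IsL2 S q) (hX : IsH10 S X χ) :
    ∫ s, q s * X s ∂(vert S) = -∫ s, (∫ τ in (-S.m)..s, q τ) * χ s ∂(vert S) := by
  have hle := (neg_m_lt_ℓ S).le
  have hGac := hq.intervalIntegrable.absolutelyContinuousOnInterval_intervalIntegral
    (left_mem_uIcc (a := -S.m) (b := S.ℓ))
  have hXac := hX.memLp.intervalIntegrable.absolutelyContinuousOnInterval_intervalIntegral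
    (left_mem_uIcc (a := -S.m) (b := S.ℓ))
  have h := hGac.integral_mul_deriv_eq_deriv_mul hXac
  have e1 : ∫ s in (-S.m)..S.ℓ, (∫ τ in (-S.m)..s, q τ) * deriv (fun s => ∫ τ in (-S.m)..s, χ τ) s
      = ∫ s, (∫ τ in (-S.m)..s, q τ) * χ s ∂(vert S) := by
    rw [integral_vert]
    refine integral_congr_ae ?_
    filter_upwards [ae_vert_mem S,
      ae_restrict_of_ae hX.memLp.intervalIntegrable.ae_hasDerivAt_integral] with s hs hd
    rw [(hd (by rw [uIcc_of_le hle]; exact Ioo_subset_Icc_self hs) _ left_mem_uIcc).deriv]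
  have e2 : ∫ s in (-S.m)..S.ℓ, deriv (fun s => ∫ τ in (-S.m)..s, q τ) s * (∫ τ in (-S.m)..s, χ τ)
      = ∫ s, q s * X s ∂(vert S) := by
    rw [integral_vert]
    refine integral_congr_ae ?_
    filter_upwards [ae_vert_mem S,
      ae_restrict_of_ae hq.intervalIntegrable.ae_hasDerivAt_integral] with s hs hd
    rw [(hd (by rw [uIcc_of_le hle]; exact Ioo_subset_Icc_self hs) _ left_mem_uIcc).deriv,
      hX.primitive s (Ioo_subset_Icc_self hs)]
  have e3 : ∫ τ in (-S.m)..S.ℓ, χ τ = 0 := by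
    rw [← hX.primitive _ ⟨hle, le_rfl⟩, hX.top_eq_zero]
  rw [e1, e2, e3] at h
  simp only [intervalIntegral.integral_same] at h
  linarith

theorem ae_eq_zero_of_integral_mul_self {f : ℝ → ℝ} (hf : IsL2 S f)
    (h : ∫ s, f s * f s ∂(vert S) = 0) : f =ᵐ[vert S] 0 := by
  have := (integral_eq_zero_iff_of_nonneg (fun s => mul_self_nonneg (f s))
    (hf.integrable_mul hf)).1 h
  filter_upwards [this] with s hs
  exact mul_self_eq_zero.1 hs

/-- The du Bois-Reymond lemma. -/
theorem ae_eq_const_of_forall {W : ℝ → ℝ} (hW : IsL2 S W)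
    (h : ∀ X χ, IsH10 S X χ → ∫ s, W s * χ s ∂(vert S) = 0) : ∃ c : ℝ, W =ᵐ[vert S] fun _ => c := by
  have hL : 0 < S.ℓ + S.m := by linarith [S.m_pos, S.ℓ_pos]
  set c := (∫ s, W s ∂(vert S)) / (S.ℓ + S.m) with hc
  have hvol : (vert S).real univ = S.ℓ + S.m := by
    simp only [Measure.real, Measure.restrict_apply_univ, Real.volume_Ioo]
    rw [ENNReal.toReal_ofReal (by linarith)]
    ring
  have hχ : IsL2 S fun s => W s - c := hW.sub (isL2_const c)
  have h0 : ∫ s, (W s - c) ∂(vert S) = 0 := by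
    rw [integral_sub hW.integrable (integrable_const c), integral_const, hvol, smul_eq_mul, hc]
    field_simp
    ring
  -- The test function is the primitive of `W` minus its mean; removing the mean makes it vanish at
  -- the upper end. It yields `∫ (W - c)² = 0`.
  have hX : IsH10 S (fun s => ∫ τ in (-S.m)..s, (W τ - c)) fun s => W s - c :=
    ⟨hχ, fun _ _ => rfl, by rw [integral_vert, h0]⟩
  have h1 := h _ _ hX
  refine ⟨c, ?_⟩
  have h2 : ∫ s, (W s - c) * (W s - c) ∂(vert S) = 0 := by
    have : ∫ s, (W s - c) * (W s - c) ∂(vert S)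
        = ∫ s, W s * (W s - c) ∂(vert S) - c * ∫ s, (W s - c) ∂(vert S) := by
      rw [← integral_const_mul, ← integral_sub (hW.integrable_mul hχ) (hχ.integrable.const_mul c)]
      congr 1
      ext s
      ring
    rw [this, h1, h0]
    ring
  filter_upwards [ae_eq_zero_of_integral_mul_self hχ h2] with s hs
  exact sub_eq_zero.1 hs

/-- Varying `φ` freely gives an algebraic relation, which expresses `φ` through `ψ` and `p`. Varying
`ψ` and using du Bois-Reymond gives `P'ρ(ψ' + rφ)` a continuous representative `p` on the whole
closed interval, including the interface, and an equation for `p'`. The definition of `p`, solved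
for `ψ'`, is the remaining equation. -/
theorem euler_lagrange {r : ℝ} (hr : 0 < r) {φ ψ d : ℝ → ℝ} (h : IsAdmissible S φ ψ d)
    (hmin : energyE S r φ ψ d = mu S r) : ∃ p : ℝ → ℝ, IsModeSol S r ψ p ∧
      (∀ᵐ s ∂(vert S), φ s = phiOf S r (growthRate S r ^ 2) s (ψ s) (p s)) ∧
      (∀ᵐ s ∂(vert S), d s = slopePsi S r (growthRate S r ^ 2) s (ψ s) (p s)) ∧
      (∀ᵐ s ∂(vert S), dP S s * (rho S s * (d s + r * φ s)) = p s) := by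
  have hφ := h.memL2
  have hψ := h.memH10.isL2
  have hd := h.memH10.memLp
  have hk : growthRate S r ^ 2 = -mu S r := growthRate_sq S hr
  set k := growthRate S r ^ 2 with hkdef
  have hkpos : 0 < k := pow_pos (growthRate_pos S hr) 2
  have hμ : mu S r = -k := by linarith
  have hP : IsL2 S fun s => dP S s * (rho S s * (d s + r * φ s)) :=
    (hd.add (hφ.const_mul r)).rho_mul.dP_mul
  -- variation of `φ`
  set w : ℝ → ℝ := fun s => r * (dP S s * (rho S s * (d s + r * φ s)))
    - S.g * r * (rho S s * ψ s) + k * (rho S s * φ s) with hw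
  have hwL : IsL2 S w := ((hP.const_mul r).sub (hψ.rho_mul.const_mul _)).add
    (hφ.rho_mul.const_mul k)
  -- The residual `w` of the first equation is itself an admissible variation of `φ`, and the form
  -- then equals `∫ w²`.
  have h1 : ∫ s, w s * w s ∂(vert S) = 0 := by
    rw [← form_eq_zero_of_minimal h hmin hwL isH10_zero, form]
    refine integral_congr_ae (ae_of_all _ fun s => ?_)
    simp only [formDensity, hμ]
    rw [hw]
    ring
  have hw0 := ae_eq_zero_of_integral_mul_self hwL h1
  -- variation of `ψ`
  set q : ℝ → ℝ := fun s => S.g * r * (rho S s * φ s) - k * (rho S s * ψ s) with hq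
  have hqL : IsL2 S q := (hφ.rho_mul.const_mul _).sub (hψ.rho_mul.const_mul k)
  have hGc := continuousOn_primitive_of_isL2 hqL
  have hGL : IsL2 S fun s => ∫ τ in (-S.m)..s, q τ := isL2_of_continuousOn hGc
  obtain ⟨c, hcae⟩ := ae_eq_const_of_forall (hP.add hGL) fun X χ hX => by
    have h2 := form_eq_zero_of_minimal h hmin (isL2_const 0) hX
    have h3 : form S r (mu S r) φ ψ d (fun _ => 0) X χ
        = ∫ s, dP S s * (rho S s * (d s + r * φ s)) * χ s ∂(vert S)
          - ∫ s, q s * X s ∂(vert S) := by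
      rw [← integral_sub (hP.integrable_mul hX.memLp) (hqL.integrable_mul hX.isL2), form]
      refine integral_congr_ae (ae_of_all _ fun s => ?_)
      simp only [formDensity, hμ, hq]
      ring
    rw [h2, integral_mul_eq_neg_primitive hqL hX, sub_neg_eq_add,
      ← integral_add (hP.integrable_mul hX.memLp) (hGL.integrable_mul hX.memLp)] at h3
    rw [h3]
    congr 1
    ext s
    ring
  -- Being a constant minus a primitive, `p` does not jump at the interface; this is the origin of
  -- the pressure jump condition.
  set p : ℝ → ℝ := fun s => c - ∫ τ in (-S.m)..s, q τ with hp
  have hpc : ContinuousOn p (Icc (-S.m) S.ℓ) := continuousOn_const.sub hGc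
  have hpae : ∀ᵐ s ∂(vert S), dP S s * (rho S s * (d s + r * φ s)) = p s := by
    filter_upwards [hcae] with s hs
    rw [hp]
    linarith
  have hφae : ∀ᵐ s ∂(vert S), φ s = phiOf S r k s (ψ s) (p s) := by
    filter_upwards [hpae, hw0, ae_vert_mem S] with s h2 h3 hs
    have h4 := rho_pos (Ioo_subset_Icc_self hs)
    simp only [hw, Pi.zero_apply, h2] at h3
    unfold phiOf
    field_simp
    linarith
  have hdae : ∀ᵐ s ∂(vert S), d s = slopePsi S r k s (ψ s) (p s) := by
    filter_upwards [hpae, hφae, ae_vert_mem S] with s h2 h3 hs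
    have h4 := rho_pos (Ioo_subset_Icc_self hs)
    have h5 := dP_pos (Ioo_subset_Icc_self hs)
    rw [slopePsi_eq, ← h3, ← h2]
    field_simp
    ring
  have hae : ∀ {f f' : ℝ → ℝ}, f =ᵐ[vert S] f' → ∀ s ∈ Icc (-S.m) S.ℓ,
      ∫ τ in (-S.m)..s, f τ = ∫ τ in (-S.m)..s, f' τ := fun {f f'} hf s hs => by
    rw [primitive_eq_integral_indicator hs, primitive_eq_integral_indicator hs]
    refine integral_congr_ae ?_
    filter_upwards [hf] with τ hτ
    rw [hτ]
  refine ⟨p, ⟨h.memH10.continuousOn, hpc, h.memH10.top_eq_zero, fun s hs => ?_, fun s hs => ?_⟩,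
    hφae, hdae, hpae⟩
  · rw [h.memH10.primitive s hs]
    exact hae hdae s hs
  · have h2 : ∫ τ in (-S.m)..s, slopeP S r k τ (ψ τ) (p τ) = ∫ τ in (-S.m)..s, -q τ := by
      refine hae ?_ s hs
      filter_upwards [hφae, ae_vert_mem S] with τ h3 hτ
      rw [slopeP_eq r k (Ioo_subset_Icc_self hτ), ← h3, hq]
      ring
    rw [h2, intervalIntegral.integral_neg, hp]
    simp only [intervalIntegral.integral_same]
    ring

/-! ### Regularity for the first order system, and its relation to normal modes. -/

theorem continuousAt_coeff {s : ℝ} (hs : s ∈ Ioo (-S.m) S.ℓ) (h0 : s ≠ 0) :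
    ContinuousAt (rho S) s ∧ ContinuousAt (dP S) s := by
  have key : ∀ L : Layer S, s ∈ Ioo L.a L.b → ContinuousAt (rho S) s ∧ ContinuousAt (dP S) s := by
    intro L hL
    have hJ := L.isOpen.mem_nhds (L.subset (Ioo_subset_Icc_self hL))
    refine ⟨(L.smooth_ρ.continuousOn.continuousAt hJ).congr ?_,
      (L.smooth_D.continuousOn.continuousAt hJ).congr ?_⟩
    · filter_upwards [Ioo_mem_nhds hL.1 hL.2] with t ht using (L.rho_eq t ht).symm
    · filter_upwards [Ioo_mem_nhds hL.1 hL.2] with t ht using (L.dP_eq t ht).symm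
  rcases lt_or_gt_of_ne h0 with h | h
  · exact key (lowerLayer S) ⟨hs.1, h⟩
  · exact key (upperLayer S) ⟨h, hs.2⟩

theorem continuousWithinAt_slope {ψ p : ℝ → ℝ} {r k : ℝ} {T : Set ℝ} {s : ℝ}
    (hs : s ∈ Icc (-S.m) S.ℓ) (hρ : ContinuousWithinAt (rho S) T s)
    (hD : ContinuousWithinAt (dP S) T s) (hψ : ContinuousWithinAt ψ T s)
    (hp : ContinuousWithinAt p T s) :
    ContinuousWithinAt (fun s => slopePsi S r k s (ψ s) (p s)) T s ∧
    ContinuousWithinAt (fun s => slopeP S r k s (ψ s) (p s)) T s ∧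
    ContinuousWithinAt (fun s => phiOf S r k s (ψ s) (p s)) T s := by
  have hρi := hρ.inv₀ (rho_pos hs).ne'
  have hDi := hD.inv₀ (dP_pos hs).ne'
  refine ⟨?_, ?_, ?_⟩
  · exact (continuousWithinAt_const.mul hψ).add
      (((hDi.mul hρi).add (continuousWithinAt_const.mul hρi)).mul hp)
  · exact (continuousWithinAt_const.mul (hρ.mul hψ)).add (continuousWithinAt_const.mul hp)
  · exact continuousWithinAt_const.mul ((continuousWithinAt_const.mul hψ).sub (hρi.mul hp))

namespace IsModeSol

variable {r : ℝ} {ψ p : ℝ → ℝ}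

theorem isL2_ψ (h : IsModeSol S r ψ p) : IsL2 S ψ := isL2_of_continuousOn h.cont_ψ

theorem isL2_p (h : IsModeSol S r ψ p) : IsL2 S p := isL2_of_continuousOn h.cont_p

theorem bottom (h : IsModeSol S r ψ p) : ψ (-S.m) = 0 := by
  rw [h.prim_ψ _ ⟨le_rfl, (neg_m_lt_ℓ S).le⟩, intervalIntegral.integral_same]

theorem continuousAt (h : IsModeSol S r ψ p) {s : ℝ} (hs : s ∈ Ioo (-S.m) S.ℓ) : ContinuousAt ψ s ∧ ContinuousAt p s :=
  ⟨h.cont_ψ.continuousAt (Icc_mem_nhds hs.1 hs.2), h.cont_p.continuousAt (Icc_mem_nhds hs.1 hs.2)⟩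

theorem continuousAt_phi (h : IsModeSol S r ψ p) (k : ℝ) {s : ℝ} (hs : s ∈ Ioo (-S.m) S.ℓ) (h0 : s ≠ 0) :
    ContinuousAt (fun s => phiOf S r k s (ψ s) (p s)) s := by
  obtain ⟨h1, h2⟩ := continuousAt_coeff hs h0
  obtain ⟨h3, h4⟩ := h.continuousAt hs
  exact (continuousWithinAt_univ _ _).1 (continuousWithinAt_slope (r := r) (k := k)
    (Ioo_subset_Icc_self hs) h1.continuousWithinAt h2.continuousWithinAt h3.continuousWithinAt
    h4.continuousWithinAt).2.2

theorem hasDerivAt (h : IsModeSol S r ψ p) {s : ℝ} (hs : s ∈ Ioo (-S.m) S.ℓ) (h0 : s ≠ 0) :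
    HasDerivAt ψ (slopePsi S r (growthRate S r ^ 2) s (ψ s) (p s)) s ∧
    HasDerivAt p (slopeP S r (growthRate S r ^ 2) s (ψ s) (p s)) s := by
  obtain ⟨h1, h2⟩ := continuousAt_coeff hs h0
  obtain ⟨h3, h4⟩ := h.continuousAt hs
  have hc := continuousWithinAt_slope (r := r) (k := growthRate S r ^ 2) (T := univ)
    (Ioo_subset_Icc_self hs) h1.continuousWithinAt h2.continuousWithinAt h3.continuousWithinAt
    h4.continuousWithinAt
  simp only [continuousWithinAt_univ] at hc
  have hmem := Ioo_subset_Icc_self hs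
  have hbot : -S.m ∈ Icc (-S.m) S.ℓ := ⟨le_rfl, (neg_m_lt_ℓ S).le⟩
  have hL1 := isL2_slopePsi (r := r) (k := growthRate S r ^ 2) h.isL2_ψ h.isL2_p
  have hL2 := isL2_slopeP (r := r) (k := growthRate S r ^ 2) h.isL2_ψ h.isL2_p
  have hnhds : Icc (-S.m) S.ℓ ∈ 𝓝 s := Icc_mem_nhds hs.1 hs.2
  have hopen : Ioo (-S.m) S.ℓ ∈ 𝓝 s := Ioo_mem_nhds hs.1 hs.2
  constructor
  · have := intervalIntegral.integral_hasDerivAt_right (hL1.intervalIntegrable' hbot hmem)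
      ⟨_, hopen, hL1.1⟩ hc.1
    refine this.congr_of_eventuallyEq ?_
    filter_upwards [hnhds] with t ht using h.prim_ψ t ht
  · have := (intervalIntegral.integral_hasDerivAt_right (hL2.intervalIntegrable' hbot hmem)
      ⟨_, hopen, hL2.1⟩ hc.2.1).const_add (p (-S.m))
    refine this.congr_of_eventuallyEq ?_
    filter_upwards [hnhds] with t ht using h.prim_p t ht

/-- The two-sided statement fails to cover the interface, where the coefficients jump. Right
derivatives exist on all of `[-m, ℓ)`, so solutions can be compared across the interface in one
application of Grönwall's inequality. -/
theorem hasDerivWithinAt (h : IsModeSol S r ψ p) {s : ℝ} (hs : s ∈ Ico (-S.m) S.ℓ) :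
    HasDerivWithinAt ψ (slopePsi S r (growthRate S r ^ 2) s (ψ s) (p s)) (Ici s) s ∧
    HasDerivWithinAt p (slopeP S r (growthRate S r ^ 2) s (ψ s) (p s)) (Ici s) s := by
  obtain ⟨h1, h2⟩ := continuousWithinAt_coeff S hs
  have hmem := Ico_subset_Icc_self hs
  have hnhds : Icc (-S.m) S.ℓ ∈ 𝓝[≥] s :=
    mem_of_superset (Icc_mem_nhdsGE hs.2) (Icc_subset_Icc_left hs.1)
  have hopen : Ioo (-S.m) S.ℓ ∈ 𝓝[>] s :=
    mem_of_superset (Ioo_mem_nhdsGT hs.2) (Ioo_subset_Ioo_left hs.1)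
  have h3 : ContinuousWithinAt ψ (Ici s) s := (h.cont_ψ s hmem).mono_of_mem_nhdsWithin hnhds
  have h4 : ContinuousWithinAt p (Ici s) s := (h.cont_p s hmem).mono_of_mem_nhdsWithin hnhds
  have hc := continuousWithinAt_slope (r := r) (k := growthRate S r ^ 2) hmem
    (h1.mono Ioi_subset_Ici_self) (h2.mono Ioi_subset_Ici_self) (h3.mono Ioi_subset_Ici_self)
    (h4.mono Ioi_subset_Ici_self)
  have hbot : -S.m ∈ Icc (-S.m) S.ℓ := ⟨le_rfl, (neg_m_lt_ℓ S).le⟩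
  have hL1 := isL2_slopePsi (r := r) (k := growthRate S r ^ 2) h.isL2_ψ h.isL2_p
  have hL2 := isL2_slopeP (r := r) (k := growthRate S r ^ 2) h.isL2_ψ h.isL2_p
  constructor
  · have := intervalIntegral.integral_hasDerivWithinAt_right
      (hL1.intervalIntegrable' hbot hmem) (s := Ici s) (t := Ioi s) ⟨_, hopen, hL1.1⟩ hc.1
    refine this.congr_of_eventuallyEq ?_ (h.prim_ψ s hmem)
    filter_upwards [hnhds] with t ht using h.prim_ψ t ht
  · have := (intervalIntegral.integral_hasDerivWithinAt_right
      (hL2.intervalIntegrable' hbot hmem) (s := Ici s) (t := Ioi s) ⟨_, hopen, hL2.1⟩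
      hc.2.1).const_add (p (-S.m))
    refine this.congr_of_eventuallyEq ?_ (h.prim_p s hmem)
    filter_upwards [hnhds] with t ht using h.prim_p t ht

end IsModeSol

theorem ae_vert_ne_zero : ∀ᵐ s ∂(vert S), s ≠ 0 :=
  ae_restrict_of_ae (by simp [ae_iff])

theorem energyE_congr {r : ℝ} {φ φ' ψ d d' : ℝ → ℝ} (hφ : φ =ᵐ[vert S] φ')
    (hd : d =ᵐ[vert S] d') : energyE S r φ ψ d = energyE S r φ' ψ d' := by
  rw [energyE, energyE, integral_vert, integral_vert]
  congr 1
  refine integral_congr_ae ?_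
  filter_upwards [hφ, hd] with s h1 h2
  rw [h1, h2]

theorem IsAdmissible.congr {φ φ' ψ d d' : ℝ → ℝ} (h : IsAdmissible S φ ψ d)
    (hφ : φ =ᵐ[vert S] φ') (hd : d =ᵐ[vert S] d') : IsAdmissible S φ' ψ d' where
  memL2 := h.memL2.congr_ae hφ
  memH10 := by
    refine ⟨h.memH10.memLp.congr_ae hd, fun s hs => ?_, h.memH10.top_eq_zero⟩
    rw [h.memH10.primitive s hs, primitive_eq_integral_indicator hs,
      primitive_eq_integral_indicator hs]
    refine integral_congr_ae ?_
    filter_upwards [hd] with τ hτ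
    rw [hτ]
  constraint := by
    rw [← h.constraint, constraintJ, constraintJ, integral_vert, integral_vert]
    congr 1
    refine integral_congr_ae ?_
    filter_upwards [hφ] with s h1
    rw [h1]

/-- Every normal mode comes from a solution of the first order system. -/
theorem IsMode.exists_modeSol {r : ℝ} (hr : 0 < r) {φ ψ : ℝ → ℝ} (h : IsMode S r φ ψ) :
    ∃ p, IsModeSol S r ψ p ∧
      (∀ s ∈ Ioo (-S.m) S.ℓ, s ≠ 0 → φ s = phiOf S r (growthRate S r ^ 2) s (ψ s) (p s)) ∧
      (∀ᵐ s ∂(vert S), dP S s * (rho S s * (deriv ψ s + r * φ s)) = p s) := by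
  obtain ⟨p, hp, hφ, -, hP⟩ := euler_lagrange hr h.admissible h.minimal
  refine ⟨p, hp, fun s hs h0 => ?_, hP⟩
  -- Two continuous functions that agree almost everywhere on an open set agree everywhere on it.
  -- This upgrades the formula for `φ` to every height off the interface.
  have key : ∀ U : Set ℝ, IsOpen U → U ⊆ Ioo (-S.m) S.ℓ → (0 : ℝ) ∉ U → ContinuousOn φ U →
      EqOn φ (fun s => phiOf S r (growthRate S r ^ 2) s (ψ s) (p s)) U := by
    intro U hU hsub hU0 hc
    refine Measure.eqOn_open_of_ae_eq (μ := volume) ?_ hU hc fun t ht =>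
      (hp.continuousAt_phi _ (hsub ht) fun h => hU0 (h ▸ ht)).continuousWithinAt
    exact ae_restrict_of_ae_restrict_of_subset hsub hφ
  rcases lt_or_gt_of_ne h0 with h1 | h1
  · exact key (Ioo (-S.m) 0) isOpen_Ioo (Ioo_subset_Ioo_right S.ℓ_pos.le) (by simp) h.cont_lower
      ⟨hs.1, h1⟩
  · exact key (Ioo 0 S.ℓ) isOpen_Ioo (Ioo_subset_Ioo_left (neg_lt_zero.2 S.m_pos).le) (by simp)
      h.cont_upper ⟨h1, hs.2⟩

/-- Normal modes exist at every frequency. -/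
theorem exists_mode {r : ℝ} (hr : 0 < r) : ∃ ψ p : ℝ → ℝ, IsModeSol S r ψ p ∧
    IsMode S r (fun s => phiOf S r (growthRate S r ^ 2) s (ψ s) (p s)) ψ := by
  obtain ⟨φ, ψ, d, h, hmin⟩ := exists_minimizer (S := S) hr
  obtain ⟨p, hp, hφ, hd, -⟩ := euler_lagrange hr h hmin
  have hd' : d =ᵐ[vert S] deriv ψ := by
    filter_upwards [hd, ae_vert_mem S, ae_vert_ne_zero] with s h1 hs h0
    rw [h1, (hp.hasDerivAt hs h0).1.deriv]
  refine ⟨ψ, p, hp, h.congr hφ hd', ?_, fun s hs => ?_, fun s hs => ?_⟩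
  · rw [← hmin]
    exact (energyE_congr hφ hd').symm
  · exact (hp.continuousAt_phi _ ⟨hs.1, hs.2.trans S.ℓ_pos⟩ hs.2.ne).continuousWithinAt
  · exact (hp.continuousAt_phi _ ⟨(neg_lt_zero.2 S.m_pos).trans hs.1, hs.2⟩
      hs.1.ne').continuousWithinAt

end RayleighTaylor

end

noncomputable section

namespace RayleighTaylor

variable {S : Params}

/-! ### Measurable families of normal modes -/

/-- The frequency enters the system only through `r²/k` and `k`. As the slopes are linear in `(y,
p)`, the same constant serves as Lipschitz constant in Grönwall's inequality and in the pointwise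
bounds for modes. -/
theorem slope_bounds {r k M : ℝ} {s : ℝ} (hs : s ∈ Icc (-S.m) S.ℓ) {y p B : ℝ}
    (hβ : |r ^ 2 / k| ≤ M) (hk : |k| ≤ M) (hy : |y| ≤ B) (hp : |p| ≤ B) :
    |slopePsi S r k s y p| ≤ (2 * S.g * M + (cmin S)⁻¹ ^ 2 + M * (cmin S)⁻¹
      + (M + S.g ^ 2 * M) * cmax S) * B ∧
    |slopeP S r k s y p| ≤ (2 * S.g * M + (cmin S)⁻¹ ^ 2 + M * (cmin S)⁻¹
      + (M + S.g ^ 2 * M) * cmax S) * B := by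
  have hB : 0 ≤ B := (abs_nonneg y).trans hy
  have hM : 0 ≤ M := (abs_nonneg _).trans hk
  have hg := S.g_pos
  have hc := cmin_pos S
  have hC := cmax_pos S
  have hρ := rho_pos hs
  have hD := dP_pos hs
  have hρi : |(rho S s)⁻¹| ≤ (cmin S)⁻¹ := by
    rw [abs_of_pos (by positivity)]
    have := cmin_le_rho S hs
    gcongr
  have hDi : |(dP S s)⁻¹| ≤ (cmin S)⁻¹ := by
    rw [abs_of_pos (by positivity)]
    have := cmin_le_dP S hs
    gcongr
  have hρC : |rho S s| ≤ cmax S := by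
    rw [abs_of_pos hρ]
    exact rho_le_cmax S hs
  constructor
  · calc |slopePsi S r k s y p| ≤ S.g * M * B + ((cmin S)⁻¹ * (cmin S)⁻¹ + M * (cmin S)⁻¹) * B := by
          unfold slopePsi
          refine (abs_add_le _ _).trans (add_le_add ?_ ?_)
          · rw [abs_mul, abs_neg, abs_mul, abs_of_pos hg]
            gcongr
          · rw [abs_mul]
            refine mul_le_mul ((abs_add_le _ _).trans (add_le_add ?_ ?_)) hp (abs_nonneg _)
              (by positivity)
            · rw [abs_mul]
              gcongr
            · rw [abs_mul]
              gcongr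
      _ ≤ _ := by
          have h1 : 0 ≤ S.g * M * B := by positivity
          have h2 : 0 ≤ (M + S.g ^ 2 * M) * cmax S * B := by positivity
          linarith
  · calc |slopeP S r k s y p| ≤ (M + S.g ^ 2 * M) * (cmax S * B) + S.g * M * B := by
          unfold slopeP
          refine (abs_add_le _ _).trans (add_le_add ?_ ?_)
          · rw [abs_mul, abs_mul]
            refine mul_le_mul ((abs_sub _ _).trans (add_le_add hk ?_)) (by gcongr)
              (by positivity) (by positivity)
            rw [abs_mul, abs_of_pos (by positivity : 0 < S.g ^ 2)]
            gcongr
          · rw [abs_mul, abs_mul, abs_of_pos hg]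
            gcongr
      _ ≤ _ := by
          have h1 : 0 ≤ S.g * M * B := by positivity
          have h2 : 0 ≤ (cmin S)⁻¹ ^ 2 * B := by positivity
          have h3 : 0 ≤ M * (cmin S)⁻¹ * B := by positivity
          linarith

/-- The slopes are affine in `(r²/k, k)`, so a parameter change of size `η` perturbs them by `O(η)`
on bounded states. -/
theorem slope_sub_bounds {r k r' k' η : ℝ} {s : ℝ} (hs : s ∈ Icc (-S.m) S.ℓ) {y p B : ℝ}
    (hβ : |r ^ 2 / k - r' ^ 2 / k'| ≤ η) (hk : |k - k'| ≤ η) (hy : |y| ≤ B) (hp : |p| ≤ B) :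
    |slopePsi S r k s y p - slopePsi S r' k' s y p| ≤ (2 * S.g + (cmin S)⁻¹
      + (1 + S.g ^ 2) * cmax S) * B * η ∧
    |slopeP S r k s y p - slopeP S r' k' s y p| ≤ (2 * S.g + (cmin S)⁻¹
      + (1 + S.g ^ 2) * cmax S) * B * η := by
  have hB : 0 ≤ B := (abs_nonneg y).trans hy
  have hη : 0 ≤ η := (abs_nonneg _).trans hk
  have hg := S.g_pos
  have hc := cmin_pos S
  have hC := cmax_pos S
  have hρ := rho_pos hs
  have hρi : |(rho S s)⁻¹| ≤ (cmin S)⁻¹ := by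
    rw [abs_of_pos (by positivity)]
    have := cmin_le_rho S hs
    gcongr
  have hρC : |rho S s| ≤ cmax S := by
    rw [abs_of_pos hρ]
    exact rho_le_cmax S hs
  constructor
  · have e : slopePsi S r k s y p - slopePsi S r' k' s y p
        = (r ^ 2 / k - r' ^ 2 / k') * (-(S.g * y) + (rho S s)⁻¹ * p) := by
      unfold slopePsi
      ring
    rw [e, abs_mul]
    have h1 : |-(S.g * y) + (rho S s)⁻¹ * p| ≤ S.g * B + (cmin S)⁻¹ * B := by
      refine (abs_add_le _ _).trans (add_le_add ?_ ?_)
      · rw [abs_neg, abs_mul, abs_of_pos hg]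
        gcongr
      · rw [abs_mul]
        gcongr
    calc _ ≤ η * (S.g * B + (cmin S)⁻¹ * B) := by gcongr
      _ ≤ _ := by
          have h2 : 0 ≤ S.g * B * η := by positivity
          have h3 : 0 ≤ (1 + S.g ^ 2) * cmax S * B * η := by positivity
          linarith
  · have e : slopeP S r k s y p - slopeP S r' k' s y p
        = (k - k') * (rho S s * y)
          + (r ^ 2 / k - r' ^ 2 / k') * (S.g * p - S.g ^ 2 * (rho S s * y)) := by
      unfold slopeP
      ring
    rw [e]
    have h1 : |S.g * p - S.g ^ 2 * (rho S s * y)| ≤ S.g * B + S.g ^ 2 * (cmax S * B) := by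
      refine (abs_sub _ _).trans (add_le_add ?_ ?_)
      · rw [abs_mul, abs_of_pos hg]
        gcongr
      · rw [abs_mul, abs_mul, abs_of_pos (by positivity : 0 < S.g ^ 2)]
        gcongr
    calc _ ≤ η * (cmax S * B) + η * (S.g * B + S.g ^ 2 * (cmax S * B)) := by
          refine (abs_add_le _ _).trans (add_le_add ?_ ?_)
          · rw [abs_mul, abs_mul]
            gcongr
          · rw [abs_mul]
            gcongr
      _ ≤ _ := by
          have h2 : 0 ≤ S.g * B * η := by positivity
          have h3 : 0 ≤ (cmin S)⁻¹ * B * η := by positivity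
          linarith

theorem IsModeSol.const_mul {r : ℝ} {ψ p : ℝ → ℝ} (h : IsModeSol S r ψ p) (c : ℝ) :
    IsModeSol S r (fun s => c * ψ s) (fun s => c * p s) := by
  have e1 : ∀ k s y p, slopePsi S r k s (c * y) (c * p) = c * slopePsi S r k s y p :=
    fun k s y p => by unfold slopePsi; ring
  have e2 : ∀ k s y p, slopeP S r k s (c * y) (c * p) = c * slopeP S r k s y p :=
    fun k s y p => by unfold slopeP; ring
  refine ⟨continuousOn_const.mul h.cont_ψ, continuousOn_const.mul h.cont_p, by simp [h.top],
    fun s hs => ?_, fun s hs => ?_⟩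
  · simp only [e1, intervalIntegral.integral_const_mul]
    rw [← h.prim_ψ s hs]
  · simp only [e2, intervalIntegral.integral_const_mul]
    rw [h.prim_p s hs]
    ring

theorem isModeSol_zero (r : ℝ) : IsModeSol S r (fun _ => 0) (fun _ => 0) := by
  refine ⟨continuousOn_const, continuousOn_const, rfl, fun s _ => ?_, fun s _ => ?_⟩ <;>
  simp [slopePsi, slopeP]

/-- Continuous dependence of the solutions on the parameters. -/
theorem IsModeSol.dist_le {r r' : ℝ} {ψ p ψ' p' : ℝ → ℝ} (h : IsModeSol S r ψ p)
    (h' : IsModeSol S r' ψ' p') (h0 : p (-S.m) = p' (-S.m)) {M B η : ℝ}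
    (hM1 : |r ^ 2 / growthRate S r ^ 2| ≤ M) (hM2 : |growthRate S r ^ 2| ≤ M)
    (hη1 : |r ^ 2 / growthRate S r ^ 2 - r' ^ 2 / growthRate S r' ^ 2| ≤ η)
    (hη2 : |growthRate S r ^ 2 - growthRate S r' ^ 2| ≤ η)
    (hB : ∀ s ∈ Icc (-S.m) S.ℓ, |ψ' s| ≤ B ∧ |p' s| ≤ B) :
    ∀ s ∈ Icc (-S.m) S.ℓ, dist (ψ s, p s) (ψ' s, p' s) ≤ gronwallBound 0
      (2 * S.g * M + (cmin S)⁻¹ ^ 2 + M * (cmin S)⁻¹ + (M + S.g ^ 2 * M) * cmax S)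
      ((2 * S.g + (cmin S)⁻¹ + (1 + S.g ^ 2) * cmax S) * B * η) (s - -S.m) := by
  have hM : 0 ≤ M := (abs_nonneg _).trans hM2
  have hg := S.g_pos
  have hc := cmin_pos S
  have hC := cmax_pos S
  set K := 2 * S.g * M + (cmin S)⁻¹ ^ 2 + M * (cmin S)⁻¹ + (M + S.g ^ 2 * M) * cmax S with hK
  have hK0 : 0 ≤ K := by positivity
  -- The second solution is regarded as an approximate trajectory of the system at frequency `r`,
  -- with defect given by the change of parameters. Both start from the same data because `ψ` and
  -- `ψ'` vanish at the bottom.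
  have key := dist_le_of_approx_trajectories_ODE_of_mem
    (v := fun s (u : ℝ × ℝ) => (slopePsi S r (growthRate S r ^ 2) s u.1 u.2,
      slopeP S r (growthRate S r ^ 2) s u.1 u.2)) (s := fun _ => univ) (K := ⟨K, hK0⟩)
    (f := fun s => (ψ s, p s)) (g := fun s => (ψ' s, p' s)) (a := -S.m) (b := S.ℓ)
    (f' := fun s => (slopePsi S r (growthRate S r ^ 2) s (ψ s) (p s),
      slopeP S r (growthRate S r ^ 2) s (ψ s) (p s)))
    (g' := fun s => (slopePsi S r' (growthRate S r' ^ 2) s (ψ' s) (p' s),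
      slopeP S r' (growthRate S r' ^ 2) s (ψ' s) (p' s)))
    (εf := 0) (εg := (2 * S.g + (cmin S)⁻¹ + (1 + S.g ^ 2) * cmax S) * B * η) (δ := 0)
    ?_ (h.cont_ψ.prodMk h.cont_p)
    (fun t ht => (h.hasDerivWithinAt ht).1.prodMk (h.hasDerivWithinAt ht).2)
    (fun t ht => by simp) (fun _ _ => mem_univ _) (h'.cont_ψ.prodMk h'.cont_p)
    (fun t ht => (h'.hasDerivWithinAt ht).1.prodMk (h'.hasDerivWithinAt ht).2)
    (fun t ht => ?_) (fun _ _ => mem_univ _) ?_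
  · intro s hs
    have := key s hs
    rwa [zero_add] at this
  · intro t ht
    refine LipschitzOnWith.of_dist_le_mul fun u _ w _ => ?_
    have hmem := Ico_subset_Icc_self ht
    have hb := slope_bounds (r := r) (k := growthRate S r ^ 2) hmem (y := u.1 - w.1)
      (p := u.2 - w.2) (B := dist u w) hM1 hM2
      (by rw [Prod.dist_eq]; exact le_max_left _ _) (by rw [Prod.dist_eq]; exact le_max_right _ _)
    rw [Prod.dist_eq]
    refine max_le ?_ ?_
    · refine le_trans (le_of_eq ?_) hb.1
      rw [Real.dist_eq]
      unfold slopePsi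
      congr 1
      ring
    · refine le_trans (le_of_eq ?_) hb.2
      rw [Real.dist_eq]
      unfold slopeP
      congr 1
      ring
  · have hmem := Ico_subset_Icc_self ht
    have hb := slope_sub_bounds hmem hη1 hη2 (hB t hmem).1 (hB t hmem).2
    rw [dist_comm, Prod.dist_eq]
    exact max_le hb.1 hb.2
  · rw [h.bottom, h'.bottom, h0, dist_self]

/-- Comparison with the zero solution by Grönwall. As `ψ(-m) = 0` always holds, `p(-m)` is the only
free datum of a solution. -/
theorem IsModeSol.eq_zero {r : ℝ} {ψ p : ℝ → ℝ} (h : IsModeSol S r ψ p) (h0 : p (-S.m) = 0) :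
    ∀ s ∈ Icc (-S.m) S.ℓ, ψ s = 0 ∧ p s = 0 := by
  intro s hs
  have := h.dist_le (isModeSol_zero r) h0 (le_max_left _ _) (le_max_right _ _)
    (B := 0) (η := 0) (by simp) (by simp) (by simp) s hs
  rw [mul_zero, gronwallBound_ε0_δ0, Prod.dist_eq] at this
  have h1 := (le_max_left _ _).trans this
  have h2 := (le_max_right _ _).trans this
  simpa using And.intro h1 h2

theorem constraintJ_congr {φ φ' ψ ψ' : ℝ → ℝ} (hφ : φ =ᵐ[vert S] φ') (hψ : ψ =ᵐ[vert S] ψ') :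
    constraintJ S φ ψ = constraintJ S φ' ψ' := by
  rw [constraintJ, constraintJ, integral_vert, integral_vert]
  congr 1
  refine integral_congr_ae ?_
  filter_upwards [hφ, hψ] with s h1 h2
  rw [h1, h2]

theorem IsMode.neg {r : ℝ} {φ ψ : ℝ → ℝ} (h : IsMode S r φ ψ) :
    IsMode S r (fun s => -1 * φ s) (fun s => -1 * ψ s) := by
  have hd : deriv (fun s => -1 * ψ s) = fun s => -1 * deriv ψ s := by
    ext s
    simp
  refine ⟨⟨h.admissible.memL2.const_mul _, ?_, ?_⟩, ?_, continuousOn_const.mul h.cont_lower,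
    continuousOn_const.mul h.cont_upper⟩
  · rw [hd]
    exact h.admissible.memH10.const_mul _
  · rw [constraintJ_smul, h.admissible.constraint]
    norm_num
  · rw [hd, ← h.minimal, energyE, energyE]
    congr 1
    refine intervalIntegral.integral_congr fun s _ => ?_
    ring

/-- If `p(-m)` were zero the mode would vanish, contradicting `J = 1`; otherwise its sign can be
reversed together with the mode. Positivity later removes the sign ambiguity from the normalizing
factor. -/
theorem exists_mode_pos {r : ℝ} (hr : 0 < r) : ∃ ψ p : ℝ → ℝ, IsModeSol S r ψ p ∧
    0 < p (-S.m) ∧ IsMode S r (fun s => phiOf S r (growthRate S r ^ 2) s (ψ s) (p s)) ψ := by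
  obtain ⟨ψ, p, h, hm⟩ := exists_mode (S := S) hr
  rcases lt_trichotomy (p (-S.m)) 0 with h0 | h0 | h0
  · refine ⟨_, _, h.const_mul (-1), by linarith, ?_⟩
    have := hm.neg
    have e : (fun s => phiOf S r (growthRate S r ^ 2) s (-1 * ψ s) (-1 * p s))
        = fun s => -1 * phiOf S r (growthRate S r ^ 2) s (ψ s) (p s) := by
      ext s
      unfold phiOf
      ring
    rwa [e]
  · exfalso
    have hz := h.eq_zero h0
    have h1 := hm.admissible.constraint
    rw [constraintJ_congr (φ' := fun _ => 0) (ψ' := fun _ => 0)] at h1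
    · simp [constraintJ] at h1
    · filter_upwards [ae_vert_mem S] with s hs
      have := hz s (Ioo_subset_Icc_self hs)
      simp [phiOf, this.1, this.2]
    · filter_upwards [ae_vert_mem S] with s hs using (hz s (Ioo_subset_Icc_self hs)).1
  · exact ⟨ψ, p, h, h0, hm⟩

/-- Continuity relative to the parameter map `e` suffices: the preimage of an open set is the
`e`-preimage of a union of balls, which is open whatever the size of the union. -/
theorem measurable_of_dist_control {α : Type*} [MeasurableSpace α] {e : α → ℝ × ℝ}
    (he : Measurable e) {F : α → ℝ} (hF : ∀ a₀, ∀ ε > 0, ∃ δ > 0, ∀ a, dist (e a) (e a₀) < δ →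
      dist (F a) (F a₀) < ε) : Measurable F := by
  refine measurable_of_isOpen fun V hV => ?_
  have h1 : ∀ a₀ : F ⁻¹' V, ∃ δ > 0, ∀ a, dist (e a) (e a₀) < δ → F a ∈ V := fun a₀ => by
    obtain ⟨ε, hε, hb⟩ := Metric.isOpen_iff.1 hV _ a₀.2
    obtain ⟨δ, hδ, h⟩ := hF a₀ ε hε
    exact ⟨δ, hδ, fun a ha => hb (h a ha)⟩
  choose δ hδ hd using h1
  have : F ⁻¹' V = e ⁻¹' (⋃ a₀ : F ⁻¹' V, Metric.ball (e a₀) (δ a₀)) := by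
    ext a
    simp only [mem_preimage, mem_iUnion, Metric.mem_ball]
    exact ⟨fun ha => ⟨⟨a, ha⟩, by simpa using hδ _⟩, fun ⟨a₀, ha⟩ => hd a₀ a ha⟩
  rw [this]
  exact he (isOpen_iUnion fun _ => Metric.isOpen_ball).measurableSet

/-- A function measurable in one variable and continuous in the other is jointly measurable.
Extension by zero confines the continuity requirement to `I`. -/
theorem measurable_uncurry_indicator {α E : Type*} [MeasurableSpace α] [NormedAddCommGroup E]
    [MeasurableSpace E] [BorelSpace E] {I : Set ℝ} (hI : MeasurableSet I) {F : α → ℝ → E}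
    (h1 : ∀ s ∈ I, Measurable fun a => F a s) (h2 : ∀ a, ContinuousOn (F a) I) :
    Measurable fun q : α × ℝ => I.indicator (F q.1) q.2 := by
  have hm : Measurable (Function.uncurry fun (s : I) (a : α) => F a s) :=
    measurable_uncurry_of_continuous_of_measurable
      (fun a => (continuousOn_iff_continuous_domRestrict.1 (h2 a))) fun s => h1 s s.2
  have hemb : MeasurableEmbedding (fun q : I × α => (q.2, (q.1 : ℝ))) := by
    have h3 : MeasurableEmbedding (Prod.map ((↑) : I → ℝ) id : I × α → ℝ × α) :=
      (MeasurableEmbedding.subtype_coe hI).prodMap MeasurableEmbedding.id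
    exact MeasurableEquiv.prodComm.measurableEmbedding.comp h3
  have := hemb.measurable_extend hm (measurable_const (a := (0 : E)))
  convert this using 1
  ext q
  by_cases hq : q.2 ∈ I
  · rw [indicator_of_mem hq]
    exact (hemb.injective.extend_apply (Function.uncurry fun (s : I) (a : α) => F a s) _
      (⟨q.2, hq⟩, q.1)).symm
  · rw [indicator_of_notMem hq, Function.extend_apply']
    rintro ⟨⟨s, a⟩, rfl⟩
    exact hq s.2

/-- The growth rate is known to be Borel but not continuous in `r`, so measurability is obtained
through the parameters `(r²/λ², λ²)`. Solutions normalized by `p(-m) = 1` depend continuously on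
them. The normalizing factor is then recovered from the constraint as a parameter integral. -/
theorem exists_family : ∃ φ ψ : ℝ → ℝ → ℝ, IsModeFamily S φ ψ := by
  have hg := S.g_pos
  have hc := cmin_pos S
  have hC := cmax_pos S
  choose ψ p hsol hpos hmode using fun r : Ioi (0 : ℝ) => exists_mode_pos (S := S) r.2
  set k : Ioi (0 : ℝ) → ℝ := fun r => growthRate S r ^ 2 with hk
  have hkm : Measurable k := ((measurable_growthRate S).comp measurable_subtype_coe).pow_const 2
  -- These are the two parameters through which the first order system depends on the frequency.
  set e : Ioi (0 : ℝ) → ℝ × ℝ := fun r => ((r : ℝ) ^ 2 / k r, k r) with he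
  have hem : Measurable e := ((measurable_subtype_coe.pow_const 2).div hkm).prodMk hkm
  set c : Ioi (0 : ℝ) → ℝ := fun r => p r (-S.m) with hcdef
  have hnorm := fun r => (hsol r).const_mul (c r)⁻¹
  have hone : ∀ r, (c r)⁻¹ * p r (-S.m) = 1 := fun r => inv_mul_cancel₀ (hpos r).ne'
  have hcont : ∀ r₀, ∀ ε > 0, ∃ δ > 0, ∀ r, dist (e r) (e r₀) < δ → ∀ s ∈ Icc (-S.m) S.ℓ,
      dist ((c r)⁻¹ * ψ r s, (c r)⁻¹ * p r s) ((c r₀)⁻¹ * ψ r₀ s, (c r₀)⁻¹ * p r₀ s) < ε := by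
    intro r₀ ε hε
    obtain ⟨B1, hB1⟩ := isCompact_Icc.exists_bound_of_continuousOn (hnorm r₀).cont_ψ
    obtain ⟨B2, hB2⟩ := isCompact_Icc.exists_bound_of_continuousOn (hnorm r₀).cont_p
    set B := max B1 B2
    have hB0 : 0 ≤ B := ((norm_nonneg _).trans (hB1 (-S.m) ⟨le_rfl, (neg_m_lt_ℓ S).le⟩)).trans
      (le_max_left _ _)
    set M := ‖e r₀‖ + 1
    set K := 2 * S.g * M + (cmin S)⁻¹ ^ 2 + M * (cmin S)⁻¹ + (M + S.g ^ 2 * M) * cmax S with hK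
    have hM : 0 < M := by positivity
    have hK0 : 0 < K := by positivity
    set A := (2 * S.g + (cmin S)⁻¹ + (1 + S.g ^ 2) * cmax S) * B with hA
    have hA0 : 0 ≤ A := by positivity
    -- Grönwall bounds the distance of the normalized solutions by `X η`. The radius is taken with
    -- `X + 1` because `X` may be zero.
    set X := A / K * (Real.exp (K * (S.ℓ + S.m)) - 1) with hX
    have hX0 : 0 ≤ X := by
      have : 1 ≤ Real.exp (K * (S.ℓ + S.m)) :=
        Real.one_le_exp (mul_nonneg hK0.le (by linarith [S.m_pos, S.ℓ_pos]))
      exact mul_nonneg (by positivity) (by linarith)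
    refine ⟨min 1 (ε / (X + 1)), lt_min one_pos (by positivity), fun r hr s hs => ?_⟩
    set η := dist (e r) (e r₀) with hη
    have hη0 : 0 ≤ η := dist_nonneg
    have hb1 : ‖e r‖ ≤ M := by
      have : ‖e r‖ ≤ ‖e r₀‖ + ‖e r - e r₀‖ := by
        simpa using norm_add_le (e r₀) (e r - e r₀)
      rw [← dist_eq_norm] at this
      linarith [hr.trans_le (min_le_left _ _)]
    have hdist : η = max (dist (e r).1 (e r₀).1) (dist (e r).2 (e r₀).2) := Prod.dist_eq
    have := (hnorm r).dist_le (hnorm r₀) ((hone r).trans (hone r₀).symm) (M := M) (B := B) (η := η)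
      ((norm_fst_le (e r)).trans hb1) ((norm_snd_le (e r)).trans hb1)
      (hdist ▸ le_max_left _ _) (hdist ▸ le_max_right _ _)
      (fun s hs => ⟨(hB1 s hs).trans (le_max_left _ _), (hB2 s hs).trans (le_max_right _ _)⟩) s hs
    refine this.trans_lt ?_
    rw [← hK, ← hA, gronwallBound_of_K_ne_0 hK0.ne']
    simp only [zero_mul, zero_add]
    calc A * η / K * (Real.exp (K * (s - -S.m)) - 1)
        ≤ A * η / K * (Real.exp (K * (S.ℓ + S.m)) - 1) := by
          have : s - -S.m ≤ S.ℓ + S.m := by linarith [hs.2]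
          gcongr
      _ = X * η := by rw [hX]; ring
      _ ≤ (X + 1) * η := by linarith
      _ < (X + 1) * (ε / (X + 1)) := by
          have := hr.trans_le (min_le_right _ _)
          gcongr
      _ = ε := by field_simp
  have hmψ : ∀ s ∈ Icc (-S.m) S.ℓ, Measurable fun r => (c r)⁻¹ * ψ r s := fun s hs =>
    measurable_of_dist_control hem fun r₀ ε hε => by
      obtain ⟨δ, hδ, h⟩ := hcont r₀ ε hε
      refine ⟨δ, hδ, fun r hr => ?_⟩
      have := h r hr s hs
      rw [Prod.dist_eq] at this
      exact (le_max_left _ _).trans_lt this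
  have hmp : ∀ s ∈ Icc (-S.m) S.ℓ, Measurable fun r => (c r)⁻¹ * p r s := fun s hs =>
    measurable_of_dist_control hem fun r₀ ε hε => by
      obtain ⟨δ, hδ, h⟩ := hcont r₀ ε hε
      refine ⟨δ, hδ, fun r hr => ?_⟩
      have := h r hr s hs
      rw [Prod.dist_eq] at this
      exact (le_max_right _ _).trans_lt this
  -- measurability of the normalizing factor
  set N : Ioi (0 : ℝ) → ℝ → ℝ := fun r s => rho S s *
    ((phiOf S r (k r) s ((c r)⁻¹ * ψ r s) ((c r)⁻¹ * p r s)) ^ 2 + ((c r)⁻¹ * ψ r s) ^ 2) with hN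
  have hNm : ∀ s ∈ Icc (-S.m) S.ℓ, Measurable fun r => N r s := fun s hs =>
    measurable_const.mul (((((measurable_subtype_coe.div hkm)).mul
      ((measurable_const.mul (hmψ s hs)).sub (measurable_const.mul (hmp s hs)))).pow_const 2).add
      ((hmψ s hs).pow_const 2))
  have hNint : Measurable fun r => ∫ s, N r s ∂(vert S) := by
    set I := Ioo (-S.m) 0 ∪ Ioo 0 S.ℓ with hI
    have hIs : ∀ s ∈ I, s ∈ Ioo (-S.m) S.ℓ ∧ s ≠ 0 := by
      rintro s (hs | hs)
      · exact (lowerLayer S).mem s hs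
      · exact (upperLayer S).mem s hs
    have hIm : MeasurableSet I := measurableSet_Ioo.union measurableSet_Ioo
    have hj := measurable_uncurry_indicator hIm (F := N)
      (fun s hs => hNm s (Ioo_subset_Icc_self (hIs s hs).1)) fun r s hs => by
        obtain ⟨h1, h0⟩ := hIs s hs
        exact ((continuousAt_coeff h1 h0).1.mul
          ((((hnorm r).continuousAt_phi (k r) h1 h0).pow 2).add
            (((hnorm r).continuousAt h1).1.pow 2))).continuousWithinAt
    have := (hj.stronglyMeasurable.integral_prod_right' (ν := vert S)).measurable
    convert this using 1
    ext r
    refine integral_congr_ae ?_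
    filter_upwards [ae_vert_mem S, ae_vert_ne_zero] with s hs h0
    rw [indicator_of_mem]
    rcases lt_or_gt_of_ne h0 with h | h
    · exact Or.inl ⟨hs.1, h⟩
    · exact Or.inr ⟨h, hs.2⟩
  -- The normalized pair has `J = c⁻²`, since the mode itself has `J = 1`; positivity of `c` selects
  -- the root.
  have hcJ : ∀ r, c r = (√(1 / 2 * ∫ s, N r s ∂(vert S)))⁻¹ := fun r => by
    have h1 := (hmode r).admissible.constraint
    have h2 : 1 / 2 * ∫ s, N r s ∂(vert S) = (c r)⁻¹ ^ 2 := by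
      have e1 : 1 / 2 * ∫ s, N r s ∂(vert S) = constraintJ S
          (fun s => (c r)⁻¹ * phiOf S r (k r) s (ψ r s) (p r s)) (fun s => (c r)⁻¹ * ψ r s) := by
        rw [constraintJ, integral_vert]
        congr 2
        ext s
        rw [hN]
        simp only [phiOf]
        ring
      rw [e1, constraintJ_smul, h1, mul_one]
    rw [h2, Real.sqrt_sq (inv_nonneg.2 (hpos r).le), inv_inv]
  have hcm : Measurable c := by
    rw [funext hcJ]
    exact (hNint.const_mul _).sqrt.inv
  have hψm : ∀ s ∈ Icc (-S.m) S.ℓ, Measurable fun r => ψ r s := fun s hs => by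
    have h1 : (fun r => ψ r s) = fun r => c r * ((c r)⁻¹ * ψ r s) :=
      funext fun r => (mul_inv_cancel_left₀ (hpos r).ne' _).symm
    rw [h1]
    exact hcm.mul (hmψ s hs)
  have hpm : ∀ s ∈ Icc (-S.m) S.ℓ, Measurable fun r => p r s := fun s hs => by
    have h1 : (fun r => p r s) = fun r => c r * ((c r)⁻¹ * p r s) :=
      funext fun r => (mul_inv_cancel_left₀ (hpos r).ne' _).symm
    rw [h1]
    exact hcm.mul (hmp s hs)
  refine ⟨fun r s => if h : 0 < r then phiOf S r (k ⟨r, h⟩) s (ψ ⟨r, h⟩ s) (p ⟨r, h⟩ s) else 0,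
    fun r s => if h : 0 < r then ψ ⟨r, h⟩ s else 0, fun r hr => ?_, fun s hs _ => ?_,
    fun s hs _ => ?_⟩
  · have := hmode ⟨r, hr⟩
    simp only [hr, dite_true]
    exact this
  · have h1 : ∀ r : Ioi (0 : ℝ), 0 < (r : ℝ) := fun r => r.2
    simp only [h1, dite_true]
    exact (measurable_subtype_coe.div hkm).mul
      ((measurable_const.mul (hψm s (Ioo_subset_Icc_self hs))).sub
        (measurable_const.mul (hpm s (Ioo_subset_Icc_self hs))))
  · have h1 : ∀ r : Ioi (0 : ℝ), 0 < (r : ℝ) := fun r => r.2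
    simp only [h1, dite_true]
    exact hψm s (Ioo_subset_Icc_self hs)

end RayleighTaylor

end

noncomputable section

namespace RayleighTaylor

variable {S : Params}

/-! ### Uniform bounds for families of normal modes -/

/-- A family of normal modes together with the associated pressures. -/
structure ModeData (S : Params) (φ ψ p : ℝ → ℝ → ℝ) : Prop where
  mode : ∀ r, 0 < r → IsMode S r (φ r) (ψ r)
  sol : ∀ r, 0 < r → IsModeSol S r (ψ r) (p r)
  phi : ∀ r, 0 < r → ∀ s ∈ Ioo (-S.m) S.ℓ, s ≠ 0 →
    φ r s = phiOf S r (growthRate S r ^ 2) s (ψ r s) (p r s)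
  pressure : ∀ r, 0 < r → ∀ᵐ s ∂(vert S),
    dP S s * (rho S s * (deriv (ψ r) s + r * φ r s)) = p r s
  meas_ψ : ∀ s ∈ Ioo (-S.m) S.ℓ, s ≠ 0 → Measurable fun r : Ioi (0 : ℝ) => ψ r s
  meas_p : ∀ s ∈ Ioo (-S.m) S.ℓ, s ≠ 0 → Measurable fun r : Ioi (0 : ℝ) => p r s

/-- Solving the algebraic relation for the pressure gives `p = ρ₀ (g ψ - λ² φ / r)` off the
interface, so `p` inherits measurability in `r` from the family. -/
theorem IsModeFamily.exists_data {φ ψ : ℝ → ℝ → ℝ} (h : IsModeFamily S φ ψ) :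
    ∃ p, ModeData S φ ψ p := by
  choose! p hp using fun r (hr : 0 < r) => (h.mode r hr).exists_modeSol hr
  refine ⟨p, h.mode, fun r hr => (hp r hr).1, fun r hr => (hp r hr).2.1,
    fun r hr => (hp r hr).2.2, h.meas_ψ, fun s hs h0 => ?_⟩
  have e : (fun r : Ioi (0 : ℝ) => p r s) = fun r : Ioi (0 : ℝ) =>
      rho S s * (S.g * ψ r s - growthRate S r ^ 2 / r * φ r s) := by
    ext r
    rw [(hp r r.2).2.1 s hs h0]
    have h1 := (rho_pos (Ioo_subset_Icc_self hs)).ne'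
    have h2 := (growthRate_pos S r.2).ne'
    have h3 : (r : ℝ) ≠ 0 := ne_of_gt r.2
    unfold phiOf
    field_simp
    ring
  rw [e]
  exact measurable_const.mul ((measurable_const.mul (h.meas_ψ s hs h0)).sub
    (((((measurable_growthRate S).comp measurable_subtype_coe).pow_const 2).div
      measurable_subtype_coe).mul (h.meas_φ s hs h0)))

namespace ModeData

variable {φ ψ p : ℝ → ℝ → ℝ}

/-- The pressure is the compression times `P'ρ₀`. At a mode the energy equals `μ < 0`, so gravity
alone bounds the compression, by `2 g r / cmin²` in square integral. -/
theorem integral_p_sq_le (h : ModeData S φ ψ p) {r : ℝ} (hr : 0 < r) :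
    ∫ s, p r s * p r s ∂(vert S) ≤ 2 * S.g * cmax S ^ 4 / cmin S ^ 2 * r := by
  have hm := h.mode r hr
  have hc := cmin_pos S
  have hC := cmax_pos S
  have h1 := hm.admissible.integral_compression_sq_le hr.le
  rw [hm.minimal] at h1
  have he : IsL2 S fun s => deriv (ψ r) s + r * φ r s :=
    hm.admissible.memH10.memLp.add (hm.admissible.memL2.const_mul r)
  have h2 : ∫ s, p r s * p r s ∂(vert S) ≤ ∫ s, cmax S ^ 4 *
      ((deriv (ψ r) s + r * φ r s) * (deriv (ψ r) s + r * φ r s)) ∂(vert S) := by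
    refine integral_mono_ae ((h.sol r hr).isL2_p.integrable_mul (h.sol r hr).isL2_p)
      ((he.integrable_mul he).const_mul _) ?_
    filter_upwards [h.pressure r hr, ae_vert_mem S] with s hs hmem
    have hmem := Ioo_subset_Icc_self hmem
    rw [← hs]
    have h3 := rho_le_cmax S hmem
    have h4 := dP_le_cmax S hmem
    have h5 := (rho_pos hmem).le
    have h6 := (dP_pos hmem).le
    have h7 : (dP S s * rho S s) ^ 2 ≤ (cmax S * cmax S) ^ 2 := by gcongr
    calc _ = (dP S s * rho S s) ^ 2 *
          ((deriv (ψ r) s + r * φ r s) * (deriv (ψ r) s + r * φ r s)) := by ring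
      _ ≤ (cmax S * cmax S) ^ 2 *
          ((deriv (ψ r) s + r * φ r s) * (deriv (ψ r) s + r * φ r s)) :=
        mul_le_mul_of_nonneg_right h7 (mul_self_nonneg _)
      _ = _ := by ring
  rw [integral_const_mul] at h2
  refine h2.trans ?_
  have h3 : ∫ s, (deriv (ψ r) s + r * φ r s) * (deriv (ψ r) s + r * φ r s) ∂(vert S)
      ≤ 2 * (S.g * r) / cmin S ^ 2 := by
    rw [le_div_iff₀ (by positivity)]
    linarith [mu_neg S hr]
  calc _ ≤ cmax S ^ 4 * (2 * (S.g * r) / cmin S ^ 2) := by gcongr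
    _ = _ := by ring

/-- The square integrals of `ψ` and `p` together grow at most linearly in the frequency. -/
theorem exists_integral_bound (S : Params) : ∃ C : ℝ, 0 < C ∧ ∀ φ ψ p, ModeData S φ ψ p → ∀ r, 1 ≤ r →
    ∫ s, (ψ r s * ψ r s + p r s * p r s) ∂(vert S) ≤ C * r := by
  have hc := cmin_pos S
  have hC := cmax_pos S
  have hg := S.g_pos
  refine ⟨2 / cmin S + 2 * S.g * cmax S ^ 4 / cmin S ^ 2, by positivity, fun φ ψ p h r hr => ?_⟩
  have hr0 : 0 < r := by linarith
  have hs := h.sol r hr0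
  rw [integral_add (hs.isL2_ψ.integrable_mul hs.isL2_ψ) (hs.isL2_p.integrable_mul hs.isL2_p),
    add_mul]
  refine add_le_add ((h.mode r hr0).admissible.integral_ψ_sq_le.trans ?_) (h.integral_p_sq_le hr0)
  exact le_mul_of_one_le_right (by positivity) hr

/-- Pointwise bounds, locally uniform in the frequency. -/
theorem exists_sup_bound (h : ModeData S φ ψ p) {κ r₀ R : ℝ} (hκ : 0 < κ) (hr₀ : 1 ≤ r₀)
    (hk : ∀ r, r₀ ≤ r → κ * r ≤ growthRate S r ^ 2) :
    ∃ B, 0 ≤ B ∧ ∀ r, r₀ ≤ r → r ≤ R → ∀ s ∈ Icc (-S.m) S.ℓ, |ψ r s| ≤ B ∧ |p r s| ≤ B := by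
  obtain ⟨C, hC0, hC⟩ := exists_integral_bound S
  have hg := S.g_pos
  have hc := cmin_pos S
  have hCm := cmax_pos S
  have hL : 0 < S.ℓ + S.m := by linarith [S.m_pos, S.ℓ_pos]
  rcases lt_or_ge R r₀ with hR | hR
  · exact ⟨0, le_rfl, fun r h1 h2 => by linarith⟩
  have hR0 : 0 < R := by linarith
  -- From `κ r ≤ λ² ≤ g r` follow `r²/λ² ≤ r/κ` and `λ² ≤ g r`; `M` bounds both parameters for `r ≤
  -- R`.
  set M := max (R / κ) (S.g * R) with hM
  have hM0 : 0 ≤ M := (mul_pos hg hR0).le.trans (le_max_right _ _)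
  set K := 2 * S.g * M + (cmin S)⁻¹ ^ 2 + M * (cmin S)⁻¹ + (M + S.g ^ 2 * M) * cmax S with hK
  have hK0 : 0 ≤ K := by positivity
  set A := (S.ℓ + S.m) + C * R with hA
  have hA0 : 0 ≤ A := by positivity
  have hvol : (vert S).real univ = S.ℓ + S.m := by
    simp only [Measure.real, Measure.restrict_apply_univ, Real.volume_Ioo]
    rw [ENNReal.toReal_ofReal (by linarith)]
    ring
  refine ⟨K * A + A / (S.ℓ + S.m), by positivity, fun r h1 h2 => ?_⟩
  have hr1 : 1 ≤ r := hr₀.trans h1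
  have hr0 : 0 < r := by linarith
  have hs := h.sol r hr0
  have hk1 := hk r h1
  have hk2 := growthRate_sq_le S hr0
  have hkpos : 0 < growthRate S r ^ 2 := pow_pos (growthRate_pos S hr0) 2
  have hβ : |r ^ 2 / growthRate S r ^ 2| ≤ M := by
    rw [abs_of_pos (by positivity)]
    refine le_trans ?_ (le_max_left _ _)
    rw [div_le_div_iff₀ hkpos hκ]
    nlinarith
  have hkM : |growthRate S r ^ 2| ≤ M := by
    rw [abs_of_pos hkpos]
    exact (hk2.trans (by gcongr)).trans (le_max_right _ _)
  have hL1 : IsL2 S fun s => |ψ r s| + |p r s| := isL2_of_continuousOn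
    (hs.cont_ψ.abs.add hs.cont_p.abs)
  -- The `L²` bound gives an `L¹` bound through `|x| ≤ (1 + x²)/2`. Integrating the system then
  -- bounds the oscillation of `ψ` and `p` by `K A`.
  have hint : ∫ s, (|ψ r s| + |p r s|) ∂(vert S) ≤ A := by
    have : ∫ s, (|ψ r s| + |p r s|) ∂(vert S)
        ≤ ∫ s, (1 + (ψ r s * ψ r s + p r s * p r s)) ∂(vert S) := by
      refine integral_mono hL1.integrable ((integrable_const 1).add
        ((hs.isL2_ψ.integrable_mul hs.isL2_ψ).add (hs.isL2_p.integrable_mul hs.isL2_p))) ?_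
      intro s
      simp only
      nlinarith [sq_abs (ψ r s), sq_abs (p r s), sq_nonneg (|ψ r s| - 1), sq_nonneg (|p r s| - 1)]
    have hsum : Integrable (fun s => ψ r s * ψ r s + p r s * p r s) (vert S) :=
      (hs.isL2_ψ.integrable_mul hs.isL2_ψ).add (hs.isL2_p.integrable_mul hs.isL2_p)
    rw [integral_add (integrable_const 1) hsum, integral_const, hvol, smul_eq_mul, mul_one] at this
    refine this.trans (add_le_add le_rfl ((hC φ ψ p h r hr1).trans ?_))
    gcongr
  have hslope : ∀ s ∈ Icc (-S.m) S.ℓ,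
      |slopePsi S r (growthRate S r ^ 2) s (ψ r s) (p r s)| ≤ K * (|ψ r s| + |p r s|) ∧
      |slopeP S r (growthRate S r ^ 2) s (ψ r s) (p r s)| ≤ K * (|ψ r s| + |p r s|) :=
    fun s hs => slope_bounds hs hβ hkM (le_add_of_nonneg_right (abs_nonneg _))
      (le_add_of_nonneg_left (abs_nonneg _))
  have hbot : -S.m ∈ Icc (-S.m) S.ℓ := ⟨le_rfl, (neg_m_lt_ℓ S).le⟩
  have hprim : ∀ F : ℝ → ℝ, (∀ s ∈ Icc (-S.m) S.ℓ, |F s| ≤ K * (|ψ r s| + |p r s|)) →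
      ∀ s ∈ Icc (-S.m) S.ℓ, ∀ t ∈ Icc (-S.m) S.ℓ, |∫ τ in t..s, F τ| ≤ K * A := by
    intro F hF s hs t ht
    have h3 : ‖∫ τ in t..s, F τ‖ ≤ |∫ τ in t..s, K * (|ψ r τ| + |p r τ|)| := by
      refine intervalIntegral.norm_integral_le_abs_of_norm_le (ae_restrict_of_forall_mem
        measurableSet_uIoc fun τ hτ => ?_) ((hL1.const_mul K).intervalIntegrable' ht hs)
      exact hF τ ((convex_Icc _ _).ordConnected.uIcc_subset ht hs (uIoc_subset_uIcc hτ))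
    refine h3.trans ?_
    rw [intervalIntegral.integral_const_mul, abs_mul, abs_of_nonneg hK0]
    refine mul_le_mul_of_nonneg_left (le_trans ?_ hint) hK0
    rw [← integral_vert, ← abs_of_nonneg (intervalIntegral.integral_nonneg (neg_m_lt_ℓ S).le
      fun τ _ => add_nonneg (abs_nonneg (ψ r τ)) (abs_nonneg (p r τ)))]
    refine intervalIntegral.abs_integral_mono_interval ?_ (ae_of_all _ fun τ =>
      add_nonneg (abs_nonneg (ψ r τ)) (abs_nonneg (p r τ))) hL1.intervalIntegrable
    rw [uIoc_of_le (neg_m_lt_ℓ S).le]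
    intro τ hτ
    exact ⟨lt_of_le_of_lt (le_min ht.1 hs.1) hτ.1, hτ.2.trans (max_le ht.2 hs.2)⟩
  intro s hsm
  constructor
  · rw [hs.prim_ψ s hsm]
    refine (hprim _ (fun t ht => (hslope t ht).1) s hsm _ hbot).trans ?_
    have : 0 ≤ A / (S.ℓ + S.m) := by positivity
    linarith
  -- There is no boundary condition for `p`. Its value at `s` is compared with its values at all
  -- other heights, and averaging over them turns the `L¹` bound into a pointwise one.
  · have h4 : ∀ t ∈ Ioo (-S.m) S.ℓ, |p r s| - K * A ≤ |p r t| := by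
      intro t ht
      have ht := Ioo_subset_Icc_self ht
      have hi := isL2_slopeP (r := r) (k := growthRate S r ^ 2) hs.isL2_ψ hs.isL2_p
      have h5 : p r s - p r t
          = ∫ τ in t..s, slopeP S r (growthRate S r ^ 2) τ (ψ r τ) (p r τ) := by
        rw [hs.prim_p s hsm, hs.prim_p t ht, add_sub_add_left_eq_sub,
          intervalIntegral.integral_interval_sub_left (hi.intervalIntegrable' hbot hsm)
            (hi.intervalIntegrable' hbot ht)]
      have h6 := hprim _ (fun t ht => (hslope t ht).2) s hsm t ht
      rw [← h5] at h6
      have := abs_sub_abs_le_abs_sub (p r s) (p r t)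
      linarith
    have h5 : ∫ _, (|p r s| - K * A) ∂(vert S) ≤ ∫ t, (|ψ r t| + |p r t|) ∂(vert S) := by
      refine integral_mono_ae (integrable_const _) hL1.integrable ?_
      filter_upwards [ae_vert_mem S] with t ht
      linarith [h4 t ht, abs_nonneg (ψ r t)]
    rw [integral_const, hvol, smul_eq_mul] at h5
    have h6 : |p r s| - K * A ≤ A / (S.ℓ + S.m) := by
      rw [le_div_iff₀ hL]
      linarith
    linarith

end ModeData

/-! ### Symbols -/

/-- Finite sums of products `c(r) α(s)` with `α` smooth and `c(r) = O(r^j)`. -/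
inductive Symbol (J : Set ℝ) (r₀ : ℝ) : ℕ → (ℝ → ℝ → ℝ) → Prop
  | term {j : ℕ} {c α : ℝ → ℝ} (hc : Measurable c) (hb : ∃ C, ∀ r, r₀ ≤ r → |c r| ≤ C * r ^ j)
    (hα : ContDiffOn ℝ ∞ α J) : Symbol J r₀ j fun r s => c r * α s
  | add {j : ℕ} {a b : ℝ → ℝ → ℝ} (ha : Symbol J r₀ j a) (hb : Symbol J r₀ j b) :
    Symbol J r₀ j fun r s => a r s + b r s

namespace Symbol

variable {J : Set ℝ} {r₀ : ℝ} {i j : ℕ} {a b : ℝ → ℝ → ℝ}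

theorem exists_hasDerivAt (hJ : IsOpen J) (h : Symbol J r₀ j a) :
    ∃ a', Symbol J r₀ j a' ∧ ∀ r, ∀ s ∈ J, HasDerivAt (a r) (a' r s) s := by
  induction h with
  | @term c α hc hb hα =>
    refine ⟨_, .term hc hb (hα.deriv_of_isOpen hJ (m := ∞) (by simp)), fun r s hs => ?_⟩
    exact ((((hα.contDiffAt (hJ.mem_nhds hs)).differentiableAt (by simp)).hasDerivAt).const_mul _)
  | add ha hb iha ihb =>
    obtain ⟨a', ha', h1⟩ := iha
    obtain ⟨b', hb', h2⟩ := ihb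
    exact ⟨_, ha'.add hb', fun r s hs => (h1 r s hs).add (h2 r s hs)⟩

theorem continuousOn (hJ : IsOpen J) (h : Symbol J r₀ j a) (r : ℝ) : ContinuousOn (a r) J := by
  obtain ⟨a', -, h'⟩ := h.exists_hasDerivAt hJ
  exact fun s hs => (h' r s hs).continuousAt.continuousWithinAt

theorem congr (h : Symbol J r₀ j a) (hab : ∀ r s, a r s = b r s) : Symbol J r₀ j b := by
  have : a = b := funext fun r => funext fun s => hab r s
  rwa [← this]

theorem mul (hr₀ : 0 ≤ r₀) (ha : Symbol J r₀ i a) (hb : Symbol J r₀ j b) :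
    Symbol J r₀ (i + j) fun r s => a r s * b r s := by
  induction ha with
  | @term c α hc hcb hα =>
    induction hb with
    | @term e β he heb hβ =>
      refine (Symbol.term (c := fun r => c r * e r) (hc.mul he) ?_ (hα.mul hβ)).congr
        fun r s => by ring
      obtain ⟨C, hC⟩ := hcb
      obtain ⟨E, hE⟩ := heb
      refine ⟨C * E, fun r hr => ?_⟩
      have hr0 : 0 ≤ r := hr₀.trans hr
      rw [abs_mul]
      calc _ ≤ (C * r ^ i) * (E * r ^ j) := mul_le_mul (hC r hr) (hE r hr) (abs_nonneg _)
            ((abs_nonneg _).trans (hC r hr))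
        _ = _ := by ring
    | add _ _ ih1 ih2 => exact (ih1.add ih2).congr fun r s => by ring
  | add _ _ ih1 ih2 => exact (ih1.add ih2).congr fun r s => by ring

theorem mono (hr₀ : 1 ≤ r₀) (hij : i ≤ j) (h : Symbol J r₀ i a) : Symbol J r₀ j a := by
  induction h with
  | term hc hb hα =>
    obtain ⟨C, hC⟩ := hb
    refine .term hc ⟨C, fun r hr => (hC r hr).trans ?_⟩ hα
    have h1 : 1 ≤ r := hr₀.trans hr
    have h3 : 0 < r := by linarith
    have hC0 : 0 ≤ C := by
      have h2 := (abs_nonneg _).trans (hC r hr)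
      exact nonneg_of_mul_nonneg_left h2 (by positivity)
    gcongr
  | add _ _ ih1 ih2 => exact ih1.add ih2

theorem exists_bound (h : Symbol J r₀ j a) {K : Set ℝ} (hK : IsCompact K) (hKJ : K ⊆ J) :
    ∃ C, ∀ r, r₀ ≤ r → ∀ s ∈ K, |a r s| ≤ C * r ^ j := by
  induction h with
  | @term c α hc hb hα =>
    obtain ⟨C, hC⟩ := hb
    obtain ⟨B, hB⟩ := hK.exists_bound_of_continuousOn (hα.continuousOn.mono hKJ)
    refine ⟨C * B, fun r hr s hs => ?_⟩
    rw [abs_mul]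
    calc _ ≤ (C * r ^ j) * B := mul_le_mul (hC r hr) (hB s hs) (abs_nonneg _)
          ((abs_nonneg _).trans (hC r hr))
      _ = _ := by ring
  | add _ _ ih1 ih2 =>
    obtain ⟨C, hC⟩ := ih1
    obtain ⟨B, hB⟩ := ih2
    refine ⟨C + B, fun r hr s hs => (abs_add_le _ _).trans ?_⟩
    rw [add_mul]
    exact add_le_add (hC r hr s hs) (hB r hr s hs)

theorem measurable (h : Symbol J r₀ j a) (s : ℝ) : Measurable fun r => a r s := by
  induction h with
  | term hc hb hα => exact hc.mul_const _
  | add _ _ ih1 ih2 => exact ih1.add ih2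

theorem of_smooth {α : ℝ → ℝ} (hα : ContDiffOn ℝ ∞ α J) : Symbol J r₀ 0 fun _ s => α s :=
  (Symbol.term (c := fun _ => 1) measurable_const ⟨1, fun r _ => by simp⟩ hα).congr
    fun r s => by simp

theorem const (x : ℝ) : Symbol J r₀ 0 fun _ _ => x := of_smooth contDiffOn_const

theorem of_coeff {c : ℝ → ℝ} (hc : Measurable c) (hb : ∃ C, ∀ r, r₀ ≤ r → |c r| ≤ C * r ^ j) :
    Symbol J r₀ j fun r _ => c r :=
  (Symbol.term hc hb (contDiffOn_const (c := (1 : ℝ)))).congr fun r s => by simp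

end Symbol

/-- A threshold frequency beyond which the squared growth rate is at least `κ r`. -/
structure GrowthBound (S : Params) (κ r₀ : ℝ) : Prop where
  pos : 0 < κ
  one_le : 1 ≤ r₀
  le : ∀ r, r₀ ≤ r → κ * r ≤ growthRate S r ^ 2

/-! ### Vertical derivatives of normal modes. -/

section

variable {κ r₀ : ℝ} {J : Set ℝ}

/-- The linear lower bound for `λ²` makes this ratio bounded. As a result `φ` is a combination of
`ψ` and `p` with coefficients of order zero. -/
theorem symbol_ratio (hG : GrowthBound S κ r₀) :
    Symbol J r₀ 0 fun r _ => r / growthRate S r ^ 2 := by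
  refine Symbol.of_coeff (measurable_id.div ((measurable_growthRate S).pow_const 2))
    ⟨κ⁻¹, fun r hr => ?_⟩
  have h0 : 0 < r := by linarith [hG.one_le]
  have := hG.le r hr
  have hκ := hG.pos
  have hk := pow_pos (growthRate_pos S h0) 2
  rw [abs_of_pos (by positivity), pow_zero, mul_one, div_le_iff₀ hk, ← div_le_iff₀' (by positivity)]
  rw [div_inv_eq_mul]
  linarith

theorem symbol_sq_ratio (hG : GrowthBound S κ r₀) :
    Symbol J r₀ 1 fun r _ => r ^ 2 / growthRate S r ^ 2 := by
  have h1 : Symbol J r₀ 1 fun r _ => r :=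
    Symbol.of_coeff measurable_id ⟨1, fun r hr => by
      rw [abs_of_pos (by linarith [hG.one_le])]
      simp⟩
  refine ((symbol_ratio hG).mul (by linarith [hG.one_le]) h1).congr fun r _ => by ring

theorem symbol_growthRate_sq (hG : GrowthBound S κ r₀) :
    Symbol J r₀ 1 fun r _ => growthRate S r ^ 2 :=
  Symbol.of_coeff ((measurable_growthRate S).pow_const 2) ⟨S.g, fun r hr => by
    rw [abs_of_nonneg (sq_nonneg _), pow_one]
    exact growthRate_sq_le S (by linarith [hG.one_le])⟩

/-- The product rule and the first order system express the derivative through `ψ` and `p` again.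
Since `κ r ≤ λ² ≤ g r`, the coefficients of the system have order at most one, so differentiation
costs a single power of `r`. The new coefficients do not depend on the mode, whence constants
uniform over all families. -/
theorem exists_symbol_step (hG : GrowthBound S κ r₀) (L : Layer S) {j : ℕ} {a b : ℝ → ℝ → ℝ}
    (ha : Symbol L.J r₀ j a) (hb : Symbol L.J r₀ j b) :
    ∃ a' b', (Symbol L.J r₀ (j + 1) a' ∧ Symbol L.J r₀ (j + 1) b') ∧
      ∀ r, ∀ s ∈ Ioo L.a L.b, ∀ ψ p : ℝ → ℝ,
        HasDerivAt ψ (slopePsi S r (growthRate S r ^ 2) s (ψ s) (p s)) s →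
        HasDerivAt p (slopeP S r (growthRate S r ^ 2) s (ψ s) (p s)) s →
        HasDerivAt (fun s => a r s * ψ s + b r s * p s) (a' r s * ψ s + b' r s * p s) s := by
  have h1 := hG.one_le
  have h0 : 0 ≤ r₀ := by linarith
  obtain ⟨da, hda, hda'⟩ := ha.exists_hasDerivAt L.isOpen
  obtain ⟨db, hdb, hdb'⟩ := hb.exists_hasDerivAt L.isOpen
  have sβ := symbol_sq_ratio (J := L.J) hG
  have sk := symbol_growthRate_sq (J := L.J) hG
  have sρ : Symbol L.J r₀ 0 fun _ s => L.ρ s := .of_smooth L.smooth_ρ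
  have sρi : Symbol L.J r₀ 0 fun _ s => (L.ρ s)⁻¹ :=
    .of_smooth (L.smooth_ρ.inv fun s hs => (L.ρ_pos s hs).ne')
  have sDi : Symbol L.J r₀ 0 fun _ s => (L.D s)⁻¹ :=
    .of_smooth (L.smooth_D.inv fun s hs => (L.D_pos s hs).ne')
  have s11 := (Symbol.const (J := L.J) (r₀ := r₀) (-S.g)).mul h0 sβ
  have s12 := ((sDi.mul h0 sρi).mono (j := 0 + 1) h1 (by norm_num)).add
    ((sβ.mul h0 sρi).mono h1 (by norm_num))
  have s21 := ((sk.mono (j := 0 + 1) h1 le_rfl).add ((Symbol.const (-S.g ^ 2)).mul h0 sβ)).mul h0 sρ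
  have s22 := (Symbol.const (J := L.J) (r₀ := r₀) S.g).mul h0 sβ
  have lift : ∀ {c : ℝ → ℝ → ℝ} {n : ℕ}, n ≤ 1 → ∀ {d : ℝ → ℝ → ℝ}, Symbol L.J r₀ j d →
      Symbol L.J r₀ n c → Symbol L.J r₀ (j + 1) fun r s => d r s * c r s :=
    fun hn _ hd hc => (hd.mul h0 hc).mono h1 (by omega)
  refine ⟨_, _, ⟨((hda.mono h1 (Nat.le_succ j)).add ((lift (by norm_num) ha s11).add
    (lift (by norm_num) hb s21))), ((hdb.mono h1 (Nat.le_succ j)).add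
    ((lift (by norm_num) ha s12).add (lift (by norm_num) hb s22)))⟩, fun r s hs ψ p hψ hp => ?_⟩
  have hsJ := L.subset (Ioo_subset_Icc_self hs)
  refine (((hda' r s hsJ).mul hψ).add ((hdb' r s hsJ).mul hp)).congr_deriv ?_
  rw [slopePsi, slopeP, L.rho_eq s hs, L.dP_eq s hs]
  ring

/-- Repeated vertical derivatives of a combination of `ψ` and `p`. -/
theorem exists_symbol_chain (hG : GrowthBound S κ r₀) (L : Layer S) {a b : ℝ → ℝ → ℝ}
    (ha : Symbol L.J r₀ 0 a) (hb : Symbol L.J r₀ 0 b) :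
    ∃ A B : ℕ → ℝ → ℝ → ℝ, A 0 = a ∧ B 0 = b ∧
      (∀ j, Symbol L.J r₀ j (A j) ∧ Symbol L.J r₀ j (B j)) ∧
      ∀ j r, ∀ s ∈ Ioo L.a L.b, ∀ ψ p : ℝ → ℝ,
        HasDerivAt ψ (slopePsi S r (growthRate S r ^ 2) s (ψ s) (p s)) s →
        HasDerivAt p (slopeP S r (growthRate S r ^ 2) s (ψ s) (p s)) s →
        HasDerivAt (fun s => A j r s * ψ s + B j r s * p s)
          (A (j + 1) r s * ψ s + B (j + 1) r s * p s) s := by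
  -- The recursion carries the order bound along with the coefficients, because each step requires
  -- it of the previous one.
  let T : ℕ → Type := fun j => {c : (ℝ → ℝ → ℝ) × (ℝ → ℝ → ℝ) //
    Symbol L.J r₀ j c.1 ∧ Symbol L.J r₀ j c.2}
  have step : ∀ j (c : T j), ∃ c' : T (j + 1), ∀ r, ∀ s ∈ Ioo L.a L.b, ∀ ψ p : ℝ → ℝ,
        HasDerivAt ψ (slopePsi S r (growthRate S r ^ 2) s (ψ s) (p s)) s →
        HasDerivAt p (slopeP S r (growthRate S r ^ 2) s (ψ s) (p s)) s →
        HasDerivAt (fun s => c.1.1 r s * ψ s + c.1.2 r s * p s)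
          (c'.1.1 r s * ψ s + c'.1.2 r s * p s) s := fun j c => by
    obtain ⟨a', b', h1, h2⟩ := exists_symbol_step hG L c.2.1 c.2.2
    exact ⟨⟨(a', b'), h1⟩, h2⟩
  choose next hnext using step
  let seq : ∀ j, T j := fun j => Nat.rec ⟨(a, b), ha, hb⟩ (fun j c => next j c) j
  exact ⟨fun j => (seq j).1.1, fun j => (seq j).1.2, rfl, rfl, fun j => (seq j).2,
    fun j => hnext j (seq j)⟩

end

end RayleighTaylor

end

noncomputable section

namespace RayleighTaylor

variable {S : Params}

/-! ### Fourier synthesis of amplitudes -/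

theorem growthRate_sq_le_abs (r : ℝ) : growthRate S r ^ 2 ≤ S.g * |r| := by
  rw [growthRate, Real.sq_sqrt']
  refine max_le ?_ (mul_nonneg S.g_pos.le (abs_nonneg r))
  linarith [neg_mul_le_mu S r]

theorem growthRate_le {R : ℝ} {ξ : Plane} (h : ‖ξ‖ ≤ R) : growthRate S ‖ξ‖ ≤ √(S.g * R) := by
  refine Real.le_sqrt_of_sq_le ((growthRate_sq_le_abs _).trans ?_)
  rw [abs_norm]
  exact mul_le_mul_of_nonneg_left h S.g_pos.le

theorem growthRate_nonneg (r : ℝ) : 0 ≤ growthRate S r := Real.sqrt_nonneg _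

theorem norm_wave (ξ : Plane) (x : Space) (t : ℝ) :
    ‖wave S ξ x t‖ = Real.exp (growthRate S ‖ξ‖ * t) := by
  rw [wave, norm_mul, Complex.norm_real, Real.norm_eq_abs, Real.abs_exp, Complex.norm_exp]
  simp

theorem norm_wave_le {R T : ℝ} {ξ : Plane} (h : ‖ξ‖ ≤ R) {x : Space} {t : ℝ} (ht : |t| ≤ T) :
    ‖wave S ξ x t‖ ≤ Real.exp (√(S.g * R) * T) := by
  rw [norm_wave]
  refine Real.exp_le_exp.2 ?_
  calc _ ≤ growthRate S ‖ξ‖ * |t| := by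
        gcongr
        · exact growthRate_nonneg _
        · exact le_abs_self t
    _ ≤ _ := by
        gcongr
        exact growthRate_le h

theorem measurable_wave (x : Space) (t : ℝ) : Measurable fun ξ : Plane => wave S ξ x t := by
  have h1 : Measurable fun ξ : Plane => growthRate S ‖ξ‖ :=
    (measurable_growthRate S).comp measurable_norm
  have h2 : ∀ j, Measurable fun ξ : Plane => ξ j := fun j => by fun_prop
  unfold wave
  refine (Complex.measurable_ofReal.comp (Real.measurable_exp.comp (h1.mul_const t))).mul
    (Complex.measurable_exp.comp (measurable_const.mul (Complex.measurable_ofReal.comp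
      (((h2 0).const_mul _).add ((h2 1).const_mul _)))))

/-- The synthesis of the amplitude `a`, without the factor `1 / (4 π²)`. -/
def synth (S : Params) (a : Plane → ℝ → ℂ) (x : Space) (t : ℝ) : ℂ :=
  ∫ ξ : Plane, a ξ (x 2) * wave S ξ x t

/-- Bounded amplitudes on heights `I`, supported in `|ξ| ≤ R` and continuous in the height. -/
structure IsAmp (R : ℝ) (I : Set ℝ) (a : Plane → ℝ → ℂ) : Prop where
  meas : ∀ s ∈ I, Measurable fun ξ => a ξ s
  cont : ∀ ξ, ContinuousOn (a ξ) I
  bdd : ∃ C, ∀ ξ, ∀ s ∈ I, ‖a ξ s‖ ≤ C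
  supp : ∀ ξ, R < ‖ξ‖ → ∀ s, a ξ s = 0

namespace IsAmp

variable {R : ℝ} {I : Set ℝ} {a b : Plane → ℝ → ℂ}

theorem mul_weight (h : IsAmp R I a) {m : Plane → ℂ} (hm : Measurable m)
    (hb : ∃ C, ∀ ξ, ‖ξ‖ ≤ R → ‖m ξ‖ ≤ C) : IsAmp R I fun ξ s => m ξ * a ξ s where
  meas s hs := hm.mul (h.meas s hs)
  cont ξ := continuousOn_const.mul (h.cont ξ)
  bdd := by
    obtain ⟨C, hC⟩ := hb
    obtain ⟨B, hB⟩ := h.bdd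
    refine ⟨max C 0 * max B 0, fun ξ s hs => ?_⟩
    rcases le_or_gt ‖ξ‖ R with hξ | hξ
    · rw [norm_mul]
      exact mul_le_mul ((hC ξ hξ).trans (le_max_left _ _)) ((hB ξ s hs).trans (le_max_left _ _))
        (norm_nonneg _) (le_max_right _ _)
    · rw [h.supp ξ hξ, mul_zero, norm_zero]
      positivity
  supp ξ hξ s := by rw [h.supp ξ hξ, mul_zero]

theorem exists_dominating (h : IsAmp R I a) (T : ℝ) : ∃ C, 0 ≤ C ∧ ∀ ξ, ∀ x : Space, x 2 ∈ I →
    ∀ t, |t| ≤ T → ‖a ξ (x 2) * wave S ξ x t‖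
      ≤ (Metric.closedBall (0 : Plane) R).indicator (fun _ => C) ξ := by
  obtain ⟨B, hB⟩ := h.bdd
  refine ⟨max B 0 * Real.exp (√(S.g * R) * T), by positivity, fun ξ x hx t ht => ?_⟩
  by_cases hξ : ‖ξ‖ ≤ R
  · rw [indicator_of_mem (by simpa using hξ), norm_mul]
    exact mul_le_mul ((hB ξ _ hx).trans (le_max_left _ _)) (norm_wave_le hξ ht) (norm_nonneg _)
      (le_max_right _ _)
  · rw [indicator_of_notMem (by simpa using hξ), h.supp ξ (not_le.1 hξ), zero_mul, norm_zero]

theorem _root_.RayleighTaylor.integrable_indicator_closedBall (R C : ℝ) :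
    Integrable ((Metric.closedBall (0 : Plane) R).indicator fun _ => C) :=
  (integrable_indicator_iff Metric.isClosed_closedBall.measurableSet).2
    (integrableOn_const (measure_closedBall_lt_top).ne)

theorem integrable (h : IsAmp R I a) {x : Space} (hx : x 2 ∈ I) (t : ℝ) :
    Integrable fun ξ => a ξ (x 2) * wave S ξ x t := by
  obtain ⟨C, -, hC⟩ := h.exists_dominating (S := S) |t|
  exact (integrable_indicator_closedBall R C).mono'
    ((h.meas _ hx).mul (measurable_wave x t)).aestronglyMeasurable
    (ae_of_all _ fun ξ => hC ξ x hx t le_rfl)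

theorem continuous_wave (ξ : Plane) : Continuous fun q : Space × ℝ => wave S ξ q.1 q.2 := by
  unfold wave
  fun_prop

/-- Dominated convergence, with the compact frequency support supplying the majorant. The limit
amplitude is a separate argument so that points may approach the boundary of a layer, where the
amplitude need not be continuous. -/
theorem tendsto_synth (h : IsAmp R I a) {ι : Type*} {l : Filter ι} [l.IsCountablyGenerated]
    {X : ι → Space} {τ : ι → ℝ} {x₀ : Space} {t₀ : ℝ} (hX : Tendsto X l (𝓝 x₀))
    (hτ : Tendsto τ l (𝓝 t₀)) (hI : ∀ᶠ i in l, X i 2 ∈ I) {A : Plane → ℂ}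
    (hA : ∀ ξ, Tendsto (fun i => a ξ (X i 2)) l (𝓝 (A ξ))) :
    Tendsto (fun i => synth S a (X i) (τ i)) l (𝓝 (∫ ξ, A ξ * wave S ξ x₀ t₀)) := by
  obtain ⟨C, -, hC⟩ := h.exists_dominating (S := S) (|t₀| + 1)
  refine tendsto_integral_filter_of_dominated_convergence _ ?_ ?_
    (integrable_indicator_closedBall R C) ?_
  · filter_upwards [hI] with i hi
    exact ((h.meas _ hi).mul (measurable_wave _ _)).aestronglyMeasurable
  · have hT : ∀ᶠ i in l, |τ i| < |t₀| + 1 :=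
      hτ.abs.eventually (Iio_mem_nhds (lt_add_one _))
    filter_upwards [hI, hT] with i hi ht
    exact ae_of_all _ fun ξ => hC ξ _ hi _ ht.le
  · exact ae_of_all _ fun ξ => (hA ξ).mul
      (((continuous_wave ξ).tendsto (x₀, t₀)).comp (hX.prodMk_nhds hτ))

theorem continuousAt_synth (h : IsAmp R I a) (hI : IsOpen I) {q : Space × ℝ} (hq : q.1 2 ∈ I) :
    ContinuousAt (fun q : Space × ℝ => synth S a q.1 q.2) q := by
  have hc : ContinuousAt (fun q : Space × ℝ => q.1 2) q := by fun_prop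
  exact h.tendsto_synth continuousAt_fst continuousAt_snd (hc.eventually (hI.mem_nhds hq))
    fun ξ => Tendsto.comp (g := a ξ) ((h.cont ξ).continuousAt (hI.mem_nhds hq)) hc

end IsAmp

/-- The coordinate functionals of space-time, with complex values. -/
def coordC (i : Fin 3) : Space × ℝ →L[ℝ] ℂ :=
  Complex.ofRealCLM ∘L (ContinuousLinearMap.proj i) ∘L (ContinuousLinearMap.fst ℝ Space ℝ)

/-- The time functional of space-time, with complex values. -/
def timeC : Space × ℝ →L[ℝ] ℂ := Complex.ofRealCLM ∘L (ContinuousLinearMap.snd ℝ Space ℝ)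

@[simp] theorem coordC_apply (i : Fin 3) (q : Space × ℝ) : coordC i q = (q.1 i : ℂ) := rfl

@[simp] theorem timeC_apply (q : Space × ℝ) : timeC q = (q.2 : ℂ) := rfl

/-- The amplitude of a horizontal derivative. -/
def weightX (j : Fin 2) (ξ : Plane) : ℂ := Complex.I * (ξ j : ℂ)

/-- The amplitude of the time derivative. -/
def weightT (S : Params) (ξ : Plane) : ℂ := (growthRate S ‖ξ‖ : ℂ)

theorem measurable_weightX (j : Fin 2) : Measurable (weightX j) := by
  unfold weightX
  fun_prop

theorem measurable_weightT : Measurable (weightT S) :=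
  Complex.measurable_ofReal.comp ((measurable_growthRate S).comp measurable_norm)

theorem norm_weightX_le (j : Fin 2) (ξ : Plane) : ‖weightX j ξ‖ ≤ ‖ξ‖ := by
  simpa [weightX] using PiLp.norm_apply_le ξ j

theorem norm_weightT_le {R : ℝ} {ξ : Plane} (h : ‖ξ‖ ≤ R) : ‖weightT S ξ‖ ≤ √(S.g * R) := by
  rw [weightT, Complex.norm_real, Real.norm_eq_abs, abs_of_nonneg (growthRate_nonneg _)]
  exact growthRate_le h

/-- The plane wave is the exponential of a real-linear functional on space-time with coefficients
`iξ₁`, `iξ₂` and `λ`. -/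
theorem hasFDerivAt_wave (ξ : Plane) (q : Space × ℝ) :
    HasFDerivAt (fun q : Space × ℝ => wave S ξ q.1 q.2) (wave S ξ q.1 q.2 •
      (weightX 0 ξ • coordC 0 + weightX 1 ξ • coordC 1 + weightT S ξ • timeC)) q := by
  set G : Space × ℝ →L[ℝ] ℂ :=
    weightX 0 ξ • coordC 0 + weightX 1 ξ • coordC 1 + weightT S ξ • timeC with hG
  have e : ∀ q : Space × ℝ, wave S ξ q.1 q.2 = Complex.exp (G q) := fun q => by
    rw [wave, Complex.ofReal_exp, ← Complex.exp_add]
    congr 1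
    simp only [hG, weightX, weightT, add_apply, smul_apply,
      coordC_apply, timeC_apply, smul_eq_mul]
    push_cast
    ring
  have h := (G.hasFDerivAt (x := q)).cexp
  rw [← e q] at h
  exact h.congr_of_eventuallyEq (Eventually.of_forall e)

/-- The total derivative of a synthesis. -/
def synthD (S : Params) (a a' : Plane → ℝ → ℂ) (q : Space × ℝ) : Space × ℝ →L[ℝ] ℂ :=
  synth S (fun ξ s => weightX 0 ξ * a ξ s) q.1 q.2 • coordC 0
    + synth S (fun ξ s => weightX 1 ξ * a ξ s) q.1 q.2 • coordC 1
    + synth S a' q.1 q.2 • coordC 2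
    + synth S (fun ξ s => weightT S ξ * a ξ s) q.1 q.2 • timeC

/-! ### Differentiation of syntheses. -/

namespace IsAmp

variable {R : ℝ} {I : Set ℝ} {a a' : Plane → ℝ → ℂ}

theorem weightX_mul (h : IsAmp R I a) (j : Fin 2) : IsAmp R I fun ξ s => weightX j ξ * a ξ s :=
  h.mul_weight (measurable_weightX j) ⟨R, fun ξ hξ => (norm_weightX_le j ξ).trans hξ⟩

theorem weightT_mul (h : IsAmp R I a) : IsAmp R I fun ξ s => weightT S ξ * a ξ s :=
  h.mul_weight measurable_weightT ⟨_, fun _ hξ => norm_weightT_le hξ⟩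

/-- Differentiation under the integral. Horizontal and time derivatives multiply the amplitude by
`iξ_j` or `λ`, bounded on the frequency support; the vertical one falls on the amplitude. All are
dominated on a unit time interval by a constant on a ball of frequencies. -/
theorem hasFDerivAt_synth (hI : IsOpen I) (h : IsAmp R I a) (h' : IsAmp R I a')
    (hd : ∀ ξ, ∀ s ∈ I, HasDerivAt (a ξ) (a' ξ s) s) {q : Space × ℝ} (hq : q.1 2 ∈ I) :
    HasFDerivAt (fun q : Space × ℝ => synth S a q.1 q.2) (synthD S a a' q) q := by
  have h0 := h.weightX_mul 0
  have h1 := h.weightX_mul 1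
  have ht := h.weightT_mul (S := S)
  obtain ⟨C0, hC0, b0⟩ := h0.exists_dominating (S := S) (|q.2| + 1)
  obtain ⟨C1, hC1, b1⟩ := h1.exists_dominating (S := S) (|q.2| + 1)
  obtain ⟨C2, hC2, b2⟩ := h'.exists_dominating (S := S) (|q.2| + 1)
  obtain ⟨C3, hC3, b3⟩ := ht.exists_dominating (S := S) (|q.2| + 1)
  set F' : Space × ℝ → Plane → (Space × ℝ →L[ℝ] ℂ) := fun q ξ =>
    ((weightX 0 ξ * a ξ (q.1 2)) * wave S ξ q.1 q.2) • coordC 0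
    + ((weightX 1 ξ * a ξ (q.1 2)) * wave S ξ q.1 q.2) • coordC 1
    + (a' ξ (q.1 2) * wave S ξ q.1 q.2) • coordC 2
    + ((weightT S ξ * a ξ (q.1 2)) * wave S ξ q.1 q.2) • timeC with hF'
  have i0 := (h0.integrable (S := S) hq q.2).smul_const (coordC 0)
  have i1 := (h1.integrable (S := S) hq q.2).smul_const (coordC 1)
  have i2 := (h'.integrable (S := S) hq q.2).smul_const (coordC 2)
  have i3 := (ht.integrable (S := S) hq q.2).smul_const timeC
  have e : synthD S a a' q = ∫ ξ, F' q ξ := by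
    have i01 : Integrable fun ξ => ((weightX 0 ξ * a ξ (q.1 2)) * wave S ξ q.1 q.2) • coordC 0
      + ((weightX 1 ξ * a ξ (q.1 2)) * wave S ξ q.1 q.2) • coordC 1 := i0.add i1
    have i012 : Integrable fun ξ => ((weightX 0 ξ * a ξ (q.1 2)) * wave S ξ q.1 q.2) • coordC 0
      + ((weightX 1 ξ * a ξ (q.1 2)) * wave S ξ q.1 q.2) • coordC 1
      + (a' ξ (q.1 2) * wave S ξ q.1 q.2) • coordC 2 := i01.add i2
    rw [hF', integral_add i012 i3, integral_add i01 i2, integral_add i0 i1]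
    simp only [integral_smul_const]
    rfl
  rw [e]
  have hc : Continuous fun q : Space × ℝ => q.1 2 := by fun_prop
  set U : Set (Space × ℝ) := (fun q : Space × ℝ => q.1 2) ⁻¹' I ∩
    (fun q : Space × ℝ => q.2) ⁻¹' Metric.ball q.2 1 with hU
  have hUo : IsOpen U := (hI.preimage hc).inter (Metric.isOpen_ball.preimage continuous_snd)
  have hqU : q ∈ U := ⟨hq, Metric.mem_ball_self one_pos⟩
  have hUt : ∀ w ∈ U, |w.2| ≤ |q.2| + 1 := fun w hw => by
    have : |w.2 - q.2| < 1 := hw.2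
    have := abs_sub_abs_le_abs_sub w.2 q.2
    linarith
  refine hasFDerivAt_integral_of_dominated_of_fderiv_le (s := U) (F' := F')
    (bound := (Metric.closedBall (0 : Plane) R).indicator fun _ =>
      C0 * ‖coordC 0‖ + C1 * ‖coordC 1‖ + C2 * ‖coordC 2‖ + C3 * ‖timeC‖)
    (hUo.mem_nhds hqU) ?_ (h.integrable hq q.2) ?_ ?_
    (integrable_indicator_closedBall R _) ?_
  · filter_upwards [hUo.mem_nhds hqU] with w hw
    exact (h.integrable hw.1 w.2).aestronglyMeasurable
  · exact (((i0.add i1).add i2).add i3).aestronglyMeasurable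
  · refine ae_of_all _ fun ξ w hw => ?_
    have c0 := b0 ξ w.1 hw.1 w.2 (hUt w hw)
    have c1 := b1 ξ w.1 hw.1 w.2 (hUt w hw)
    have c2 := b2 ξ w.1 hw.1 w.2 (hUt w hw)
    have c3 := b3 ξ w.1 hw.1 w.2 (hUt w hw)
    have hnorm : ‖F' w ξ‖ ≤ ‖(weightX 0 ξ * a ξ (w.1 2)) * wave S ξ w.1 w.2‖ * ‖coordC 0‖
        + ‖(weightX 1 ξ * a ξ (w.1 2)) * wave S ξ w.1 w.2‖ * ‖coordC 1‖
        + ‖a' ξ (w.1 2) * wave S ξ w.1 w.2‖ * ‖coordC 2‖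
        + ‖(weightT S ξ * a ξ (w.1 2)) * wave S ξ w.1 w.2‖ * ‖timeC‖ := by
      refine (norm_add_le _ _).trans (add_le_add ((norm_add_le _ _).trans
        (add_le_add ((norm_add_le _ _).trans (add_le_add ?_ ?_)) ?_)) ?_) <;>
      exact (norm_smul _ _).le
    refine hnorm.trans ?_
    by_cases hξ : ξ ∈ Metric.closedBall (0 : Plane) R
    · rw [indicator_of_mem hξ] at c0 c1 c2 c3 ⊢
      gcongr
    · rw [indicator_of_notMem hξ] at c0 c1 c2 c3 ⊢
      have z0 := le_antisymm c0 (norm_nonneg _)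
      have z1 := le_antisymm c1 (norm_nonneg _)
      have z2 := le_antisymm c2 (norm_nonneg _)
      have z3 := le_antisymm c3 (norm_nonneg _)
      rw [z0, z1, z2, z3]
      simp
  · refine ae_of_all _ fun ξ w hw => ?_
    have hproj : HasFDerivAt (fun q : Space × ℝ => q.1 2)
        ((ContinuousLinearMap.proj 2) ∘L (ContinuousLinearMap.fst ℝ Space ℝ)) w :=
      ((ContinuousLinearMap.proj (R := ℝ) (φ := fun _ : Fin 3 => ℝ) 2) ∘L
        (ContinuousLinearMap.fst ℝ Space ℝ)).hasFDerivAt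
    have ha := (hd ξ (w.1 2) hw.1).hasFDerivAt.comp w hproj
    have hm := ha.mul (hasFDerivAt_wave (S := S) ξ w)
    refine hm.congr_fderiv ?_
    ext v <;>
    · simp [hF']
      ring

theorem contDiffOn_synth (hI : IsOpen I) (h : IsAmp R I a) (h' : IsAmp R I a')
    (hd : ∀ ξ, ∀ s ∈ I, HasDerivAt (a ξ) (a' ξ s) s) :
    ContDiffOn ℝ 1 (fun q : Space × ℝ => synth S a q.1 q.2) {q | q.1 2 ∈ I} := by
  have hc : Continuous fun q : Space × ℝ => q.1 2 := by fun_prop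
  have hO : IsOpen {q : Space × ℝ | q.1 2 ∈ I} := hI.preimage hc
  have hD := fun q (hq : q ∈ {q : Space × ℝ | q.1 2 ∈ I}) =>
    hasFDerivAt_synth (S := S) hI h h' hd hq
  rw [← zero_add (1 : WithTop ℕ∞), contDiffOn_succ_iff_fderiv_of_isOpen hO]
  refine ⟨fun q hq => (hD q hq).differentiableAt.differentiableWithinAt, by simp, ?_⟩
  rw [contDiffOn_zero]
  refine ContinuousOn.congr (f := synthD S a a') ?_ fun q hq => (hD q hq).fderiv
  intro q hq
  have k0 := (h.weightX_mul 0).continuousAt_synth (S := S) hI hq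
  have k1 := (h.weightX_mul 1).continuousAt_synth (S := S) hI hq
  have k2 := h'.continuousAt_synth (S := S) hI hq
  have k3 := (h.weightT_mul (S := S)).continuousAt_synth (S := S) hI hq
  exact ((((k0.smul continuousAt_const).add (k1.smul continuousAt_const)).add
    (k2.smul continuousAt_const)).add (k3.smul continuousAt_const)).continuousWithinAt

end IsAmp

end RayleighTaylor

end

noncomputable section

namespace RayleighTaylor

variable {S : Params}

/-! ### Amplitudes built from normal modes -/

/-- Bounded horizontal coefficients supported in the annulus `R₂ ≤ |ξ| ≤ R₃`. -/
structure IsCoef (R₂ R₃ : ℝ) (c : Plane → ℂ) : Prop where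
  meas : Measurable c
  bdd : ∃ C, ∀ ξ, ‖c ξ‖ ≤ C
  supp : ∀ ξ, c ξ ≠ 0 → R₂ ≤ ‖ξ‖ ∧ ‖ξ‖ ≤ R₃

/-- The amplitude `c(ξ) (a ψ + b p)(|ξ|, s)`. -/
def amp (c : Plane → ℂ) (a b ψ p : ℝ → ℝ → ℝ) (ξ : Plane) (s : ℝ) : ℂ :=
  c ξ * ((a ‖ξ‖ s * ψ ‖ξ‖ s + b ‖ξ‖ s * p ‖ξ‖ s : ℝ) : ℂ)

theorem IsCoef.mul {R₂ R₃ : ℝ} {c m : Plane → ℂ} (h : IsCoef R₂ R₃ c) (hm : Measurable m)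
    (hb : ∃ C, ∀ ξ, R₂ ≤ ‖ξ‖ → ‖ξ‖ ≤ R₃ → ‖m ξ‖ ≤ C) : IsCoef R₂ R₃ fun ξ => m ξ * c ξ where
  meas := hm.mul h.meas
  bdd := by
    obtain ⟨C, hC⟩ := hb
    obtain ⟨B, hB⟩ := h.bdd
    refine ⟨max C 0 * max B 0, fun ξ => ?_⟩
    by_cases hξ : c ξ = 0
    · rw [hξ, mul_zero, norm_zero]
      positivity
    · obtain ⟨h1, h2⟩ := h.supp ξ hξ
      rw [norm_mul]
      exact mul_le_mul ((hC ξ h1 h2).trans (le_max_left _ _)) ((hB ξ).trans (le_max_left _ _))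
        (norm_nonneg _) (le_max_right _ _)
  supp ξ hξ := h.supp ξ (right_ne_zero_of_mul hξ)

theorem IsCoef.weightT_mul {R₂ R₃ : ℝ} {c : Plane → ℂ} (h : IsCoef R₂ R₃ c) :
    IsCoef R₂ R₃ fun ξ => weightT S ξ * c ξ :=
  h.mul measurable_weightT ⟨_, fun _ _ hξ => norm_weightT_le hξ⟩

theorem exists_measurable_eq {F : ℝ → ℝ} (h : Measurable fun r : Ioi (0 : ℝ) => F r) :
    ∃ G : ℝ → ℝ, Measurable G ∧ ∀ r, 0 < r → G r = F r := by
  refine ⟨Function.extend ((↑) : Ioi (0 : ℝ) → ℝ) (fun r : Ioi (0 : ℝ) => F r) 0,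
    (MeasurableEmbedding.subtype_coe measurableSet_Ioi).measurable_extend h measurable_zero,
    fun r hr => ?_⟩
  exact Subtype.val_injective.extend_apply (fun r : Ioi (0 : ℝ) => F r) 0 ⟨r, hr⟩

theorem Layer.mem_Icc (L : Layer S) {s : ℝ} (hs : s ∈ Ioo L.a L.b) : s ∈ Icc (-S.m) S.ℓ :=
  Ioo_subset_Icc_self (L.mem s hs).1

namespace ModeData

variable {φ ψ p : ℝ → ℝ → ℝ} {κ r₀ R₂ R₃ : ℝ} {c : Plane → ℂ} {a b : ℝ → ℝ → ℝ} {i j : ℕ}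

theorem hasDerivAt (h : ModeData S φ ψ p) (L : Layer S) {r : ℝ} (hr : 0 < r) {s : ℝ}
    (hs : s ∈ Ioo L.a L.b) :
    HasDerivAt (ψ r) (slopePsi S r (growthRate S r ^ 2) s (ψ r s) (p r s)) s ∧
    HasDerivAt (p r) (slopeP S r (growthRate S r ^ 2) s (ψ r s) (p r s)) s :=
  (h.sol r hr).hasDerivAt (L.mem s hs).1 (L.mem s hs).2

/-- The coefficient `c` vanishes below the threshold `r₀`. This excludes `r = 0`, where the family
is arbitrary, and the low frequencies, for which neither the sup bound nor the symbol estimates are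
available. -/
theorem isAmp (h : ModeData S φ ψ p) (hG : GrowthBound S κ r₀) (hr : r₀ ≤ R₂) (L : Layer S)
    (ha : Symbol L.J r₀ i a) (hb : Symbol L.J r₀ j b) (hc : IsCoef R₂ R₃ c) :
    IsAmp R₃ (Ioo L.a L.b) (amp c a b ψ p) where
  meas s hs := by
    obtain ⟨h1, h2⟩ := L.mem s hs
    obtain ⟨G, hGm, hGe⟩ := exists_measurable_eq (F := fun r => ψ r s) (h.meas_ψ s h1 h2)
    obtain ⟨H, hHm, hHe⟩ := exists_measurable_eq (F := fun r => p r s) (h.meas_p s h1 h2)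
    have e : (fun ξ => amp c a b ψ p ξ s)
        = fun ξ => c ξ * ((a ‖ξ‖ s * G ‖ξ‖ + b ‖ξ‖ s * H ‖ξ‖ : ℝ) : ℂ) := by
      ext ξ
      by_cases hξ : c ξ = 0
      · simp [amp, hξ]
      · have : 0 < ‖ξ‖ := by linarith [(hc.supp ξ hξ).1, hG.one_le]
        rw [amp, hGe _ this, hHe _ this]
    rw [e]
    refine hc.meas.mul (Complex.measurable_ofReal.comp ?_)
    exact (((ha.measurable s).mul hGm).add ((hb.measurable s).mul hHm)).comp measurable_norm
  cont ξ := by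
    by_cases hξ : c ξ = 0
    · refine (continuousOn_const (c := (0 : ℂ))).congr fun s _ => ?_
      rw [amp, hξ, zero_mul]
    · have : 0 < ‖ξ‖ := by linarith [(hc.supp ξ hξ).1, hG.one_le]
      have hsub : Ioo L.a L.b ⊆ L.J := Ioo_subset_Icc_self.trans L.subset
      have hs := h.sol _ this
      have hI : Ioo L.a L.b ⊆ Icc (-S.m) S.ℓ := fun s hs => L.mem_Icc hs
      exact continuousOn_const.mul (Complex.continuous_ofReal.comp_continuousOn
        ((((ha.continuousOn L.isOpen _).mono hsub).mul (hs.cont_ψ.mono hI)).add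
          (((hb.continuousOn L.isOpen _).mono hsub).mul (hs.cont_p.mono hI))))
  bdd := by
    obtain ⟨C, hC⟩ := hc.bdd
    obtain ⟨B, hB0, hB⟩ := h.exists_sup_bound (R := R₃) hG.pos hG.one_le hG.le
    obtain ⟨A, hA⟩ := ha.exists_bound isCompact_Icc L.subset
    obtain ⟨E, hE⟩ := hb.exists_bound isCompact_Icc L.subset
    refine ⟨max C 0 * (|A| * |R₃| ^ i * B + |E| * |R₃| ^ j * B), fun ξ s hs => ?_⟩
    by_cases hξ : c ξ = 0
    · simp only [amp, hξ, zero_mul, norm_zero]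
      positivity
    · obtain ⟨h1, h2⟩ := hc.supp ξ hξ
      have h3 : r₀ ≤ ‖ξ‖ := hr.trans h1
      have hs' := Ioo_subset_Icc_self hs
      obtain ⟨b1, b2⟩ := hB _ h3 h2 s (L.mem_Icc hs)
      have h4 : ‖ξ‖ ≤ |R₃| := h2.trans (le_abs_self _)
      have a1 : |a ‖ξ‖ s| ≤ |A| * |R₃| ^ i := (hA _ h3 s hs').trans
        (mul_le_mul (le_abs_self _) (by gcongr) (by positivity) (abs_nonneg _))
      have a2 : |b ‖ξ‖ s| ≤ |E| * |R₃| ^ j := (hE _ h3 s hs').trans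
        (mul_le_mul (le_abs_self _) (by gcongr) (by positivity) (abs_nonneg _))
      rw [amp, norm_mul, Complex.norm_real, Real.norm_eq_abs]
      refine mul_le_mul ((hC ξ).trans (le_max_left _ _)) ((abs_add_le _ _).trans (add_le_add ?_ ?_))
        (abs_nonneg _) (le_max_right _ _)
      · rw [abs_mul]
        gcongr
      · rw [abs_mul]
        gcongr
  supp ξ hξ s := by
    have : c ξ = 0 := by
      by_contra hne
      exact absurd (hc.supp ξ hne).2 (not_le.2 hξ)
    rw [amp, this, zero_mul]

theorem hasDerivAt_amp (h : ModeData S φ ψ p) (hG : GrowthBound S κ r₀) (hr : r₀ ≤ R₂)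
    (L : Layer S) (hc : IsCoef R₂ R₃ c) {a' b' : ℝ → ℝ → ℝ}
    (hd : ∀ r, ∀ s ∈ Ioo L.a L.b, ∀ ψ p : ℝ → ℝ,
        HasDerivAt ψ (slopePsi S r (growthRate S r ^ 2) s (ψ s) (p s)) s →
        HasDerivAt p (slopeP S r (growthRate S r ^ 2) s (ψ s) (p s)) s →
        HasDerivAt (fun s => a r s * ψ s + b r s * p s) (a' r s * ψ s + b' r s * p s) s)
    (ξ : Plane) (s : ℝ) (hs : s ∈ Ioo L.a L.b) :
    HasDerivAt (amp c a b ψ p ξ) (amp c a' b' ψ p ξ s) s := by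
  by_cases hξ : c ξ = 0
  · have e : amp c a b ψ p ξ = fun _ => 0 := funext fun s => by simp [amp, hξ]
    rw [e]
    simpa [amp, hξ] using hasDerivAt_const s (0 : ℂ)
  · have : 0 < ‖ξ‖ := by linarith [(hc.supp ξ hξ).1, hG.one_le]
    obtain ⟨h1, h2⟩ := h.hasDerivAt L this hs
    exact ((hd _ s hs _ _ h1 h2).ofReal_comp).const_mul (c ξ)

end ModeData

end RayleighTaylor

end

noncomputable section

namespace RayleighTaylor

/-! ### The Plancherel theorem in the plane -/

open scoped FourierTransform SchwartzMap

/-- Both versions of the transform pair in the same way with smooth compactly supported functions: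
the `L²` version through tempered distributions, the integral version by Fubini. -/
theorem ae_eq_fourier {f : Plane → ℂ} (h1 : Integrable f) (h2 : MemLp f 2) :
    (𝓕 (h2.toLp f) : Lp ℂ 2 (volume : Measure Plane)) =ᵐ[volume] 𝓕 f := by
  set F : Lp ℂ 2 (volume : Measure Plane) := 𝓕 (h2.toLp f) with hF
  have hcont : Continuous (𝓕 f) := VectorFourier.fourierIntegral_continuous Real.continuous_fourierChar
    (by exact continuous_inner) h1
  have hloc : LocallyIntegrable (fun x => F x - 𝓕 f x) :=
    ((Lp.memLp F).locallyIntegrable (by norm_num)).sub hcont.locallyIntegrable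
  have key := ae_eq_zero_of_integral_contDiff_smul_eq_zero hloc fun g hg hgc => by
    have hg' : ContDiff ℝ ∞ (fun x => (g x : ℂ)) := Complex.ofRealCLM.contDiff.comp hg
    have hgc' : HasCompactSupport (fun x => (g x : ℂ)) := hgc.comp_left Complex.ofReal_zero
    set G : 𝓢(Plane, ℂ) := hgc'.toSchwartzMap hg' with hG
    have hGx : ∀ x, G x = (g x : ℂ) := fun x => rfl
    have e1 : ∫ x, G x • F x = ∫ x, (𝓕 G) x • f x := by
      have := congrArg (fun T : 𝓢'(Plane, ℂ) => T G) (Lp.fourier_toTemperedDistribution_eq (h2.toLp f))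
      simp only [TemperedDistribution.fourier_apply, Lp.toTemperedDistribution_apply] at this
      rw [← this]
      refine integral_congr_ae ?_
      filter_upwards [h2.coeFn_toLp] with x hx
      rw [hx]
    have e2 : ∫ x, G x • 𝓕 f x = ∫ x, (𝓕 G) x • f x := by
      have := VectorFourier.integral_fourierIntegral_smul_eq_flip (μ := volume) (ν := volume)
        (L := innerₗ Plane) (f := G) (g := f) Real.continuous_fourierChar
        (by exact continuous_inner) G.integrable h1
      rw [flip_innerₗ] at this
      exact this.symm
    have i1 : Integrable fun x => G x • F x := by
      have := ((Lp.memLp F).integrable_mul (G.memLp 2)) 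
      refine this.congr (ae_of_all _ fun x => ?_)
      simp [mul_comm]
    have i2 : Integrable fun x => G x • 𝓕 f x := by
      have hc : HasCompactSupport fun x => G x • 𝓕 f x := hgc'.smul_right
      exact (G.continuous.smul hcont).integrable_of_hasCompactSupport hc
    have : ∫ x, (G x • F x - G x • 𝓕 f x) = 0 := by
      rw [integral_sub i1 i2, e1, e2, sub_self]
    rw [← this]
    refine integral_congr_ae (ae_of_all _ fun x => ?_)
    simp only [hGx, smul_eq_mul, Complex.real_smul]
    ring
  filter_upwards [key] with x hx using sub_eq_zero.1 hx

theorem lintegral_enorm_sq_fourier {f : Plane → ℂ} (h1 : Integrable f) (h2 : MemLp f 2) :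
    ∫⁻ x, ‖𝓕 f x‖ₑ ^ 2 = ∫⁻ x, ‖f x‖ₑ ^ 2 := by
  have hm : MemLp (𝓕 f) 2 := (memLp_congr_ae (ae_eq_fourier h1 h2)).1 (Lp.memLp _)
  have e : eLpNorm (𝓕 f) 2 volume = eLpNorm f 2 volume := by
    rw [← eLpNorm_congr_ae (ae_eq_fourier h1 h2), ← eLpNorm_congr_ae h2.coeFn_toLp]
    have := Lp.norm_fourier_eq (h2.toLp f)
    rw [Lp.norm_def, Lp.norm_def, ENNReal.toReal_eq_toReal_iff' (Lp.eLpNorm_ne_top _)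
      (Lp.eLpNorm_ne_top _)] at this
    exact this
  simp only [eLpNorm_eq_lintegral_rpow_enorm_toReal (p := 2) two_ne_zero ENNReal.ofNat_ne_top] at e
  simpa using ENNReal.rpow_left_injective (by norm_num) e

/-- `∫ G(ξ) e^{i x·ξ} dξ`. -/
def planeSynth (G : Plane → ℂ) (x : Plane) : ℂ :=
  ∫ ξ, G ξ * Complex.exp (Complex.I * ((x 0 * ξ 0 + x 1 * ξ 1 : ℝ) : ℂ))

theorem inner_plane (x y : Plane) : inner ℝ x y = x 0 * y 0 + x 1 * y 1 := by
  rw [PiLp.inner_apply, Fin.sum_univ_two]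
  simp [mul_comm]

theorem planeSynth_eq (G : Plane → ℂ) (x : Plane) :
    planeSynth G x = 𝓕 G ((-(2 * π)⁻¹ : ℝ) • x) := by
  rw [Real.fourier_eq', planeSynth]
  congr 1
  ext ξ
  rw [smul_eq_mul, mul_comm, inner_smul_right, real_inner_comm, inner_plane]
  congr 2
  rw [mul_comm]
  congr 2
  field_simp

theorem integral_exp_neg_eq (G : Plane → ℂ) (x : Plane) :
    ∫ ξ, G ξ * Complex.exp (-Complex.I * ((inner ℝ x ξ : ℝ) : ℂ)) = 𝓕 G ((2 * π)⁻¹ • x) := by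
  rw [Real.fourier_eq']
  congr 1
  ext ξ
  rw [smul_eq_mul, mul_comm, inner_smul_right, real_inner_comm]
  congr 2
  have : -2 * π * ((2 * π)⁻¹ * inner ℝ x ξ) = - inner ℝ x ξ := by field_simp
  rw [real_inner_comm, this]
  push_cast
  ring

theorem lintegral_comp_smul_plane {F : Plane → ℝ≥0∞} (hF : Measurable F) {r : ℝ} (hr : r ≠ 0) :
    ∫⁻ x, F (r • x) = ENNReal.ofReal |(r ^ 2)⁻¹| * ∫⁻ x, F x := by
  rw [← lintegral_map (f := F) (g := fun x : Plane => r • x) hF (measurable_const_smul r),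
    Measure.map_addHaar_smul _ hr, lintegral_smul_measure]
  simp

theorem lintegral_planeSynth {G : Plane → ℂ} (h1 : Integrable G) (h2 : MemLp G 2) :
    ∫⁻ x, ‖planeSynth G x‖ₑ ^ 2 = ENNReal.ofReal ((2 * π) ^ 2) * ∫⁻ ξ, ‖G ξ‖ₑ ^ 2 := by
  have hcont : Continuous (𝓕 G) := VectorFourier.fourierIntegral_continuous
    Real.continuous_fourierChar (by exact continuous_inner) h1
  simp only [planeSynth_eq]
  rw [lintegral_comp_smul_plane (F := fun y => ‖𝓕 G y‖ₑ ^ 2) (by fun_prop)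
    (neg_ne_zero.2 (by positivity)), lintegral_enorm_sq_fourier h1 h2]
  congr 2
  rw [neg_sq, abs_of_pos (by positivity)]
  field_simp

/-- After the substitution `x ↦ -x/(2π)` the factors are the transform of `G` and the inverse
transform of `Φ`. The multiplication formula moves the transform onto the second factor, where it
cancels; the Jacobian contributes `(2π)²`. -/
theorem integral_planeSynth_mul {G : Plane → ℂ} (hG : Integrable G) {Φ : Plane → ℝ}
    (hΦ : ContDiff ℝ ∞ Φ) (hc : HasCompactSupport Φ) :
    ∫ x, planeSynth G x * (∫ ξ, (Φ ξ : ℂ) * Complex.exp (-Complex.I * ((inner ℝ x ξ : ℝ) : ℂ)))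
      = (4 * π ^ 2 : ℝ) * ∫ ξ, G ξ * (Φ ξ : ℂ) := by
  have hg' : ContDiff ℝ ∞ (fun x => (Φ x : ℂ)) := Complex.ofRealCLM.contDiff.comp hΦ
  have hgc' : HasCompactSupport (fun x => (Φ x : ℂ)) := hc.comp_left Complex.ofReal_zero
  set P : 𝓢(Plane, ℂ) := hgc'.toSchwartzMap hg' with hP
  have hPx : (P : Plane → ℂ) = fun x => (Φ x : ℂ) := rfl
  have e1 : ∀ x : Plane, planeSynth G x *
      (∫ ξ, (Φ ξ : ℂ) * Complex.exp (-Complex.I * ((inner ℝ x ξ : ℝ) : ℂ)))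
      = (fun y => 𝓕 G y * (𝓕⁻ P) y) ((-(2 * π)⁻¹ : ℝ) • x) := fun x => by
    simp only
    rw [planeSynth_eq, integral_exp_neg_eq (fun ξ => (Φ ξ : ℂ)), SchwartzMap.fourierInv_coe,
      Real.fourierInv_eq_fourier_neg, hPx, neg_smul, neg_neg]
  rw [integral_congr_ae (ae_of_all _ e1)]
  refine (Measure.integral_comp_smul volume (fun y => 𝓕 G y * (𝓕⁻ P : 𝓢(Plane, ℂ)) y) _).trans ?_
  have e2 : ∫ y, 𝓕 G y * (𝓕⁻ P) y = ∫ ξ, G ξ * (Φ ξ : ℂ) := by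
    have := VectorFourier.integral_fourierIntegral_smul_eq_flip (μ := volume) (ν := volume)
      (L := innerₗ Plane) (f := G) (g := (𝓕⁻ P : 𝓢(Plane, ℂ))) Real.continuous_fourierChar
      (by exact continuous_inner) hG (𝓕⁻ P : 𝓢(Plane, ℂ)).integrable
    rw [flip_innerₗ] at this
    refine Eq.trans (by exact this) ?_
    refine integral_congr_ae (ae_of_all _ fun ξ => ?_)
    have h3 : 𝓕 ((𝓕⁻ P : 𝓢(Plane, ℂ)) : Plane → ℂ) ξ = P ξ := by
      rw [← SchwartzMap.fourier_coe, FourierTransform.fourier_fourierInv_eq]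
    exact congrArg (fun z => G ξ * z) h3
  rw [e2, finrank_euclideanSpace_fin, neg_sq, abs_of_pos (by positivity), Complex.real_smul]
  congr 2
  field_simp
  ring

end RayleighTaylor

end

noncomputable section

namespace RayleighTaylor

/-! ### Amplitudes on slabs -/

theorem slab_eq (I : Set ℝ) :
    slab I = (volume : Measure Plane).prod (volume.restrict I) := by
  rw [slab, ← Measure.restrict_univ (μ := (volume : Measure Plane)), Measure.prod_restrict,
    Measure.volume_eq_prod]

theorem ae_slab_mem {I : Set ℝ} (hI : MeasurableSet I) : ∀ᵐ p ∂(slab I), p.2 ∈ I := by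
  filter_upwards [ae_restrict_mem (MeasurableSet.univ.prod hI)] with p hp using hp.2

theorem memLp_two_of_lintegral {α : Type*} [MeasurableSpace α] {μ : Measure α} {f : α → ℂ}
    (hf : AEStronglyMeasurable f μ) (h : ∫⁻ x, ‖f x‖ₑ ^ 2 ∂μ < ⊤) : MemLp f 2 μ := by
  refine ⟨hf, (eLpNorm_lt_top_iff_lintegral_rpow_enorm_lt_top two_ne_zero
    ENNReal.ofNat_ne_top).2 ?_⟩
  simpa using h

namespace IsAmp

variable {R R' : ℝ} {I : Set ℝ} {G G' : Plane → ℝ → ℂ}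

theorem mul (h : IsAmp R I G) (h' : IsAmp R' I G') : IsAmp R I fun ξ s => G ξ s * G' ξ s where
  meas s hs := (h.meas s hs).mul (h'.meas s hs)
  cont ξ := (h.cont ξ).mul (h'.cont ξ)
  bdd := by
    obtain ⟨C, hC⟩ := h.bdd
    obtain ⟨B, hB⟩ := h'.bdd
    refine ⟨C * B, fun ξ s hs => ?_⟩
    rw [norm_mul]
    exact mul_le_mul (hC ξ s hs) (hB ξ s hs) (norm_nonneg _) ((norm_nonneg _).trans (hC ξ s hs))
  supp ξ hξ s := by rw [h.supp ξ hξ, zero_mul]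

theorem comp_neg (h : IsAmp R I G) : IsAmp R I fun ξ s => G (-ξ) s where
  meas s hs := (h.meas s hs).comp measurable_neg
  cont ξ := h.cont _
  bdd := by
    obtain ⟨C, hC⟩ := h.bdd
    exact ⟨C, fun ξ s hs => hC _ s hs⟩
  supp ξ hξ s := h.supp _ (by rwa [norm_neg]) s

theorem aestronglyMeasurable (h : IsAmp R I G) (hI : MeasurableSet I) :
    AEStronglyMeasurable (fun p : Plane × ℝ => G p.1 p.2) (slab I) := by
  refine (measurable_uncurry_indicator hI h.meas h.cont).aestronglyMeasurable.congr ?_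
  filter_upwards [ae_slab_mem hI] with p hp
  rw [indicator_of_mem hp]

theorem memLp (h : IsAmp R I G) (hI : MeasurableSet I) (hv : volume I ≠ ⊤) (r : ℝ≥0∞) :
    MemLp (fun p : Plane × ℝ => G p.1 p.2) r (slab I) := by
  obtain ⟨C, hC⟩ := h.bdd
  have hm : MeasurableSet (Metric.closedBall (0 : Plane) R ×ˢ (univ : Set ℝ)) :=
    Metric.isClosed_closedBall.measurableSet.prod MeasurableSet.univ
  have hfin : slab I (Metric.closedBall (0 : Plane) R ×ˢ (univ : Set ℝ)) ≠ ⊤ := by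
    rw [slab_eq, Measure.prod_prod, Measure.restrict_apply_univ]
    exact ENNReal.mul_ne_top measure_closedBall_lt_top.ne hv
  refine (memLp_indicator_const r hm C (Or.inr hfin)).mono (h.aestronglyMeasurable hI) ?_
  filter_upwards [ae_slab_mem hI] with p hp
  by_cases hξ : ‖p.1‖ ≤ R
  · rw [indicator_of_mem (mem_prod.2 ⟨by simpa using hξ, mem_univ _⟩), Real.norm_eq_abs]
    exact (hC _ _ hp).trans (le_abs_self _)
  · rw [h.supp _ (not_le.1 hξ), norm_zero]
    positivity

theorem integrable_slab (h : IsAmp R I G) (hI : MeasurableSet I) (hv : volume I ≠ ⊤) :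
    Integrable (fun p : Plane × ℝ => G p.1 p.2) (slab I) :=
  memLp_one_iff_integrable.1 (h.memLp hI hv 1)

theorem memLp_slice (h : IsAmp R I G) {s : ℝ} (hs : s ∈ I) (r : ℝ≥0∞) :
    MemLp (fun ξ => G ξ s) r := by
  obtain ⟨C, hC⟩ := h.bdd
  refine (memLp_indicator_const r Metric.isClosed_closedBall.measurableSet C
    (Or.inr (measure_closedBall_lt_top (x := (0 : Plane)) (r := R)).ne)).mono
    (h.meas s hs).aestronglyMeasurable (ae_of_all _ fun ξ => ?_)
  by_cases hξ : ‖ξ‖ ≤ R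
  · rw [indicator_of_mem (by simpa using hξ), Real.norm_eq_abs]
    exact (hC _ _ hs).trans (le_abs_self _)
  · rw [h.supp _ (not_le.1 hξ), norm_zero]
    positivity

/-- At time zero the growth factor is one, so `synth` reduces to `planeSynth` for any choice of `S`,
and its continuity carries over. -/
theorem continuousOn_planeSynth (S : Params) (h : IsAmp R I G) (hI : IsOpen I) :
    ContinuousOn (fun p : Plane × ℝ => planeSynth (fun ξ => G ξ p.2) p.1) (univ ×ˢ I) := by
  intro p hp
  have hX : Continuous fun p : Plane × ℝ => ((![p.1 0, p.1 1, p.2] : Space), (0 : ℝ)) := by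
    refine Continuous.prodMk (continuous_pi fun i => ?_) continuous_const
    fin_cases i <;> simp <;> fun_prop
  have e : (fun p : Plane × ℝ => planeSynth (fun ξ => G ξ p.2) p.1)
      = (fun q : Space × ℝ => synth S G q.1 q.2) ∘
        fun p : Plane × ℝ => ((![p.1 0, p.1 1, p.2] : Space), (0 : ℝ)) := by
    ext p
    simp [planeSynth, synth, wave]
  rw [e]
  have := h.continuousAt_synth (S := S) hI (q := ((![p.1 0, p.1 1, p.2] : Space), (0 : ℝ)))
    (by simpa using hp.2)
  exact (ContinuousAt.comp (f := fun p : Plane × ℝ => ((![p.1 0, p.1 1, p.2] : Space), (0 : ℝ)))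
    this hX.continuousAt).continuousWithinAt

/-- Plancherel in each horizontal plane, integrated over the heights by Tonelli. -/
theorem memLp_planeSynth (S : Params) (h : IsAmp R I G) (hI : IsOpen I) (hv : volume I ≠ ⊤) :
    MemLp (fun p : Plane × ℝ => planeSynth (fun ξ => G ξ p.2) p.1) 2 (slab I) := by
  have hIm := hI.measurableSet
  have hm : AEStronglyMeasurable (fun p : Plane × ℝ => planeSynth (fun ξ => G ξ p.2) p.1)
      (slab I) :=
    (h.continuousOn_planeSynth S hI).aestronglyMeasurable (MeasurableSet.univ.prod hIm)
  refine memLp_two_of_lintegral hm ?_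
  have hfin : ∫⁻ p, ‖G p.1 p.2‖ₑ ^ 2 ∂(slab I) < ⊤ := by
    have := (eLpNorm_lt_top_iff_lintegral_rpow_enorm_lt_top two_ne_zero
      ENNReal.ofNat_ne_top).1 (h.memLp hIm hv 2).2
    simpa using this
  have hGm := (h.aestronglyMeasurable hIm).enorm.pow_const 2
  have hm' := hm.enorm.pow_const 2
  rw [slab_eq] at hfin hGm hm' ⊢
  rw [lintegral_prod_symm _ hGm] at hfin
  rw [lintegral_prod_symm _ hm']
  calc _ = ∫⁻ s, ENNReal.ofReal ((2 * π) ^ 2) * (∫⁻ ξ, ‖G ξ s‖ₑ ^ 2) ∂(volume.restrict I) := by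
        refine setLIntegral_congr_fun hIm fun s hs => ?_
        exact lintegral_planeSynth (memLp_one_iff_integrable.1 (h.memLp_slice hs 1))
          (h.memLp_slice hs 2)
    _ = ENNReal.ofReal ((2 * π) ^ 2) * ∫⁻ s, (∫⁻ ξ, ‖G ξ s‖ₑ ^ 2) ∂(volume.restrict I) :=
        lintegral_const_mul' _ _ ENNReal.ofReal_ne_top
    _ < ⊤ := ENNReal.mul_lt_top ENNReal.ofReal_lt_top hfin

end IsAmp

/-! ### Test functions on slabs. -/

theorem exists_isAmp {Φ : Plane × ℝ → ℂ} (hΦ : Continuous Φ) (hc : HasCompactSupport Φ)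
    (I : Set ℝ) : ∃ R, IsAmp R I fun ξ s => Φ (ξ, s) := by
  obtain ⟨R, hR⟩ := hc.isCompact.isBounded.subset_closedBall (0 : Plane × ℝ)
  obtain ⟨C, hC⟩ := hΦ.bounded_above_of_compact_support hc
  refine ⟨R, ⟨fun s _ => ?_, fun ξ => ?_, ⟨C, fun ξ s _ => hC _⟩, fun ξ hξ s => ?_⟩⟩
  · exact (hΦ.comp (by fun_prop : Continuous fun ξ : Plane => (ξ, s))).measurable
  · exact (hΦ.comp (by fun_prop : Continuous fun s : ℝ => (ξ, s))).continuousOn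
  · by_contra hne
    have := hR (subset_tsupport _ hne)
    rw [mem_closedBall_zero_iff] at this
    exact absurd ((norm_fst_le (ξ, s)).trans this) (not_le.2 hξ)

namespace IsTest

variable {I : Set ℝ} {Φ : Plane × ℝ → ℝ}

theorem exists_isAmp (h : IsTest I Φ) : ∃ R, IsAmp R I fun ξ s => (Φ (ξ, s) : ℂ) :=
  RayleighTaylor.exists_isAmp (Φ := fun p => (Φ p : ℂ))
    (Complex.continuous_ofReal.comp h.smooth.continuous) (h.compact.comp_left Complex.ofReal_zero) I

theorem exists_isAmp_deriv (h : IsTest I Φ) :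
    ∃ R, IsAmp R I fun ξ s => ((fderiv ℝ Φ (ξ, s) (0, 1) : ℝ) : ℂ) := by
  refine RayleighTaylor.exists_isAmp (Φ := fun p => ((fderiv ℝ Φ p (0, 1) : ℝ) : ℂ)) ?_ ?_ I
  · exact Complex.continuous_ofReal.comp
      ((h.smooth.continuous_fderiv (by simp)).clm_apply continuous_const)
  · exact (h.compact.fderiv_apply (𝕜 := ℝ) (0, 1)).comp_left Complex.ofReal_zero

theorem slice (h : IsTest I Φ) (s : ℝ) :
    ContDiff ℝ ∞ (fun ξ => Φ (ξ, s)) ∧ HasCompactSupport fun ξ => Φ (ξ, s) := by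
  refine ⟨h.smooth.comp (by fun_prop), ?_⟩
  obtain ⟨R, hR⟩ := h.exists_isAmp
  refine HasCompactSupport.intro (isCompact_closedBall (0 : Plane) R) fun ξ hξ => ?_
  exact Complex.ofReal_eq_zero.1 (hR.supp ξ (by simpa using hξ) s)

theorem hasDerivAt (h : IsTest I Φ) (ξ : Plane) (s : ℝ) :
    HasDerivAt (fun s => Φ (ξ, s)) (fderiv ℝ Φ (ξ, s) (0, 1)) s := by
  have h1 : HasFDerivAt Φ (fderiv ℝ Φ (ξ, s)) (ξ, s) :=
    ((h.smooth.differentiable (by simp)) _).hasFDerivAt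
  exact h1.comp_hasDerivAt s ((hasDerivAt_const s ξ).prodMk (hasDerivAt_id s))

end IsTest

/-! ### Horizontal Fourier transforms and weak derivatives -/

section

variable {R R' : ℝ} {I : Set ℝ} {G G' : Plane → ℝ → ℂ}

/-- Fourier inversion at each height, combined by Fubini. The factor `1/(4π²)` of the synthesis
cancels the Jacobian of the duality formula. -/
theorem IsAmp.isHorizontalFourier (S : Params) (h : IsAmp R I G) (hI : IsOpen I)
    (hv : volume I ≠ ⊤) {u : Plane × ℝ → ℝ}
    (hu : ∀ x : Plane, ∀ s ∈ I, (u (x, s) : ℂ)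
      = ((1 / (4 * π ^ 2) : ℝ) : ℂ) * planeSynth (fun ξ => G ξ s) x) :
    IsHorizontalFourier I u fun p => G p.1 p.2 := by
  have hIm := hI.measurableSet
  have hu' : (fun p : Plane × ℝ => ((1 / (4 * π ^ 2) : ℝ) : ℂ) *
      planeSynth (fun ξ => G ξ p.2) p.1) =ᵐ[slab I] fun p => (u p : ℂ) := by
    filter_upwards [ae_slab_mem hIm] with p hp
    rw [← hu _ _ hp]
  have huL : MemLp (fun p => (u p : ℂ)) 2 (slab I) :=
    (memLp_congr_ae hu').1 ((h.memLp_planeSynth S hI hv).const_mul _)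
  refine ⟨?_, h.memLp hIm hv 2, fun Φ hΦ => ?_⟩
  · simpa using! huL.re
  obtain ⟨R₁, hR₁⟩ := hΦ.exists_isAmp
  have hΦL := hR₁.comp_neg.memLp_planeSynth S hI hv
  have e : ∀ p : Plane × ℝ, planeSynth (fun ξ => ((Φ (-ξ, p.2) : ℝ) : ℂ)) p.1
      = ∫ ξ : Plane, (Φ (ξ, p.2) : ℂ) *
        Complex.exp (-Complex.I * ((inner ℝ p.1 ξ : ℝ) : ℂ)) := fun p => by
    rw [planeSynth, ← integral_neg_eq_self]
    congr 1
    ext ξ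
    rw [neg_neg, inner_plane]
    congr 2
    simp only [PiLp.neg_apply]
    push_cast
    ring
  simp only [e] at hΦL
  have i1 := (h.mul hR₁).integrable_slab hIm hv
  have i2 := huL.integrable_mul hΦL
  simp only [Pi.mul_def] at i2
  rw [slab_eq] at i1 i2 ⊢
  rw [integral_prod_symm _ i1, integral_prod_symm _ i2]
  refine setIntegral_congr_fun hIm fun s hs => ?_
  obtain ⟨c1, c2⟩ := hΦ.slice s
  have key := integral_planeSynth_mul (memLp_one_iff_integrable.1 (h.memLp_slice hs 1)) c1 c2
  simp only [hu _ s hs, mul_assoc]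
  rw [integral_const_mul, key, ← mul_assoc, ← Complex.ofReal_mul]
  have : (1 / (4 * π ^ 2)) * (4 * π ^ 2) = 1 := by field_simp
  rw [this, Complex.ofReal_one, one_mul]

/-- For almost every `ξ` the product of `G` and the test function, extended by zero, is
differentiable on the whole line: the test function vanishes near the endpoints of `I`. The integral
of its derivative is zero. -/
theorem IsAmp.isWeakVertDeriv (h : IsAmp R I G) (h' : IsAmp R' I G') (hI : IsOpen I)
    (hv : volume I ≠ ⊤) (hd : ∀ ξ, ∀ s ∈ I, HasDerivAt (G ξ) (G' ξ s) s) :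
    IsWeakVertDeriv I (fun p => G p.1 p.2) fun p => G' p.1 p.2 := by
  intro Φ hΦ
  have hIm := hI.measurableSet
  obtain ⟨R₁, hR₁⟩ := hΦ.exists_isAmp
  obtain ⟨R₂, hR₂⟩ := hΦ.exists_isAmp_deriv
  have i0 := (h.mul hR₁).integrable_slab hIm hv
  have i1 := (h'.mul hR₁).integrable_slab hIm hv
  have i2 := (h.mul hR₂).integrable_slab hIm hv
  rw [eq_neg_iff_add_eq_zero, ← integral_add i1 i2]
  have i3 : Integrable (fun p : Plane × ℝ => G' p.1 p.2 * (Φ (p.1, p.2) : ℂ)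
      + G p.1 p.2 * ((fderiv ℝ Φ (p.1, p.2) (0, 1) : ℝ) : ℂ)) (slab I) := i1.add i2
  rw [slab_eq] at i0 i3 ⊢
  rw [integral_prod _ i3]
  refine integral_eq_zero_of_ae ?_
  filter_upwards [i0.prod_right_ae, i3.prod_right_ae] with ξ j0 j3
  have j0' := (integrable_indicator_iff hIm).2 j0
  have j3' := (integrable_indicator_iff hIm).2 j3
  simp only [Pi.zero_apply]
  rw [← integral_indicator hIm]
  refine integral_eq_zero_of_hasDerivAt_of_integrable (fun s => ?_) j3' j0'
  by_cases hs : s ∈ I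
  · rw [indicator_of_mem hs]
    refine (((hd ξ s hs).mul (hΦ.hasDerivAt ξ s).ofReal_comp)).congr_of_eventuallyEq ?_
    filter_upwards [hI.mem_nhds hs] with τ hτ
    rw [indicator_of_mem hτ]
    rfl
  · rw [indicator_of_notMem hs]
    refine (hasDerivAt_const s (0 : ℂ)).congr_of_eventuallyEq ?_
    have hn : (ξ, s) ∉ tsupport Φ := fun hmem => hs (hΦ.support hmem).2
    have hcont : ContinuousAt (fun τ : ℝ => (ξ, τ)) s := by fun_prop
    filter_upwards [hcont.eventually ((isClosed_tsupport Φ).isOpen_compl.mem_nhds hn)] with τ hτ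
    by_cases hτI : τ ∈ I
    · rw [indicator_of_mem hτI]
      rw [image_eq_zero_of_notMem_tsupport hτ, Complex.ofReal_zero, mul_zero]
    · rw [indicator_of_notMem hτI]

theorem ae_eq_of_forall_test (hI : IsOpen I) {F F' : Plane × ℝ → ℂ} (hF : MemLp F 2 (slab I))
    (hF' : MemLp F' 2 (slab I))
    (h : ∀ Φ, IsTest I Φ → ∫ p, F p * (Φ p : ℂ) ∂(slab I) = ∫ p, F' p * (Φ p : ℂ) ∂(slab I)) :
    F =ᵐ[slab I] F' := by
  have hIm := hI.measurableSet
  have hU : IsOpen ((univ : Set Plane) ×ˢ I) := isOpen_univ.prod hI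
  have hloc : LocallyIntegrable (F - F') (volume.restrict ((univ : Set Plane) ×ˢ I)) :=
    MemLp.locallyIntegrable (μ := volume.restrict ((univ : Set Plane) ×ˢ I)) (hF.sub hF')
      (by norm_num)
  have key := hU.ae_eq_zero_of_integral_contDiff_smul_eq_zero
    (locallyIntegrableOn_of_locallyIntegrable_restrict hloc) fun g hg hgc hgs => by
      have hT : IsTest I g := ⟨hg, hgc, hgs⟩
      have hL : MemLp (fun p => (g p : ℂ)) 2 (slab I) :=
        ((Complex.continuous_ofReal.comp hg.continuous).memLp_of_hasCompactSupport
          (hgc.comp_left Complex.ofReal_zero)).restrict _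
      rw [← setIntegral_eq_integral_of_forall_compl_eq_zero (s := (univ : Set Plane) ×ˢ I)]
      · have i1 := hF.integrable_mul hL
        have i2 := hF'.integrable_mul hL
        have : ∫ p, (F p * (g p : ℂ) - F' p * (g p : ℂ)) ∂(slab I) = 0 := by
          rw [← sub_eq_zero.2 (h g hT)]
          exact integral_sub i1 i2
        rw [← this]
        refine integral_congr_ae (ae_of_all _ fun p => ?_)
        simp only [Pi.sub_apply, Complex.real_smul]
        ring
      · intro p hp
        rw [image_eq_zero_of_notMem_tsupport fun hmem => hp (hgs hmem), zero_smul]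
  have := (ae_restrict_iff' (μ := volume) (MeasurableSet.univ.prod hIm)).2 key
  filter_upwards [this] with p hp using sub_eq_zero.1 hp

namespace IsHkTransform

variable {k : ℕ} {u : Plane × ℝ → ℝ} {U V : ℕ → Plane × ℝ → ℂ}

/-- The transforms are unique almost everywhere. -/
theorem ae_eq (hI : IsOpen I) (hU : IsHkTransform k I u U) (hV : IsHkTransform k I u V) :
    ∀ j ≤ k, U j =ᵐ[slab I] V j := by
  intro j
  induction j with
  | zero =>
    intro _
    exact ae_eq_of_forall_test hI hU.fourier.memLp_U hV.fourier.memLp_U fun Φ hΦ => by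
      rw [hU.fourier.duality Φ hΦ, hV.fourier.duality Φ hΦ]
  | succ j ih =>
    intro hj
    refine ae_eq_of_forall_test hI (hU.memLp _ hj) (hV.memLp _ hj) fun Φ hΦ => ?_
    rw [hU.weak j hj Φ hΦ, hV.weak j hj Φ hΦ]
    congr 1
    refine integral_congr_ae ?_
    filter_upwards [ih (by omega)] with p hp
    rw [hp]

/-- Uniqueness of transforms makes the infimum range over a single value, so any transform at hand
computes the norm. -/
theorem hkSqOn_eq (hI : IsOpen I) (hU : IsHkTransform k I u U) :
    hkSqOn k I u = ∑ j ∈ Finset.range (k + 1),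
      ∫⁻ p, ENNReal.ofReal ((1 + ‖p.1‖ ^ 2) ^ (k - j)) * ‖U j p‖ₑ ^ 2 ∂(slab I) := by
  refine le_antisymm (iInf₂_le U hU) (le_iInf₂ fun V hV => ?_)
  refine (Finset.sum_congr rfl fun j hj => lintegral_congr_ae ?_).le
  filter_upwards [hU.ae_eq hI hV j (by simpa [Nat.lt_succ_iff] using hj)] with p hp
  rw [hp]

end IsHkTransform

end

end RayleighTaylor

end

noncomputable section

namespace RayleighTaylor

variable {S : Params}

/-! ### Sobolev norms of syntheses of normal modes -/

/-- The evolution of a coefficient up to time `t`. -/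
def evolve (S : Params) (c : Plane → ℂ) (t : ℝ) (ξ : Plane) : ℂ :=
  (Real.exp (growthRate S ‖ξ‖ * t) : ℂ) * c ξ

theorem IsCoef.evolve {R₂ R₃ : ℝ} {c : Plane → ℂ} (h : IsCoef R₂ R₃ c) (t : ℝ) :
    IsCoef R₂ R₃ (evolve S c t) := by
  refine h.mul ?_ ⟨Real.exp (√(S.g * R₃) * |t|), fun ξ _ hξ => ?_⟩
  · exact Complex.measurable_ofReal.comp (Real.measurable_exp.comp
      (((measurable_growthRate S).comp measurable_norm).mul_const t))
  · have := norm_wave_le (S := S) hξ (x := 0) (le_refl |t|)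
    rw [norm_wave] at this
    rwa [Complex.norm_real, Real.norm_eq_abs, Real.abs_exp]

theorem evolve_zero (c : Plane → ℂ) : evolve S c 0 = c := by
  ext ξ
  simp [evolve]

theorem enorm_evolve_sq (c : Plane → ℂ) (t : ℝ) (a b ψ p : ℝ → ℝ → ℝ) (ξ : Plane) (s : ℝ) :
    ‖amp (evolve S c t) a b ψ p ξ s‖ₑ ^ 2
      = ENNReal.ofReal (Real.exp (t * growthRate S ‖ξ‖)) ^ 2 * ‖amp c a b ψ p ξ s‖ₑ ^ 2 := by
  rw [← mul_pow, amp, evolve, mul_assoc, enorm_mul, amp]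
  congr 2
  rw [← ofReal_norm, Complex.norm_real, Real.norm_eq_abs, Real.abs_exp, mul_comm t]

namespace ModeData

variable {φ ψ p : ℝ → ℝ → ℝ} {κ r₀ R₂ R₃ : ℝ} {c : Plane → ℂ}

theorem lintegral_sq_le (h : ModeData S φ ψ p) (L : Layer S) {C : ℝ} {r : ℝ} (hr : 0 < r)
    (hC : ∫ s, (ψ r s * ψ r s + p r s * p r s) ∂(vert S) ≤ C * r) :
    ∫⁻ s in Ioo L.a L.b, ENNReal.ofReal (ψ r s * ψ r s + p r s * p r s) ≤ ENNReal.ofReal (C * r) := by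
  have hs := h.sol r hr
  have hint : Integrable (fun s => ψ r s * ψ r s + p r s * p r s) (vert S) :=
    (hs.isL2_ψ.integrable_mul hs.isL2_ψ).add (hs.isL2_p.integrable_mul hs.isL2_p)
  calc _ ≤ ∫⁻ s, ENNReal.ofReal (ψ r s * ψ r s + p r s * p r s) ∂(vert S) :=
        lintegral_mono_set fun s hs => (L.mem s hs).1
    _ = ENNReal.ofReal (∫ s, (ψ r s * ψ r s + p r s * p r s) ∂(vert S)) :=
        (ofReal_integral_eq_lintegral_ofReal hint (ae_of_all _ fun s =>
          add_nonneg (mul_self_nonneg _) (mul_self_nonneg _))).symm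
    _ ≤ _ := ENNReal.ofReal_le_ofReal hC

/-- The weighted square integral of an amplitude of order `j`. -/
theorem exists_lintegral_amp_le (hG : GrowthBound S κ r₀) (L : Layer S) {j k : ℕ} (hjk : j ≤ k)
    {a b : ℝ → ℝ → ℝ} (ha : Symbol L.J r₀ j a) (hb : Symbol L.J r₀ j b) :
    ∃ K, 0 < K ∧ ∀ φ ψ p, ModeData S φ ψ p → ∀ R₂ R₃, r₀ ≤ R₂ → ∀ c, IsCoef R₂ R₃ c →
      ∀ f : Plane → ℝ, (∀ ξ, ‖c ξ‖ ^ 2 ≤ (1 + S.g * ‖ξ‖) * |f ξ| ^ 2) →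
      ∫⁻ p', ENNReal.ofReal ((1 + ‖p'.1‖ ^ 2) ^ (k - j)) * ‖amp c a b ψ p p'.1 p'.2‖ₑ ^ 2
          ∂(slab (Ioo L.a L.b))
        ≤ ENNReal.ofReal K * ∫⁻ ξ, ENNReal.ofReal ((1 + ‖ξ‖ ^ 2) ^ (k + 1) * |f ξ| ^ 2) := by
  obtain ⟨C, hC0, hC⟩ := exists_integral_bound S
  obtain ⟨A, hA⟩ := ha.exists_bound isCompact_Icc L.subset
  obtain ⟨B, hB⟩ := hb.exists_bound isCompact_Icc L.subset
  have hg := S.g_pos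
  set M := |A| + |B| + 1 with hM
  have hM0 : 0 < M := by positivity
  -- The factor `2M²` comes from squaring `aψ + bp`, `C` from the square integral of the mode, and
  -- `1 + g` from absorbing `r (1 + g r)` into `1 + r²`.
  refine ⟨2 * M ^ 2 * C * (1 + S.g), by positivity, fun φ ψ p h R₂ R₃ hr c hc f hf => ?_⟩
  have hamp := h.isAmp hG hr L ha hb hc
  have hm := (hamp.aestronglyMeasurable measurableSet_Ioo).enorm.pow_const 2
  have hw : Measurable fun p' : Plane × ℝ => ENNReal.ofReal ((1 + ‖p'.1‖ ^ 2) ^ (k - j)) := by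
    fun_prop
  have hm' := hw.aemeasurable.mul hm
  simp only [Pi.mul_def] at hm'
  rw [slab_eq] at hm' ⊢
  rw [lintegral_prod _ hm', ← lintegral_const_mul' _ _ ENNReal.ofReal_ne_top]
  refine lintegral_mono fun ξ => ?_
  by_cases hξ : c ξ = 0
  · simp [amp, hξ]
  · have h1 : r₀ ≤ ‖ξ‖ := hr.trans (hc.supp ξ hξ).1
    have h2 : 1 ≤ ‖ξ‖ := hG.one_le.trans h1
    have h0 : 0 < ‖ξ‖ := by linarith
    set r := ‖ξ‖ with hrdef
    have hpt : ∀ s ∈ Ioo L.a L.b,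
        ENNReal.ofReal ((1 + r ^ 2) ^ (k - j)) * ‖amp c a b ψ p ξ s‖ₑ ^ 2
        ≤ ENNReal.ofReal ((1 + r ^ 2) ^ (k - j) * ((1 + S.g * r) * |f ξ| ^ 2)
            * (2 * M ^ 2 * r ^ (2 * j))) * ENNReal.ofReal (ψ r s * ψ r s + p r s * p r s) := by
      intro s hs
      have hs' := Ioo_subset_Icc_self hs
      have a1 : |a r s| ≤ M * r ^ j := (hA r h1 s hs').trans (by
        gcongr
        rw [hM]
        linarith [le_abs_self A, abs_nonneg B])
      have a2 : |b r s| ≤ M * r ^ j := (hB r h1 s hs').trans (by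
        gcongr
        rw [hM]
        linarith [le_abs_self B, abs_nonneg A])
      have a3 : (a r s * ψ r s + b r s * p r s) ^ 2
          ≤ 2 * M ^ 2 * r ^ (2 * j) * (ψ r s * ψ r s + p r s * p r s) := by
        have q1 : a r s ^ 2 ≤ (M * r ^ j) ^ 2 := by
          rw [← sq_abs]
          gcongr
        have q2 : b r s ^ 2 ≤ (M * r ^ j) ^ 2 := by
          rw [← sq_abs (b r s)]
          gcongr
        have e : (M * r ^ j) ^ 2 = M ^ 2 * r ^ (2 * j) := by
          rw [mul_pow, ← pow_mul, mul_comm j]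
        rw [e] at q1 q2
        have q3 := mul_le_mul_of_nonneg_right q1 (sq_nonneg (ψ r s))
        have q4 := mul_le_mul_of_nonneg_right q2 (sq_nonneg (p r s))
        nlinarith [sq_nonneg (a r s * ψ r s - b r s * p r s)]
      have a4 : ‖amp c a b ψ p ξ s‖ₑ ^ 2
          = ENNReal.ofReal (‖c ξ‖ ^ 2 * (a r s * ψ r s + b r s * p r s) ^ 2) := by
        rw [← ofReal_norm, ← ENNReal.ofReal_pow (norm_nonneg _), amp, norm_mul, mul_pow,
          Complex.norm_real, Real.norm_eq_abs, sq_abs]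
      have hnn : 0 ≤ ψ r s * ψ r s + p r s * p r s :=
        add_nonneg (mul_self_nonneg _) (mul_self_nonneg _)
      rw [a4, ← ENNReal.ofReal_mul (by positivity), ← ENNReal.ofReal_mul (by positivity)]
      refine ENNReal.ofReal_le_ofReal ?_
      calc _ ≤ (1 + r ^ 2) ^ (k - j) * (((1 + S.g * r) * |f ξ| ^ 2) *
            (2 * M ^ 2 * r ^ (2 * j) * (ψ r s * ψ r s + p r s * p r s))) := by
            have := hf ξ
            gcongr
        _ = _ := by ring
    refine (setLIntegral_mono' measurableSet_Ioo hpt).trans ?_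
    rw [lintegral_const_mul' _ _ ENNReal.ofReal_ne_top]
    refine (mul_le_mul_right (h.lintegral_sq_le L h0 (hC φ ψ p h r h2)) _).trans ?_
    rw [← ENNReal.ofReal_mul (by positivity), ← ENNReal.ofReal_mul (by positivity)]
    refine ENNReal.ofReal_le_ofReal ?_
    have e1 : (1 + r ^ 2) ^ (k + 1) = (1 + r ^ 2) ^ (k - j) * ((1 + r ^ 2) ^ j * (1 + r ^ 2)) := by
      rw [← pow_succ, ← pow_add]
      congr 1
      omega
    -- One power of `r` is lost in the square integral of `(ψ, p)` and another in `1 + g r`, which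
    -- makes room for `λ²` in the velocity. Together they account for the exponent `k + 1`.
    have e2 : r ^ (2 * j) * ((1 + S.g * r) * r) ≤ (1 + r ^ 2) ^ j * ((1 + S.g) * (1 + r ^ 2)) := by
      rw [pow_mul]
      refine mul_le_mul ?_ ?_ (by positivity) (by positivity)
      · gcongr
        linarith
      · nlinarith
    calc _ = (1 + r ^ 2) ^ (k - j) * |f ξ| ^ 2 * (2 * M ^ 2 * C) *
          (r ^ (2 * j) * ((1 + S.g * r) * r)) := by ring
      _ ≤ (1 + r ^ 2) ^ (k - j) * |f ξ| ^ 2 * (2 * M ^ 2 * C) *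
          ((1 + r ^ 2) ^ j * ((1 + S.g) * (1 + r ^ 2))) := by gcongr
      _ = _ := by
        rw [e1]
        ring

end ModeData

/-- `u` is at each time the synthesis of the amplitude `c (a ψ + b p)` in the layer `L`. -/
def IsEvolution (L : Layer S) (c : Plane → ℂ) (a b ψ p : ℝ → ℝ → ℝ) (u : ℝ → Plane × ℝ → ℝ) : Prop :=
  ∀ t, ∀ x : Plane, ∀ s ∈ Ioo L.a L.b, (u t (x, s) : ℂ) = ((1 / (4 * π ^ 2) : ℝ) : ℂ) *
    planeSynth (fun ξ => amp (evolve S c t) a b ψ p ξ s) x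

/-- Sobolev bounds in one layer for one scalar component. -/
theorem exists_hkSqOn_bound {κ r₀ : ℝ} (hG : GrowthBound S κ r₀) (L : Layer S) {a b : ℝ → ℝ → ℝ}
    (ha : Symbol L.J r₀ 0 a) (hb : Symbol L.J r₀ 0 b) (k : ℕ) :
    ∃ K, 0 < K ∧ ∀ φ ψ p, ModeData S φ ψ p → ∀ R₂ R₃, r₀ ≤ R₂ → ∀ c, IsCoef R₂ R₃ c →
      ∀ u, IsEvolution L c a b ψ p u →
      (∀ f : Plane → ℝ, (∀ ξ, ‖c ξ‖ ^ 2 ≤ (1 + S.g * ‖ξ‖) * |f ξ| ^ 2) →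
        hkSqOn k (Ioo L.a L.b) (u 0)
          ≤ ENNReal.ofReal K * ∫⁻ ξ, ENNReal.ofReal ((1 + ‖ξ‖ ^ 2) ^ (k + 1) * |f ξ| ^ 2)) ∧
      ∀ t, hkSqOn k (Ioo L.a L.b) (u t) < ⊤ ∧
        ∀ α β, 0 < t → (∀ r, R₂ ≤ r → r ≤ R₃ → α ≤ growthRate S r ∧ growthRate S r ≤ β) →
          ENNReal.ofReal (Real.exp (t * α)) ^ 2 * hkSqOn k (Ioo L.a L.b) (u 0)
            ≤ hkSqOn k (Ioo L.a L.b) (u t) ∧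
          hkSqOn k (Ioo L.a L.b) (u t)
            ≤ ENNReal.ofReal (Real.exp (t * β)) ^ 2 * hkSqOn k (Ioo L.a L.b) (u 0) := by
  obtain ⟨A, B, hA0, hB0, hAB, hd⟩ := exists_symbol_chain hG L ha hb
  -- A constant is chosen for every `j` so that they can be summed; beyond `k` its value is
  -- irrelevant.
  have hK : ∀ j, ∃ K, 0 < K ∧ (j ≤ k → ∀ φ ψ p, ModeData S φ ψ p → ∀ R₂ R₃, r₀ ≤ R₂ → ∀ c,
      IsCoef R₂ R₃ c →
      ∀ f : Plane → ℝ, (∀ ξ, ‖c ξ‖ ^ 2 ≤ (1 + S.g * ‖ξ‖) * |f ξ| ^ 2) →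
      ∫⁻ p', ENNReal.ofReal ((1 + ‖p'.1‖ ^ 2) ^ (k - j)) *
          ‖amp c (A j) (B j) ψ p p'.1 p'.2‖ₑ ^ 2 ∂(slab (Ioo L.a L.b))
        ≤ ENNReal.ofReal K * ∫⁻ ξ, ENNReal.ofReal ((1 + ‖ξ‖ ^ 2) ^ (k + 1) * |f ξ| ^ 2)) := by
    intro j
    by_cases hj : j ≤ k
    · obtain ⟨K, hK0, hK⟩ := ModeData.exists_lintegral_amp_le hG L hj (hAB j).1 (hAB j).2
      exact ⟨K, hK0, fun _ => hK⟩
    · exact ⟨1, one_pos, fun h => absurd h hj⟩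
  choose K hKpos hK using hK
  refine ⟨∑ j ∈ Finset.range (k + 1), K j,
    Finset.sum_pos (fun j _ => hKpos j) ⟨0, by simp⟩, fun φ ψ p h R₂ R₃ hr c hc u hu => ?_⟩
  have hv : volume (Ioo L.a L.b) ≠ ⊤ := by simp
  have hT : ∀ t, IsHkTransform k (Ioo L.a L.b) (u t)
      fun j p' => amp (evolve S c t) (A j) (B j) ψ p p'.1 p'.2 := fun t => by
    have hamp := fun j => h.isAmp hG hr L (hAB j).1 (hAB j).2 (hc.evolve (S := S) t)
    refine ⟨(hamp 0).isHorizontalFourier S isOpen_Ioo hv fun x s hs => ?_,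
      fun j _ => (hamp j).memLp measurableSet_Ioo hv 2, fun j _ =>
      (hamp j).isWeakVertDeriv (hamp (j + 1)) isOpen_Ioo hv
        (h.hasDerivAt_amp hG hr L (hc.evolve t) (hd j))⟩
    rw [hA0, hB0]
    exact hu t x s hs
  have hE := fun t => (hT t).hkSqOn_eq isOpen_Ioo
  refine ⟨fun f hf => ?_, fun t => ⟨?_, fun α β ht hαβ => ?_⟩⟩
  · rw [hE, ENNReal.ofReal_sum_of_nonneg fun j _ => (hKpos j).le, Finset.sum_mul]
    refine Finset.sum_le_sum fun j hj => ?_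
    rw [evolve_zero]
    exact hK j (by simpa [Nat.lt_succ_iff] using hj) φ ψ p h R₂ R₃ hr c hc f hf
  · rw [hE]
    refine ENNReal.sum_lt_top.2 fun j hj => ?_
    have hfin : ∫⁻ p', ‖amp (evolve S c t) (A j) (B j) ψ p p'.1 p'.2‖ₑ ^ 2
        ∂(slab (Ioo L.a L.b)) < ⊤ := by
      have := (eLpNorm_lt_top_iff_lintegral_rpow_enorm_lt_top two_ne_zero
        ENNReal.ofNat_ne_top).1 ((hT t).memLp j (by simpa [Nat.lt_succ_iff] using hj)).2
      simpa using this
    refine lt_of_le_of_lt (lintegral_mono (g := fun p' : Plane × ℝ =>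
      ENNReal.ofReal ((1 + R₃ ^ 2) ^ (k - j)) *
        ‖amp (evolve S c t) (A j) (B j) ψ p p'.1 p'.2‖ₑ ^ 2) fun p' => ?_) ?_
    · by_cases hξ : c p'.1 = 0
      · simp [amp, evolve, hξ]
      · have := (hc.supp _ hξ).2
        simp only
        gcongr
    · rw [lintegral_const_mul' _ _ ENNReal.ofReal_ne_top]
      exact ENNReal.mul_lt_top ENNReal.ofReal_lt_top hfin
  -- Evolution multiplies each derivative of the transform by `e^{tλ(|ξ|)}`, so both estimates
  -- already hold for the integrands, on the support of `c`.
  · rw [hE, hE, Finset.mul_sum, Finset.mul_sum]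
    have hne : ∀ γ : ℝ, ENNReal.ofReal (Real.exp (t * γ)) ^ 2 ≠ ⊤ := fun γ =>
      ENNReal.pow_ne_top ENNReal.ofReal_ne_top
    constructor
    · refine Finset.sum_le_sum fun j _ => ?_
      rw [← lintegral_const_mul' _ _ (hne α)]
      refine lintegral_mono fun p' => ?_
      simp only [evolve_zero]
      by_cases hξ : c p'.1 = 0
      · simp [amp, hξ]
      · have := (hαβ _ (hc.supp _ hξ).1 (hc.supp _ hξ).2).1
        rw [enorm_evolve_sq, mul_left_comm]
        gcongr
    · refine Finset.sum_le_sum fun j _ => ?_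
      rw [← lintegral_const_mul' _ _ (hne β)]
      refine lintegral_mono fun p' => ?_
      simp only [evolve_zero]
      by_cases hξ : c p'.1 = 0
      · simp [amp, evolve, hξ]
      · have := (hαβ _ (hc.supp _ hξ).1 (hc.supp _ hξ).2).2
        rw [enorm_evolve_sq, mul_left_comm]
        gcongr

end RayleighTaylor

end

noncomputable section

namespace RayleighTaylor

variable {S : Params}

/-! ### Real fields synthesized from amplitudes -/

theorem IsAmp.congr {R : ℝ} {I : Set ℝ} {a b : Plane → ℝ → ℂ} (h : IsAmp R I a)
    (hab : ∀ ξ, ∀ s ∈ I, a ξ s = b ξ s) (hb : ∀ ξ, R < ‖ξ‖ → ∀ s, b ξ s = 0) : IsAmp R I b where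
  meas s hs := by simpa only [hab _ s hs] using h.meas s hs
  cont ξ := (h.cont ξ).congr fun s hs => (hab ξ s hs).symm
  bdd := by
    obtain ⟨C, hC⟩ := h.bdd
    exact ⟨C, fun ξ s hs => by
      rw [← hab ξ s hs]
      exact hC ξ s hs⟩
  supp := hb

/-- The synthesis of an amplitude, with the factor `1 / (4 π²)`. -/
def cfield (S : Params) (a : Plane → ℝ → ℂ) (x : Space) (t : ℝ) : ℂ :=
  ((1 / (4 * π ^ 2) : ℝ) : ℂ) * synth S a x t

/-- The real part of the synthesis of an amplitude. -/
def field (S : Params) (a : Plane → ℝ → ℂ) (x : Space) (t : ℝ) : ℝ := (cfield S a x t).re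

theorem wave_neg (ξ : Plane) (x : Space) (t : ℝ) :
    wave S (-ξ) x t = (starRingEnd ℂ) (wave S ξ x t) := by
  rw [wave, wave, map_mul, Complex.conj_ofReal, ← Complex.exp_conj, map_mul, Complex.conj_I,
    Complex.conj_ofReal, norm_neg]
  congr 2
  simp only [PiLp.neg_apply]
  push_cast
  ring

/-- The synthesis of a Hermitian amplitude is real. -/
theorem ofReal_field {a : Plane → ℝ → ℂ} {x : Space}
    (h : ∀ ξ, a (-ξ) (x 2) = (starRingEnd ℂ) (a ξ (x 2))) (t : ℝ) :
    (field S a x t : ℂ) = cfield S a x t := by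
  have e : (starRingEnd ℂ) (synth S a x t) = synth S a x t := by
    rw [synth, ← integral_conj, ← integral_neg_eq_self]
    refine integral_congr_ae (ae_of_all _ fun ξ => ?_)
    simp only [h, wave_neg, map_mul, Complex.conj_conj]
  refine Complex.conj_eq_iff_re.1 ?_
  rw [cfield, map_mul, e, Complex.conj_ofReal]

theorem field_congr {a b : Plane → ℝ → ℂ} {x : Space} (h : ∀ ξ, a ξ (x 2) = b ξ (x 2)) (t : ℝ) :
    field S a x t = field S b x t := by
  rw [field, field, cfield, cfield, synth, synth]
  simp only [h]

theorem mul_field (k : ℝ) (a : Plane → ℝ → ℂ) (x : Space) (t : ℝ) :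
    k * field S a x t = field S (fun ξ s => k * a ξ s) x t := by
  rw [field, field, cfield, cfield, synth, synth, ← Complex.re_ofReal_mul]
  simp only [mul_assoc, integral_const_mul]
  ring_nf

theorem field_add {R R' : ℝ} {I : Set ℝ} {a b : Plane → ℝ → ℂ} (ha : IsAmp R I a)
    (hb : IsAmp R' I b) {x : Space} (hx : x 2 ∈ I) (t : ℝ) :
    field S a x t + field S b x t = field S (fun ξ s => a ξ s + b ξ s) x t := by
  rw [field, field, field, cfield, cfield, cfield, ← Complex.add_re, ← mul_add, synth, synth,
    ← integral_add (ha.integrable hx t) (hb.integrable hx t), synth]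
  simp only [add_mul]

theorem field_zero (x : Space) (t : ℝ) : field S (fun _ _ => 0) x t = 0 := by
  simp [field, cfield, synth]

/-- The total derivative of a field. -/
def fieldD (S : Params) (a a' : Plane → ℝ → ℂ) (q : Space × ℝ) : Space × ℝ →L[ℝ] ℝ :=
  Complex.reCLM ∘L (((1 / (4 * π ^ 2) : ℝ) : ℂ) • synthD S a a' q)

namespace IsAmp

variable {R : ℝ} {I : Set ℝ} {a a' : Plane → ℝ → ℂ}

theorem hasFDerivAt_field (hI : IsOpen I) (h : IsAmp R I a) (h' : IsAmp R I a')
    (hd : ∀ ξ, ∀ s ∈ I, HasDerivAt (a ξ) (a' ξ s) s) {q : Space × ℝ} (hq : q.1 2 ∈ I) :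
    HasFDerivAt (fun q : Space × ℝ => field S a q.1 q.2) (fieldD S a a' q) q :=
  Complex.reCLM.hasFDerivAt.comp q
    ((hasFDerivAt_synth hI h h' hd hq).const_mul ((1 / (4 * π ^ 2) : ℝ) : ℂ))

theorem contDiffOn_field (hI : IsOpen I) (h : IsAmp R I a) (h' : IsAmp R I a')
    (hd : ∀ ξ, ∀ s ∈ I, HasDerivAt (a ξ) (a' ξ s) s) :
    ContDiffOn ℝ 1 (fun q : Space × ℝ => field S a q.1 q.2) {q | q.1 2 ∈ I} :=
  Complex.reCLM.contDiff.comp_contDiffOn (contDiffOn_const.mul (contDiffOn_synth hI h h' hd))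

theorem fieldD_apply (q v : Space × ℝ) :
    fieldD S a a' q v = (((1 / (4 * π ^ 2) : ℝ) : ℂ) *
      (synth S (fun ξ s => weightX 0 ξ * a ξ s) q.1 q.2 * v.1 0
        + synth S (fun ξ s => weightX 1 ξ * a ξ s) q.1 q.2 * v.1 1
        + synth S a' q.1 q.2 * v.1 2
        + synth S (fun ξ s => weightT S ξ * a ξ s) q.1 q.2 * v.2)).re := rfl

theorem hasDerivAt_field (hI : IsOpen I) (h : IsAmp R I a) (h' : IsAmp R I a')
    (hd : ∀ ξ, ∀ s ∈ I, HasDerivAt (a ξ) (a' ξ s) s) {x : Space} (hx : x 2 ∈ I) (t : ℝ) :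
    HasDerivAt (fun τ => field S a x τ) (field S (fun ξ s => weightT S ξ * a ξ s) x t) t := by
  have h1 := (hasFDerivAt_field (S := S) hI h h' hd (q := (x, t)) hx).comp_hasDerivAt t
    ((hasDerivAt_const t x).prodMk (hasDerivAt_id t))
  refine h1.congr_deriv ?_
  rw [fieldD_apply]
  simp [field, cfield]

theorem pd_field (hI : IsOpen I) (h : IsAmp R I a) (h' : IsAmp R I a')
    (hd : ∀ ξ, ∀ s ∈ I, HasDerivAt (a ξ) (a' ξ s) s) {x : Space} (hx : x 2 ∈ I) (t : ℝ)
    (i : Fin 3) :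
    pd i (fun y => field S a y t) x = (![field S (fun ξ s => weightX 0 ξ * a ξ s) x t,
      field S (fun ξ s => weightX 1 ξ * a ξ s) x t, field S a' x t] : Space) i := by
  have h1 : HasFDerivAt (fun y => field S a y t)
      (fieldD S a a' (x, t) ∘L ContinuousLinearMap.inl ℝ Space ℝ) x :=
    HasFDerivAt.comp (g := fun q : Space × ℝ => field S a q.1 q.2) (f := fun e => (e, t)) x
      (hasFDerivAt_field hI h h' hd hx) (hasFDerivAt_prodMk_left x t)
  rw [pd, h1.fderiv]
  change fieldD S a a' (x, t) (Pi.single i 1, 0) = _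
  rw [fieldD_apply]
  fin_cases i <;> simp [field, cfield]

theorem tendsto_field (h : IsAmp R I a) {l : Filter Space} [l.IsCountablyGenerated]
    {x₀ : Space} (hl : l ≤ 𝓝 x₀) (t : ℝ) (hI : ∀ᶠ x in l, x 2 ∈ I) {A : Plane → ℂ}
    (hA : ∀ ξ, Tendsto (fun x : Space => a ξ (x 2)) l (𝓝 (A ξ))) :
    Tendsto (fun x => field S a x t) l
      (𝓝 (((1 / (4 * π ^ 2) : ℝ) : ℂ) * ∫ ξ, A ξ * wave S ξ x₀ t).re) :=
  (Complex.continuous_re.tendsto _).comp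
    ((h.tendsto_synth (X := id) (τ := fun _ => t) hl tendsto_const_nhds hI hA).const_mul _)

end IsAmp

/-! ### Fields of normal modes -/

/-- The amplitude `c(ξ) w(|ξ|, s)`. -/
def modeAmp (c : Plane → ℂ) (w : ℝ → ℝ → ℝ) (ξ : Plane) (s : ℝ) : ℂ := c ξ * (w ‖ξ‖ s : ℂ)

/-- In the layer `L`, `w` is the combination `a ψ + b p`. -/
def IsCombination (L : Layer S) (ψ p a b w : ℝ → ℝ → ℝ) : Prop :=
  ∀ r, 0 < r → ∀ s ∈ Ioo L.a L.b, w r s = a r s * ψ r s + b r s * p r s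

namespace ModeData

variable {φ ψ p w a b : ℝ → ℝ → ℝ} {κ r₀ R₂ R₃ : ℝ} {c : Plane → ℂ} {L : Layer S} {i j : ℕ}

theorem modeAmp_eq (hG : GrowthBound S κ r₀) (hr : r₀ ≤ R₂) (hc : IsCoef R₂ R₃ c)
    (hw : IsCombination L ψ p a b w) (ξ : Plane) {s : ℝ} (hs : s ∈ Ioo L.a L.b) :
    modeAmp c w ξ s = amp c a b ψ p ξ s := by
  by_cases hξ : c ξ = 0
  · simp [modeAmp, amp, hξ]
  · have : 0 < ‖ξ‖ := by linarith [(hc.supp ξ hξ).1, hG.one_le]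
    rw [modeAmp, amp, hw _ this s hs]

theorem isAmp_modeAmp (h : ModeData S φ ψ p) (hG : GrowthBound S κ r₀) (hr : r₀ ≤ R₂)
    (hc : IsCoef R₂ R₃ c) (ha : Symbol L.J r₀ i a) (hb : Symbol L.J r₀ j b)
    (hw : IsCombination L ψ p a b w) : IsAmp R₃ (Ioo L.a L.b) (modeAmp c w) := by
  refine (h.isAmp hG hr L ha hb hc).congr (fun ξ s hs => (modeAmp_eq hG hr hc hw ξ hs).symm)
    fun ξ hξ s => ?_
  have : c ξ = 0 := by
    by_contra hne
    exact absurd (hc.supp ξ hne).2 (not_le.2 hξ)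
  rw [modeAmp, this, zero_mul]

theorem exists_deriv_modeAmp (h : ModeData S φ ψ p) (hG : GrowthBound S κ r₀) (hr : r₀ ≤ R₂)
    (hc : IsCoef R₂ R₃ c) (ha : Symbol L.J r₀ 0 a) (hb : Symbol L.J r₀ 0 b)
    (hw : IsCombination L ψ p a b w) : ∃ A', IsAmp R₃ (Ioo L.a L.b) A' ∧
      ∀ ξ, ∀ s ∈ Ioo L.a L.b, HasDerivAt (modeAmp c w ξ) (A' ξ s) s := by
  obtain ⟨A, B, hA0, hB0, hAB, hd⟩ := exists_symbol_chain hG L ha hb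
  refine ⟨_, h.isAmp hG hr L (hAB 1).1 (hAB 1).2 hc, fun ξ s hs => ?_⟩
  have h1 := h.hasDerivAt_amp hG hr L hc (hd 0) ξ s hs
  rw [hA0, hB0] at h1
  refine h1.congr_of_eventuallyEq ?_
  filter_upwards [Ioo_mem_nhds hs.1 hs.2] with τ hτ
  exact modeAmp_eq hG hr hc hw ξ hτ

end ModeData

end RayleighTaylor

end

noncomputable section

namespace RayleighTaylor

variable {S : Params}

theorem IsAmp.const_mul {R : ℝ} {I : Set ℝ} {a : Plane → ℝ → ℂ} (h : IsAmp R I a) (k : ℂ) :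
    IsAmp R I fun ξ s => k * a ξ s :=
  h.mul_weight measurable_const ⟨‖k‖, fun _ _ => le_rfl⟩

theorem IsAmp.add {R : ℝ} {I : Set ℝ} {a b : Plane → ℝ → ℂ} (ha : IsAmp R I a)
    (hb : IsAmp R I b) : IsAmp R I fun ξ s => a ξ s + b ξ s where
  meas s hs := (ha.meas s hs).add (hb.meas s hs)
  cont ξ := (ha.cont ξ).add (hb.cont ξ)
  bdd := by
    obtain ⟨A, hA⟩ := ha.bdd
    obtain ⟨B, hB⟩ := hb.bdd
    exact ⟨A + B, fun ξ s hs => (norm_add_le _ _).trans (add_le_add (hA ξ s hs) (hB ξ s hs))⟩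
  supp ξ hξ s := by rw [ha.supp ξ hξ, hb.supp ξ hξ, add_zero]

/-! ### The synthesized solution -/

/-- Bounded radial profiles supported in an annulus. -/
structure IsProfile (R₂ R₃ : ℝ) (f : Plane → ℝ) : Prop where
  meas : Measurable f
  bdd : ∃ C, ∀ ξ, |f ξ| ≤ C
  radial : ∀ ξ ζ : Plane, ‖ξ‖ = ‖ζ‖ → f ξ = f ζ
  supp : ∀ ξ, f ξ ≠ 0 → R₂ ≤ ‖ξ‖ ∧ ‖ξ‖ ≤ R₃

/-- A superposition of normal modes of frequencies between `R₂` and `R₃`. -/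
structure IsPacket (S : Params) (φ ψ p : ℝ → ℝ → ℝ) (κ r₀ R₂ R₃ : ℝ) (f : Plane → ℝ) : Prop where
  data : ModeData S φ ψ p
  growth : GrowthBound S κ r₀
  le : r₀ ≤ R₂
  profile : IsProfile R₂ R₃ f

/-- The horizontal direction factor `-i ξ_j / |ξ|`. -/
def direction (j : Fin 2) (ξ : Plane) : ℂ := -Complex.I * ((ξ j / ‖ξ‖ : ℝ) : ℂ)

/-- The coefficients of the three components of the displacement. -/
def etaCoef (f : Plane → ℝ) : Fin 3 → Plane → ℂ :=
  ![fun ξ => direction 0 ξ * (f ξ : ℂ), fun ξ => direction 1 ξ * (f ξ : ℂ), fun ξ => (f ξ : ℂ)]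

/-- The coefficients of the three components of the velocity. -/
def vCoef (S : Params) (f : Plane → ℝ) (i : Fin 3) (ξ : Plane) : ℂ := weightT S ξ * etaCoef f i ξ

/-- The coefficient of the density. -/
def qCoef (f : Plane → ℝ) (ξ : Plane) : ℂ := -1 * (f ξ : ℂ)

/-- The vertical profiles of the displacement. -/
def prof (φ ψ : ℝ → ℝ → ℝ) : Fin 3 → ℝ → ℝ → ℝ := ![φ, φ, ψ]

/-- The vertical profile of the density. -/
def qProf (S : Params) (p : ℝ → ℝ → ℝ) (r s : ℝ) : ℝ := (dP S s)⁻¹ * p r s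

/-- The coefficient of `ψ` in the displacement profiles. -/
def profA (S : Params) : Fin 3 → ℝ → ℝ → ℝ :=
  ![fun r _ => r / growthRate S r ^ 2 * S.g, fun r _ => r / growthRate S r ^ 2 * S.g, fun _ _ => 1]

/-- The coefficient of `p` in the displacement profiles. -/
def profB (L : Layer S) : Fin 3 → ℝ → ℝ → ℝ :=
  ![fun r s => r / growthRate S r ^ 2 * (-(L.ρ s)⁻¹), fun r s => r / growthRate S r ^ 2 * (-(L.ρ s)⁻¹),
    fun _ _ => 0]

/-- The displacement. -/
def etaField (S : Params) (φ ψ : ℝ → ℝ → ℝ) (f : Plane → ℝ) (x : Space) (t : ℝ) : Space :=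
  fun i => field S (modeAmp (etaCoef f i) (prof φ ψ i)) x t

/-- The velocity. -/
def vField (S : Params) (φ ψ : ℝ → ℝ → ℝ) (f : Plane → ℝ) (x : Space) (t : ℝ) : Space :=
  fun i => field S (modeAmp (vCoef S f i) (prof φ ψ i)) x t

/-- The density. -/
def qField (S : Params) (p : ℝ → ℝ → ℝ) (f : Plane → ℝ) (x : Space) (t : ℝ) : ℝ :=
  field S (modeAmp (qCoef f) (qProf S p)) x t

theorem symbol_profA {κ r₀ : ℝ} (hG : GrowthBound S κ r₀) (J : Set ℝ) (i : Fin 3) :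
    Symbol J r₀ 0 (profA S i) := by
  have h := (symbol_ratio (J := J) hG).mul (by linarith [hG.one_le]) (Symbol.const S.g)
  fin_cases i
  · exact h
  · exact h
  · exact Symbol.const 1

theorem symbol_profB {κ r₀ : ℝ} (hG : GrowthBound S κ r₀) (L : Layer S) (i : Fin 3) :
    Symbol L.J r₀ 0 (profB L i) := by
  have h := (symbol_ratio (J := L.J) hG).mul (by linarith [hG.one_le])
    (Symbol.of_smooth (L.smooth_ρ.inv fun s hs => (L.ρ_pos s hs).ne').neg)
  fin_cases i
  · exact h
  · exact h
  · exact Symbol.const 0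

theorem symbol_D_inv (L : Layer S) (r₀ : ℝ) : Symbol L.J r₀ 0 fun _ s => (L.D s)⁻¹ :=
  .of_smooth (L.smooth_D.inv fun s hs => (L.D_pos s hs).ne')

theorem norm_direction_le (j : Fin 2) (ξ : Plane) : ‖direction j ξ‖ ≤ 1 := by
  rw [direction, norm_mul, norm_neg, Complex.norm_I, one_mul, Complex.norm_real, norm_div, norm_norm]
  exact div_le_one_of_le₀ (PiLp.norm_apply_le ξ j) (norm_nonneg _)

theorem measurable_direction (j : Fin 2) : Measurable (direction j) := by
  unfold direction
  fun_prop

namespace IsProfile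

variable {R₂ R₃ : ℝ} {f : Plane → ℝ}

theorem isCoef (h : IsProfile R₂ R₃ f) : IsCoef R₂ R₃ fun ξ => (f ξ : ℂ) where
  meas := Complex.measurable_ofReal.comp h.meas
  bdd := by
    obtain ⟨C, hC⟩ := h.bdd
    exact ⟨C, fun ξ => by simpa using hC ξ⟩
  supp ξ hξ := h.supp ξ (Complex.ofReal_ne_zero.1 hξ)

theorem isCoef_eta (h : IsProfile R₂ R₃ f) (i : Fin 3) : IsCoef R₂ R₃ (etaCoef f i) := by
  have hd := fun j => h.isCoef.mul (measurable_direction j) ⟨1, fun ξ _ _ => norm_direction_le j ξ⟩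
  fin_cases i
  · exact hd 0
  · exact hd 1
  · exact h.isCoef

theorem isCoef_v (h : IsProfile R₂ R₃ f) (i : Fin 3) : IsCoef R₂ R₃ (vCoef S f i) :=
  (h.isCoef_eta i).weightT_mul

theorem isCoef_q (h : IsProfile R₂ R₃ f) : IsCoef R₂ R₃ (qCoef f) :=
  h.isCoef.mul measurable_const ⟨‖(-1 : ℂ)‖, fun _ _ _ => le_rfl⟩

end IsProfile

namespace ModeData

variable {φ ψ p w w' a b : ℝ → ℝ → ℝ} {κ r₀ R₂ R₃ : ℝ} {c : Plane → ℂ} {L : Layer S}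

theorem isCombination_prof (h : ModeData S φ ψ p) (L : Layer S) (i : Fin 3) :
    IsCombination L ψ p (profA S i) (profB L i) (prof φ ψ i) := by
  intro r hr s hs
  have hφ : φ r s = r / growthRate S r ^ 2 * S.g * ψ r s
      + r / growthRate S r ^ 2 * (-(L.ρ s)⁻¹) * p r s := by
    rw [h.phi r hr s (L.mem s hs).1 (L.mem s hs).2, phiOf, L.rho_eq s hs]
    ring
  fin_cases i
  · exact hφ
  · exact hφ
  · simp [prof, profA, profB]

theorem isCombination_qProf (L : Layer S) :
    IsCombination L ψ p (fun _ _ => 0) (fun _ s => (L.D s)⁻¹) (qProf S p) := by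
  intro r _ s hs
  rw [qProf, L.dP_eq s hs]
  ring

theorem isCombination_p (L : Layer S) : IsCombination L ψ p (fun _ _ => 0) (fun _ _ => 1) p := by
  intro r _ s _
  ring

/-- The symbol calculus provides some amplitude that is the vertical derivative; uniqueness of
derivatives identifies it with `c w'`, which thereby becomes measurable and bounded. -/
theorem isAmp_deriv (h : ModeData S φ ψ p) (hG : GrowthBound S κ r₀) (hr : r₀ ≤ R₂)
    (hc : IsCoef R₂ R₃ c) (ha : Symbol L.J r₀ 0 a) (hb : Symbol L.J r₀ 0 b)
    (hw : IsCombination L ψ p a b w)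
    (hw' : ∀ r, 0 < r → ∀ s ∈ Ioo L.a L.b, HasDerivAt (w r) (w' r s) s) :
    IsAmp R₃ (Ioo L.a L.b) (modeAmp c w') ∧
      ∀ ξ, ∀ s ∈ Ioo L.a L.b, HasDerivAt (modeAmp c w ξ) (modeAmp c w' ξ s) s := by
  obtain ⟨A', hA', hd⟩ := h.exists_deriv_modeAmp hG hr hc ha hb hw
  have hd' : ∀ ξ, ∀ s ∈ Ioo L.a L.b, HasDerivAt (modeAmp c w ξ) (modeAmp c w' ξ s) s := by
    intro ξ s hs
    by_cases hξ : c ξ = 0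
    · have e : modeAmp c w ξ = fun _ => 0 := funext fun s => by simp [modeAmp, hξ]
      rw [e]
      simpa [modeAmp, hξ] using hasDerivAt_const s (0 : ℂ)
    · have : 0 < ‖ξ‖ := by linarith [(hc.supp ξ hξ).1, hG.one_le]
      exact ((hw' _ this s hs).ofReal_comp).const_mul (c ξ)
  refine ⟨hA'.congr (fun ξ s hs => (hd ξ s hs).unique (hd' ξ s hs)) fun ξ hξ s => ?_, hd'⟩
  have : c ξ = 0 := by
    by_contra hne
    exact absurd (hc.supp ξ hne).2 (not_le.2 hξ)
  rw [modeAmp, this, zero_mul]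

end ModeData

namespace IsPacket

variable {φ ψ p : ℝ → ℝ → ℝ} {κ r₀ R₂ R₃ : ℝ} {f : Plane → ℝ}

theorem isAmp_prof (h : IsPacket S φ ψ p κ r₀ R₂ R₃ f) (L : Layer S) {c : Plane → ℂ}
    (hc : IsCoef R₂ R₃ c) (i : Fin 3) : IsAmp R₃ (Ioo L.a L.b) (modeAmp c (prof φ ψ i)) :=
  h.data.isAmp_modeAmp h.growth h.le hc (symbol_profA h.growth L.J i) (symbol_profB h.growth L i)
    (h.data.isCombination_prof L i)

theorem isAmp_qProf (h : IsPacket S φ ψ p κ r₀ R₂ R₃ f) (L : Layer S) {c : Plane → ℂ}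
    (hc : IsCoef R₂ R₃ c) : IsAmp R₃ (Ioo L.a L.b) (modeAmp c (qProf S p)) :=
  h.data.isAmp_modeAmp h.growth h.le hc (Symbol.const 0) (symbol_D_inv L r₀)
    (ModeData.isCombination_qProf L)

theorem isAmp_p (h : IsPacket S φ ψ p κ r₀ R₂ R₃ f) (L : Layer S) {c : Plane → ℂ}
    (hc : IsCoef R₂ R₃ c) : IsAmp R₃ (Ioo L.a L.b) (modeAmp c p) :=
  h.data.isAmp_modeAmp h.growth h.le hc (Symbol.const 0) (Symbol.const 1)
    (ModeData.isCombination_p L)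

theorem deriv_prof (h : IsPacket S φ ψ p κ r₀ R₂ R₃ f) (L : Layer S) {c : Plane → ℂ}
    (hc : IsCoef R₂ R₃ c) (i : Fin 3) : ∃ A', IsAmp R₃ (Ioo L.a L.b) A' ∧
      ∀ ξ, ∀ s ∈ Ioo L.a L.b, HasDerivAt (modeAmp c (prof φ ψ i) ξ) (A' ξ s) s :=
  h.data.exists_deriv_modeAmp h.growth h.le hc (symbol_profA h.growth L.J i)
    (symbol_profB h.growth L i) (h.data.isCombination_prof L i)

theorem deriv_qProf (h : IsPacket S φ ψ p κ r₀ R₂ R₃ f) (L : Layer S) {c : Plane → ℂ}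
    (hc : IsCoef R₂ R₃ c) : ∃ A', IsAmp R₃ (Ioo L.a L.b) A' ∧
      ∀ ξ, ∀ s ∈ Ioo L.a L.b, HasDerivAt (modeAmp c (qProf S p) ξ) (A' ξ s) s :=
  h.data.exists_deriv_modeAmp h.growth h.le hc (Symbol.const 0) (symbol_D_inv L r₀)
    (ModeData.isCombination_qProf L)

theorem deriv_ψ (h : IsPacket S φ ψ p κ r₀ R₂ R₃ f) (L : Layer S) {c : Plane → ℂ}
    (hc : IsCoef R₂ R₃ c) :
    IsAmp R₃ (Ioo L.a L.b)
      (modeAmp c fun r s => slopePsi S r (growthRate S r ^ 2) s (ψ r s) (p r s)) ∧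
      ∀ ξ, ∀ s ∈ Ioo L.a L.b, HasDerivAt (modeAmp c ψ ξ)
        (modeAmp c (fun r s => slopePsi S r (growthRate S r ^ 2) s (ψ r s) (p r s)) ξ s) s :=
  h.data.isAmp_deriv h.growth h.le hc (symbol_profA h.growth L.J 2)
    (symbol_profB h.growth L 2) (h.data.isCombination_prof L 2)
    fun _ hr _ hs => (h.data.hasDerivAt L hr hs).1

theorem deriv_p (h : IsPacket S φ ψ p κ r₀ R₂ R₃ f) (L : Layer S) {c : Plane → ℂ}
    (hc : IsCoef R₂ R₃ c) :
    IsAmp R₃ (Ioo L.a L.b)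
      (modeAmp c fun r s => slopeP S r (growthRate S r ^ 2) s (ψ r s) (p r s)) ∧
      ∀ ξ, ∀ s ∈ Ioo L.a L.b, HasDerivAt (modeAmp c p ξ)
        (modeAmp c (fun r s => slopeP S r (growthRate S r ^ 2) s (ψ r s) (p r s)) ξ s) s :=
  h.data.isAmp_deriv h.growth h.le hc (Symbol.const 0) (Symbol.const 1)
    (ModeData.isCombination_p L) fun _ hr _ hs => (h.data.hasDerivAt L hr hs).2

theorem pos_of_ne (h : IsPacket S φ ψ p κ r₀ R₂ R₃ f) {ξ : Plane} (hξ : f ξ ≠ 0) : 0 < ‖ξ‖ := by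
  linarith [(h.profile.supp ξ hξ).1, h.growth.one_le, h.le]

theorem hasDerivAt_etaField (h : IsPacket S φ ψ p κ r₀ R₂ R₃ f) (L : Layer S) {x : Space}
    (hx : x 2 ∈ Ioo L.a L.b) (t : ℝ) :
    HasDerivAt (fun τ => etaField S φ ψ f x τ) (vField S φ ψ f x t) t := by
  refine hasDerivAt_pi.2 fun i => ?_
  obtain ⟨A', hA', hd⟩ := h.deriv_prof L (h.profile.isCoef_eta i) i
  refine ((h.isAmp_prof L (h.profile.isCoef_eta i) i).hasDerivAt_field isOpen_Ioo hA' hd hx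
    t).congr_deriv ?_
  exact field_congr (fun ξ => by simp only [modeAmp, vCoef]; ring) t

theorem phi_eq (h : IsPacket S φ ψ p κ r₀ R₂ R₃ f) (L : Layer S) {s : ℝ} (hs : s ∈ Ioo L.a L.b)
    {r : ℝ} (hr : 0 < r) : φ r s = phiOf S r (growthRate S r ^ 2) s (ψ r s) (p r s) :=
  h.data.phi r hr s (L.mem s hs).1 (L.mem s hs).2

/-- At the level of amplitudes this is `-λ p/P' + λ ρ₀ (rφ + ψ') = 0`, the definition of the
pressure. -/
theorem mass (h : IsPacket S φ ψ p κ r₀ R₂ R₃ f) (L : Layer S) {x : Space}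
    (hx : x 2 ∈ Ioo L.a L.b) (t : ℝ) :
    deriv (fun τ => qField S p f x τ) t
      + rho S (x 2) * ∑ i, pd i (fun y => vField S φ ψ f y t i) x = 0 := by
  have hq := h.profile.isCoef_q
  have hv := h.profile.isCoef_v (S := S)
  obtain ⟨Q', hQ', hQd⟩ := h.deriv_qProf L hq
  have e1 : deriv (fun τ => qField S p f x τ) t = _ :=
    ((h.isAmp_qProf L hq).hasDerivAt_field isOpen_Ioo hQ' hQd hx t).deriv
  have e2 : ∀ i, ∀ j : Fin 3, pd j (fun y => vField S φ ψ f y t i) x = _ := fun i j =>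
    (h.isAmp_prof L (hv i) i).pd_field isOpen_Ioo (h.deriv_prof L (hv i) i).choose_spec.1
      (h.deriv_prof L (hv i) i).choose_spec.2 hx t j
  have e3 : pd 2 (fun y => vField S φ ψ f y t 2) x = _ :=
    (h.isAmp_prof L (hv 2) 2).pd_field isOpen_Ioo (h.deriv_ψ L (hv 2)).1 (h.deriv_ψ L (hv 2)).2
      hx t 2
  rw [Fin.sum_univ_three, e1, e2 0 0, e2 1 1, e3]
  simp only [Matrix.cons_val]
  have i0 := (h.isAmp_prof L (hv 0) 0).weightX_mul 0
  have i1 := (h.isAmp_prof L (hv 1) 1).weightX_mul 1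
  have i2 := (h.deriv_ψ L (hv 2)).1
  rw [field_add i0 i1 hx, field_add (i0.add i1) i2 hx, mul_field,
    field_add ((h.isAmp_qProf L hq).weightT_mul) (((i0.add i1).add i2).const_mul _) hx,
    ← field_zero (S := S) x t]
  refine field_congr (fun ξ => ?_) t
  by_cases hξ : f ξ = 0
  · simp [modeAmp, qCoef, vCoef, etaCoef, hξ]
  have hr := h.pos_of_ne hξ
  have hρ : (rho S (x 2) : ℂ) * (rho S (x 2) : ℂ)⁻¹ = 1 :=
    mul_inv_cancel₀ (Complex.ofReal_ne_zero.2 (rho_pos (L.mem_Icc hx)).ne')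
  -- The horizontal divergence of the direction field: `iξ · (-iξ/|ξ|) = |ξ|`.
  have hdir : weightX 0 ξ * direction 0 ξ + weightX 1 ξ * direction 1 ξ = (‖ξ‖ : ℂ) := by
    have h1 : (ξ 0 * ξ 0 + ξ 1 * ξ 1) / ‖ξ‖ = ‖ξ‖ := by
      rw [← inner_plane, real_inner_self_eq_norm_mul_norm]
      field_simp
    have h2 := congrArg (fun y : ℝ => (y : ℂ)) h1
    simp only [weightX, direction]
    push_cast at h2 ⊢
    linear_combination h2 + (-(ξ 0 * ξ 0 + ξ 1 * ξ 1) / ‖ξ‖ : ℂ) * Complex.I_mul_I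
  simp only [modeAmp, qCoef, vCoef, etaCoef, prof, qProf, Matrix.cons_val, h.phi_eq L hx hr,
    slopePsi_eq]
  push_cast
  linear_combination ((rho S (x 2) : ℂ) * weightT S ξ * f ξ *
    phiOf S ‖ξ‖ (growthRate S ‖ξ‖ ^ 2) (x 2) (ψ ‖ξ‖ (x 2)) (p ‖ξ‖ (x 2))) * hdir
    + (weightT S ξ * f ξ * (dP S (x 2) : ℂ)⁻¹ * p ‖ξ‖ (x 2)) * hρ

/-- The pressure perturbation has amplitude `-f p`. Its profile is continuous across the interface,
although `q` itself generally jumps there. -/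
theorem dP_mul_qField (L : Layer S) {x : Space} (hx : x 2 ∈ Ioo L.a L.b) (t : ℝ) :
    dP S (x 2) * qField S p f x t = field S (modeAmp (qCoef f) p) x t := by
  rw [qField, mul_field]
  refine field_congr (fun ξ => ?_) t
  have hD : (dP S (x 2) : ℂ) ≠ 0 := Complex.ofReal_ne_zero.2 (dP_pos (L.mem_Icc hx)).ne'
  simp only [modeAmp, qProf]
  push_cast
  field_simp

/-- The horizontal components amount to the algebraic formula for `φ`. The vertical one is the
equation for `p'`, after `ψ'` has been replaced by its expression in `p` and `φ`. -/
theorem momentum (h : IsPacket S φ ψ p κ r₀ R₂ R₃ f) (L : Layer S) {x : Space}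
    (hx : x 2 ∈ Ioo L.a L.b) (t : ℝ) (i : Fin 3) :
    rho S (x 2) * deriv (fun τ => vField S φ ψ f x τ i) t
        + pd i (fun y => dP S (y 2) * qField S p f y t) x
      = -(S.g * qField S p f x t * (if i = 2 then 1 else 0))
        - S.g * rho S (x 2) * pd i (fun y => etaField S φ ψ f y t 2) x := by
  have hq := h.profile.isCoef_q
  have hv := h.profile.isCoef_v (S := S)
  have hη := h.profile.isCoef_eta
  have e1 : deriv (fun τ => vField S φ ψ f x τ i) t = _ :=
    ((h.isAmp_prof L (hv i) i).hasDerivAt_field isOpen_Ioo (h.deriv_prof L (hv i) i).choose_spec.1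
      (h.deriv_prof L (hv i) i).choose_spec.2 hx t).deriv
  have e2 : pd i (fun y => etaField S φ ψ f y t 2) x = _ :=
    (h.isAmp_prof L (hη 2) 2).pd_field isOpen_Ioo (h.deriv_ψ L (hη 2)).1 (h.deriv_ψ L (hη 2)).2
      hx t i
  have e3 : pd i (fun y => dP S (y 2) * qField S p f y t) x
      = pd i (fun y => field S (modeAmp (qCoef f) p) y t) x := by
    rw [pd, pd, Filter.EventuallyEq.fderiv_eq]
    have hc : ContinuousAt (fun y : Space => y 2) x := (continuous_apply 2).continuousAt
    filter_upwards [hc.eventually (Ioo_mem_nhds hx.1 hx.2)] with y hy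
    exact dP_mul_qField L hy t
  rw [e1, e2, e3, (h.isAmp_p L hq).pd_field isOpen_Ioo (h.deriv_p L hq).1 (h.deriv_p L hq).2 hx t i]
  have i1 := ((h.isAmp_prof L (hv i) i).weightT_mul (S := S)).const_mul (rho S (x 2) : ℂ)
  have hρ : (rho S (x 2) : ℂ) * (rho S (x 2) : ℂ)⁻¹ = 1 :=
    mul_inv_cancel₀ (Complex.ofReal_ne_zero.2 (rho_pos (L.mem_Icc hx)).ne')
  have horizontal : ∀ j : Fin 2, ∀ ξ : Plane,
      (rho S (x 2) : ℂ) * (weightT S ξ * (weightT S ξ * (direction j ξ * f ξ) * φ ‖ξ‖ (x 2)))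
        + weightX j ξ * (-1 * f ξ * p ‖ξ‖ (x 2))
      = ((-(S.g * rho S (x 2)) : ℝ) : ℂ) * (weightX j ξ * (f ξ * ψ ‖ξ‖ (x 2))) := by
    intro j ξ
    by_cases hξ : f ξ = 0
    · simp [hξ]
    have hr := h.pos_of_ne hξ
    have hr' : (‖ξ‖ : ℂ) ≠ 0 := Complex.ofReal_ne_zero.2 hr.ne'
    have hT : (growthRate S ‖ξ‖ : ℂ) ≠ 0 := Complex.ofReal_ne_zero.2 (growthRate_pos S hr).ne'
    rw [h.phi_eq L hx hr, phiOf]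
    simp only [weightT, weightX, direction]
    push_cast
    have e : (growthRate S ‖ξ‖ : ℂ) * growthRate S ‖ξ‖ * (‖ξ‖ : ℂ)⁻¹ *
        (‖ξ‖ / (growthRate S ‖ξ‖ : ℂ) ^ 2) = 1 := by
      field_simp
    linear_combination (-Complex.I * ξ j * f ξ * (rho S (x 2) : ℂ) *
      (S.g * ψ ‖ξ‖ (x 2) - (rho S (x 2) : ℂ)⁻¹ * p ‖ξ‖ (x 2))) * e
      + (Complex.I * ξ j * f ξ * p ‖ξ‖ (x 2)) * hρ
  have hcase : i = 0 ∨ i = 1 ∨ i = 2 := by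
    fin_cases i <;> simp
  rcases hcase with rfl | rfl | rfl
  · simp only [Matrix.cons_val]
    rw [mul_field, field_add i1 ((h.isAmp_p L hq).weightX_mul 0) hx]
    simp only [Fin.reduceEq, if_false, mul_zero, neg_zero, zero_sub]
    rw [← neg_mul, mul_field]
    exact field_congr (fun ξ => horizontal 0 ξ) t
  · simp only [Matrix.cons_val]
    rw [mul_field, field_add i1 ((h.isAmp_p L hq).weightX_mul 1) hx]
    simp only [Fin.reduceEq, if_false, mul_zero, neg_zero, zero_sub]
    rw [← neg_mul, mul_field]
    exact field_congr (fun ξ => horizontal 1 ξ) t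
  · simp only [Matrix.cons_val, if_true, mul_one]
    rw [sub_eq_add_neg, ← neg_mul, ← neg_mul, qField, mul_field, mul_field, mul_field,
      field_add i1 (h.deriv_p L hq).1 hx,
      field_add ((h.isAmp_qProf L hq).const_mul _) ((h.deriv_ψ L (hη 2)).1.const_mul _) hx]
    refine field_congr (fun ξ => ?_) t
    by_cases hξ : f ξ = 0
    · simp [modeAmp, qCoef, vCoef, etaCoef, hξ]
    have hr := h.pos_of_ne hξ
    simp only [modeAmp, qCoef, vCoef, etaCoef, prof, qProf, Matrix.cons_val, weightT,
      slopePsi_eq, slopeP_eq _ _ (L.mem_Icc hx)]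
    push_cast
    linear_combination (S.g * f ξ * (dP S (x 2) : ℂ)⁻¹ * p ‖ξ‖ (x 2)) * hρ

end IsPacket

end RayleighTaylor

end

noncomputable section

namespace RayleighTaylor

variable {S : Params}

theorem exists_layer {x : Space} (hx : x ∈ upperFluid S ∪ lowerFluid S) :
    ∃ L : Layer S, x 2 ∈ Ioo L.a L.b :=
  hx.elim (fun h => ⟨upperLayer S, h⟩) fun h => ⟨lowerLayer S, h⟩

namespace IsPacket

variable {φ ψ p : ℝ → ℝ → ℝ} {κ r₀ R₂ R₃ : ℝ} {f : Plane → ℝ}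

/-! ### The linearized equations for packets of normal modes -/

theorem contDiffOn_of_layers {E : Type*} [NormedAddCommGroup E] [NormedSpace ℝ E]
    {F : Space × ℝ → E} (h : ∀ L : Layer S, ContDiffOn ℝ 1 F {q | q.1 2 ∈ Ioo L.a L.b}) :
    ContDiffOn ℝ 1 F ((upperFluid S ∪ lowerFluid S) ×ˢ univ) := by
  intro q hq
  obtain ⟨L, hL⟩ := exists_layer hq.1
  have hc : Continuous fun q : Space × ℝ => q.1 2 := (continuous_apply 2).comp continuous_fst
  exact ((h L).contDiffAt ((isOpen_Ioo.preimage hc).mem_nhds hL)).contDiffWithinAt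

theorem contDiffOn_prof (h : IsPacket S φ ψ p κ r₀ R₂ R₃ f) {c : Fin 3 → Plane → ℂ}
    (hc : ∀ i, IsCoef R₂ R₃ (c i)) :
    ContDiffOn ℝ 1 (fun q : Space × ℝ => fun i => field S (modeAmp (c i) (prof φ ψ i)) q.1 q.2)
      ((upperFluid S ∪ lowerFluid S) ×ˢ univ) := by
  refine contDiffOn_of_layers fun L => contDiffOn_pi.2 fun i => ?_
  obtain ⟨A', hA', hd⟩ := h.deriv_prof L (hc i) i
  exact (h.isAmp_prof L (hc i) i).contDiffOn_field isOpen_Ioo hA' hd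

theorem contDiffOn_qField (h : IsPacket S φ ψ p κ r₀ R₂ R₃ f) :
    ContDiffOn ℝ 1 (fun q : Space × ℝ => qField S p f q.1 q.2)
      ((upperFluid S ∪ lowerFluid S) ×ˢ univ) := by
  refine contDiffOn_of_layers fun L => ?_
  obtain ⟨A', hA', hd⟩ := h.deriv_qProf L h.profile.isCoef_q
  exact (h.isAmp_qProf L h.profile.isCoef_q).contDiffOn_field isOpen_Ioo hA' hd

/-- The boundary value at `y` of the field with coefficient `c` and profile `w`. -/
def trace (S : Params) (c : Plane → ℂ) (w : ℝ → ℝ → ℝ) (y : Space) (t : ℝ) : ℝ :=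
  (((1 / (4 * π ^ 2) : ℝ) : ℂ) * ∫ ξ, modeAmp c w ξ (y 2) * wave S ξ y t).re

/-- The limit does not depend on the side from which the boundary is approached, because the profile
is continuous on all of `[-m, ℓ]`. Applied to `ψ` and `p` from both fluids, this yields the jump
conditions. -/
theorem tendsto_trace (h : IsPacket S φ ψ p κ r₀ R₂ R₃ f) (L : Layer S) {c : Plane → ℂ}
    (hc : IsCoef R₂ R₃ c) {w : ℝ → ℝ → ℝ} (hw : IsAmp R₃ (Ioo L.a L.b) (modeAmp c w))
    (hcont : ∀ r, 0 < r → ContinuousOn (w r) (Icc (-S.m) S.ℓ)) {D : Set Space}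
    (hD : ∀ x ∈ D, x 2 ∈ Ioo L.a L.b) {y : Space} (hy : y 2 ∈ Icc (-S.m) S.ℓ) (t : ℝ) :
    Tendsto (fun x => field S (modeAmp c w) x t) (𝓝[D] y) (𝓝 (trace S c w y t)) := by
  have hmem : ∀ᶠ x in 𝓝[D] y, x ∈ D := eventually_mem_nhdsWithin
  refine hw.tendsto_field nhdsWithin_le_nhds t (hmem.mono hD) fun ξ => ?_
  by_cases hξ : c ξ = 0
  · simpa [modeAmp, hξ] using tendsto_const_nhds
  · have hr : 0 < ‖ξ‖ := by linarith [(hc.supp ξ hξ).1, h.growth.one_le, h.le]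
    have h1 : Tendsto (fun x : Space => x 2) (𝓝[D] y) (𝓝[Icc (-S.m) S.ℓ] (y 2)) :=
      tendsto_nhdsWithin_iff.2 ⟨((continuous_apply 2).tendsto y).mono_left nhdsWithin_le_nhds,
        hmem.mono fun x hx => L.mem_Icc (hD x hx)⟩
    have h2 : Tendsto (fun x : Space => w ‖ξ‖ (x 2)) (𝓝[D] y) (𝓝 (w ‖ξ‖ (y 2))) :=
      Tendsto.comp (hcont _ hr (y 2) hy) h1
    exact ((Complex.continuous_ofReal.tendsto _).comp h2).const_mul _

theorem trace_eq_zero (h : IsPacket S φ ψ p κ r₀ R₂ R₃ f) {c : Plane → ℂ} (hc : IsCoef R₂ R₃ c)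
    {w : ℝ → ℝ → ℝ} {y : Space} (hw : ∀ r, 0 < r → w r (y 2) = 0) (t : ℝ) :
    trace S c w y t = 0 := by
  have : ∀ ξ, modeAmp c w ξ (y 2) * wave S ξ y t = 0 := fun ξ => by
    by_cases hξ : c ξ = 0
    · simp [modeAmp, hξ]
    · have hr : 0 < ‖ξ‖ := by linarith [(hc.supp ξ hξ).1, h.growth.one_le, h.le]
      simp [modeAmp, hw _ hr]
  simp [trace, this]

theorem isLinearizedSolution (h : IsPacket S φ ψ p κ r₀ R₂ R₃ f) :
    IsLinearizedSolution S (etaField S φ ψ f) (vField S φ ψ f) (qField S p f) := by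
  have hv : ∀ (L : Layer S) (D : Set Space), (∀ x ∈ D, x 2 ∈ Ioo L.a L.b) → ∀ y : Space,
      y 2 ∈ Icc (-S.m) S.ℓ → ∀ t,
      Tendsto (fun x => vField S φ ψ f x t 2) (𝓝[D] y) (𝓝 (trace S (vCoef S f 2) ψ y t)) :=
    fun L D hD y hy t => h.tendsto_trace L (h.profile.isCoef_v 2)
      (h.isAmp_prof L (h.profile.isCoef_v 2) 2) (fun r hr => (h.data.sol r hr).cont_ψ) hD hy t
  have hq : ∀ (L : Layer S) (D : Set Space), (∀ x ∈ D, x 2 ∈ Ioo L.a L.b) → ∀ y : Space,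
      y 2 ∈ Icc (-S.m) S.ℓ → ∀ t,
      Tendsto (fun x => dP S (x 2) * qField S p f x t) (𝓝[D] y)
        (𝓝 (trace S (qCoef f) p y t)) := fun L D hD y hy t => by
    refine (h.tendsto_trace L h.profile.isCoef_q (h.isAmp_p L h.profile.isCoef_q)
      (fun r hr => (h.data.sol r hr).cont_p) hD hy t).congr' ?_
    filter_upwards [eventually_mem_nhdsWithin] with x hx
    exact (dP_mul_qField L (hD x hx) t).symm
  have h0 : (0 : ℝ) ∈ Icc (-S.m) S.ℓ := ⟨(neg_lt_zero.2 S.m_pos).le, S.ℓ_pos.le⟩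
  refine ⟨h.contDiffOn_prof h.profile.isCoef_eta, h.contDiffOn_prof h.profile.isCoef_v,
    h.contDiffOn_qField, fun x hx t => ?_, fun x hx t => ?_, fun x hx t i => ?_, fun y hy t => ?_,
    fun y hy t => ?_, fun y hy t => ?_, fun y hy t => ?_⟩
  · obtain ⟨L, hL⟩ := exists_layer hx
    exact (h.hasDerivAt_etaField L hL t).deriv
  · obtain ⟨L, hL⟩ := exists_layer hx
    exact h.mass L hL t
  · obtain ⟨L, hL⟩ := exists_layer hx
    exact h.momentum L hL t i
  · exact ⟨_, hv (upperLayer S) _ (fun x hx => hx) y (hy ▸ h0) t,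
      hv (lowerLayer S) _ (fun x hx => hx) y (hy ▸ h0) t⟩
  · exact ⟨_, hq (upperLayer S) _ (fun x hx => hx) y (hy ▸ h0) t,
      hq (lowerLayer S) _ (fun x hx => hx) y (hy ▸ h0) t⟩
  · rw [← h.trace_eq_zero (h.profile.isCoef_v 2) (w := ψ) (y := y)
      (fun r hr => by rw [hy]; exact (h.data.sol r hr).top) t]
    exact hv (upperLayer S) _ (fun x hx => hx) y (by rw [hy]; exact ⟨(neg_m_lt_ℓ S).le, le_rfl⟩) t
  · rw [← h.trace_eq_zero (h.profile.isCoef_v 2) (w := ψ) (y := y)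
      (fun r hr => by rw [hy]; exact (h.data.sol r hr).bottom) t]
    exact hv (lowerLayer S) _ (fun x hx => hx) y (by rw [hy]; exact ⟨le_rfl, (neg_m_lt_ℓ S).le⟩) t

/-! ### The synthesis integrals -/

theorem etaIntegrand_eq (x : Space) (t : ℝ) (ξ : Plane) (i : Fin 3) :
    etaIntegrand S φ ψ f x t ξ i = modeAmp (etaCoef f i) (prof φ ψ i) ξ (x 2) * wave S ξ x t := by
  fin_cases i <;> simp [etaIntegrand, wHat, modeAmp, etaCoef, prof, direction, horiz] <;> ring

theorem vIntegrand_eq (x : Space) (t : ℝ) (ξ : Plane) (i : Fin 3) :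
    vIntegrand S φ ψ f x t ξ i
      = modeAmp (vCoef S f i) (prof φ ψ i) ξ (x 2) * wave S ξ x t := by
  have h1 : vIntegrand S φ ψ f x t ξ i = weightT S ξ * etaIntegrand S φ ψ f x t ξ i := by
    simp only [vIntegrand, etaIntegrand, weightT, Pi.smul_apply, smul_eq_mul]
    ring
  rw [h1, etaIntegrand_eq]
  simp only [modeAmp, vCoef]
  ring

/-- The definition of the pressure gives `rφ + ψ' = p/(P'ρ₀)` at every height off the interface, so
the synthesis of `q` is governed by `p` and involves no derivative of the mode. -/
theorem qIntegrand_eq (h : IsPacket S φ ψ p κ r₀ R₂ R₃ f) {x : Space}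
    (hx : x ∈ upperFluid S ∪ lowerFluid S) (t : ℝ) (ξ : Plane) :
    qIntegrand S φ ψ f x t ξ = ((-(rho S (x 2))⁻¹ : ℝ) : ℂ) *
      (modeAmp (qCoef f) (qProf S p) ξ (x 2) * wave S ξ x t) := by
  obtain ⟨L, hL⟩ := exists_layer hx
  by_cases hξ : f ξ = 0
  · simp [qIntegrand, modeAmp, qCoef, hξ]
  have hr := h.pos_of_ne hξ
  have h1 : ξ 0 * horiz φ ξ (x 2) 0 + ξ 1 * horiz φ ξ (x 2) 1 = ‖ξ‖ * φ ‖ξ‖ (x 2) := by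
    have h2 : ξ 0 * ξ 0 + ξ 1 * ξ 1 = ‖ξ‖ * ‖ξ‖ := by
      rw [← inner_plane, real_inner_self_eq_norm_mul_norm]
    simp only [horiz]
    field_simp
    linear_combination φ ‖ξ‖ (x 2) * h2
  have h3 : deriv (ψ ‖ξ‖) (x 2) = _ := (h.data.hasDerivAt L hr hL).1.deriv
  rw [qIntegrand, h1, h3, slopePsi_eq, h.phi_eq L hL hr, modeAmp, qCoef, qProf]
  push_cast
  ring

theorem integrable_etaIntegrand (h : IsPacket S φ ψ p κ r₀ R₂ R₃ f) {x : Space}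
    (hx : x ∈ upperFluid S ∪ lowerFluid S) (t : ℝ) : Integrable (etaIntegrand S φ ψ f x t) := by
  obtain ⟨L, hL⟩ := exists_layer hx
  refine Integrable.of_eval fun i => ?_
  simp only [etaIntegrand_eq]
  exact (h.isAmp_prof L (h.profile.isCoef_eta i) i).integrable hL t

theorem integrable_vIntegrand (h : IsPacket S φ ψ p κ r₀ R₂ R₃ f) {x : Space}
    (hx : x ∈ upperFluid S ∪ lowerFluid S) (t : ℝ) : Integrable (vIntegrand S φ ψ f x t) := by
  obtain ⟨L, hL⟩ := exists_layer hx
  refine Integrable.of_eval fun i => ?_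
  simp only [vIntegrand_eq]
  exact (h.isAmp_prof L (h.profile.isCoef_v i) i).integrable hL t

theorem integrable_qIntegrand (h : IsPacket S φ ψ p κ r₀ R₂ R₃ f) {x : Space}
    (hx : x ∈ upperFluid S ∪ lowerFluid S) (t : ℝ) : Integrable (qIntegrand S φ ψ f x t) := by
  obtain ⟨L, hL⟩ := exists_layer hx
  have e : qIntegrand S φ ψ f x t = fun ξ => _ := funext fun ξ => h.qIntegrand_eq hx t ξ
  rw [e]
  exact ((h.isAmp_qProf L h.profile.isCoef_q).integrable hL t).const_mul _

/-- The horizontal factors `-iξ_j/|ξ|` are odd and imaginary, while `f` is even and real. This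
Hermitian symmetry makes the fields real. -/
theorem etaCoef_neg (h : IsProfile R₂ R₃ f) (i : Fin 3) (ξ : Plane) :
    etaCoef f i (-ξ) = (starRingEnd ℂ) (etaCoef f i ξ) := by
  have h1 : f (-ξ) = f ξ := h.radial _ _ (norm_neg ξ)
  have h2 : ∀ j, direction j (-ξ) = (starRingEnd ℂ) (direction j ξ) := fun j => by
    simp [direction, neg_div]
  fin_cases i <;> simp [etaCoef, h1, h2]

theorem ofReal_etaField (h : IsPacket S φ ψ p κ r₀ R₂ R₃ f) {x : Space}
    (hx : x ∈ upperFluid S ∪ lowerFluid S) (t : ℝ) (i : Fin 3) :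
    (etaField S φ ψ f x t i : ℂ) = etaSynth S φ ψ f x t i := by
  rw [etaField, ofReal_field fun ξ => by
    rw [modeAmp, etaCoef_neg h.profile, norm_neg, modeAmp, map_mul, Complex.conj_ofReal]]
  rw [etaSynth, Pi.smul_apply, eval_integral fun i => (h.integrable_etaIntegrand hx t).eval i]
  simp only [etaIntegrand_eq]
  rfl

theorem ofReal_vField (h : IsPacket S φ ψ p κ r₀ R₂ R₃ f) {x : Space}
    (hx : x ∈ upperFluid S ∪ lowerFluid S) (t : ℝ) (i : Fin 3) :
    (vField S φ ψ f x t i : ℂ) = vSynth S φ ψ f x t i := by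
  rw [vField, ofReal_field fun ξ => by
    rw [modeAmp, vCoef, etaCoef_neg h.profile, weightT, norm_neg, modeAmp, vCoef, weightT, map_mul,
      map_mul, Complex.conj_ofReal, Complex.conj_ofReal]]
  rw [vSynth, Pi.smul_apply, eval_integral fun i => (h.integrable_vIntegrand hx t).eval i]
  simp only [vIntegrand_eq]
  rfl

theorem ofReal_qField (h : IsPacket S φ ψ p κ r₀ R₂ R₃ f) {x : Space}
    (hx : x ∈ upperFluid S ∪ lowerFluid S) (t : ℝ) :
    (qField S p f x t : ℂ) = qSynth S φ ψ f x t := by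
  obtain ⟨L, hL⟩ := exists_layer hx
  have h1 : ∀ ξ, f (-ξ) = f ξ := fun ξ => h.profile.radial _ _ (norm_neg ξ)
  rw [qField, ofReal_field fun ξ => by
    rw [modeAmp, qCoef, h1, norm_neg, modeAmp, qCoef, map_mul, map_mul, map_neg, map_one,
      Complex.conj_ofReal, Complex.conj_ofReal]]
  have hρ := (rho_pos (L.mem_Icc hL)).ne'
  rw [qSynth]
  simp only [h.qIntegrand_eq hx t]
  rw [integral_const_mul, ← mul_assoc, ← Complex.ofReal_mul, cfield, synth]
  congr 2
  field_simp

end IsPacket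

end RayleighTaylor

end

noncomputable section

namespace RayleighTaylor

variable {S : Params}

/-! ### Rotations about the vertical axis -/

/-- The entries of a rotation about the vertical axis. -/
structure IsVerticalRotation (R : Matrix (Fin 3) (Fin 3) ℝ) : Prop where
  c02 : R 0 2 = 0
  c12 : R 1 2 = 0
  c20 : R 2 0 = 0
  c21 : R 2 1 = 0
  c22 : R 2 2 = 1
  n0 : R 0 0 * R 0 0 + R 1 0 * R 1 0 = 1
  n1 : R 0 1 * R 0 1 + R 1 1 * R 1 1 = 1
  n01 : R 0 0 * R 0 1 + R 1 0 * R 1 1 = 0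

/-- The third column is `e₃`; orthonormality of the columns then clears the third row and makes the
horizontal block orthogonal. -/
theorem isVerticalRotation {R : Matrix (Fin 3) (Fin 3) ℝ}
    (hR : R ∈ Matrix.specialOrthogonalGroup (Fin 3) ℝ)
    (h : R *ᵥ (Pi.single 2 1 : Fin 3 → ℝ) = Pi.single 2 1) : IsVerticalRotation R := by
  have hO := (Matrix.mem_specialOrthogonalGroup_iff.1 hR).1
  have h1 : Rᵀ * R = 1 := (Matrix.mem_orthogonalGroup_iff' (Fin 3) ℝ).1 hO
  have hcol : ∀ i, R i 2 = (Pi.single 2 1 : Fin 3 → ℝ) i := fun i => by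
    rw [← h]
    simp
  have c02 : R 0 2 = 0 := by simpa using hcol 0
  have c12 : R 1 2 = 0 := by simpa using hcol 1
  have c22 : R 2 2 = 1 := by simpa using hcol 2
  have e : ∀ i j, R 0 i * R 0 j + R 1 i * R 1 j + R 2 i * R 2 j
      = (1 : Matrix (Fin 3) (Fin 3) ℝ) i j := fun i j => by
    rw [← h1, Matrix.mul_apply, Fin.sum_univ_three]
    rfl
  have c20 : R 2 0 = 0 := by simpa [c02, c12, c22] using e 0 2
  have c21 : R 2 1 = 0 := by simpa [c02, c12, c22] using e 1 2
  refine ⟨c02, c12, c20, c21, c22, ?_, ?_, ?_⟩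
  · simpa [c20] using e 0 0
  · simpa [c21] using e 1 1
  · simpa [c20, c21] using e 0 1

namespace IsVerticalRotation

variable {R : Matrix (Fin 3) (Fin 3) ℝ}

/-- The rotation of horizontal vectors. -/
def toLinearMap (R : Matrix (Fin 3) (Fin 3) ℝ) : Plane →ₗ[ℝ] Plane where
  toFun ξ := !₂[R 0 0 * ξ 0 + R 0 1 * ξ 1, R 1 0 * ξ 0 + R 1 1 * ξ 1]
  map_add' ξ ζ := by
    ext i
    fin_cases i <;> simp <;> ring
  map_smul' k ξ := by
    ext i
    fin_cases i <;> simp <;> ring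

theorem toLinearMap_zero (ξ : Plane) :
    toLinearMap R ξ 0 = R 0 0 * ξ 0 + R 0 1 * ξ 1 := rfl

theorem toLinearMap_one (ξ : Plane) :
    toLinearMap R ξ 1 = R 1 0 * ξ 0 + R 1 1 * ξ 1 := rfl

theorem norm_toLinearMap (h : IsVerticalRotation R) (ξ : Plane) : ‖toLinearMap R ξ‖ = ‖ξ‖ := by
  rw [← sq_eq_sq₀ (norm_nonneg _) (norm_nonneg _), ← real_inner_self_eq_norm_sq,
    ← real_inner_self_eq_norm_sq, inner_plane, inner_plane, toLinearMap_zero, toLinearMap_one]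
  linear_combination (ξ 0 * ξ 0) * h.n0 + (ξ 1 * ξ 1) * h.n1 + (2 * ξ 0 * ξ 1) * h.n01

/-- The rotation of horizontal vectors as an isometry. -/
def toIsometry (h : IsVerticalRotation R) : Plane ≃ₗᵢ[ℝ] Plane :=
  LinearIsometry.toLinearIsometryEquiv ⟨toLinearMap R, h.norm_toLinearMap⟩ rfl

theorem toIsometry_apply (h : IsVerticalRotation R) (ξ : Plane) :
    h.toIsometry ξ = toLinearMap R ξ := rfl

theorem mulVec_zero (h : IsVerticalRotation R) (x : Space) :
    (R *ᵥ x) 0 = R 0 0 * x 0 + R 0 1 * x 1 := by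
  simp [Matrix.mulVec, dotProduct, Fin.sum_univ_three, h.c02]

theorem mulVec_one (h : IsVerticalRotation R) (x : Space) :
    (R *ᵥ x) 1 = R 1 0 * x 0 + R 1 1 * x 1 := by
  simp [Matrix.mulVec, dotProduct, Fin.sum_univ_three, h.c12]

theorem mulVec_two (h : IsVerticalRotation R) (x : Space) : (R *ᵥ x) 2 = x 2 := by
  simp [Matrix.mulVec, dotProduct, Fin.sum_univ_three, h.c20, h.c21, h.c22]

theorem wave_apply (h : IsVerticalRotation R) (ξ : Plane) (x : Space) (t : ℝ) :
    wave S (toLinearMap R ξ) (R *ᵥ x) t = wave S ξ x t := by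
  rw [wave, wave, h.norm_toLinearMap, h.mulVec_zero, h.mulVec_one, toLinearMap_zero,
    toLinearMap_one]
  congr 4
  linear_combination (x 0 * ξ 0) * h.n0 + (x 1 * ξ 1) * h.n1 + (x 0 * ξ 1 + x 1 * ξ 0) * h.n01

/-- Substitute `ξ ↦ Rξ`, which preserves Lebesgue measure, `|ξ|` and the phase `x'·ξ`. What remains
of the rotation acts on the amplitude alone. -/
theorem field_mulVec (h : IsVerticalRotation R) (a : Plane → ℝ → ℂ) (x : Space) (t : ℝ) :
    field S a (R *ᵥ x) t = field S (fun ξ s => a (toLinearMap R ξ) s) x t := by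
  have e : synth S a (R *ᵥ x) t = synth S (fun ξ s => a (toLinearMap R ξ) s) x t := by
    rw [synth, synth, h.mulVec_two,
      ← h.toIsometry.measurePreserving.integral_comp h.toIsometry.toHomeomorph.measurableEmbedding]
    simp only [toIsometry_apply, h.wave_apply]
  rw [field, field, cfield, cfield, e]

end IsVerticalRotation

namespace IsPacket

variable {φ ψ p : ℝ → ℝ → ℝ} {κ r₀ R₂ R₃ : ℝ} {f : Plane → ℝ} {R : Matrix (Fin 3) (Fin 3) ℝ}

theorem direction_rotate (hR : IsVerticalRotation R) (ξ : Plane) :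
    direction 0 (IsVerticalRotation.toLinearMap R ξ)
      = R 0 0 * direction 0 ξ + R 0 1 * direction 1 ξ ∧
    direction 1 (IsVerticalRotation.toLinearMap R ξ)
      = R 1 0 * direction 0 ξ + R 1 1 * direction 1 ξ := by
  simp only [direction, hR.norm_toLinearMap, IsVerticalRotation.toLinearMap_zero,
    IsVerticalRotation.toLinearMap_one]
  push_cast
  constructor <;> ring

/-- Fields whose horizontal coefficients are directed along the frequency rotate. -/
theorem rotate (h : IsPacket S φ ψ p κ r₀ R₂ R₃ f) (hR : IsVerticalRotation R)
    {c : Fin 3 → Plane → ℂ} {m : Plane → ℂ} (hm : ∀ ξ ζ : Plane, ‖ξ‖ = ‖ζ‖ → m ξ = m ζ)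
    (hc : ∀ i ξ, c i ξ = m ξ * etaCoef f i ξ) (hcoef : ∀ i, IsCoef R₂ R₃ (c i)) {x : Space}
    (hx : x ∈ upperFluid S ∪ lowerFluid S) (t : ℝ) :
    (fun i => field S (modeAmp (c i) (prof φ ψ i)) (R *ᵥ x) t)
      = R *ᵥ fun i => field S (modeAmp (c i) (prof φ ψ i)) x t := by
  obtain ⟨L, hL⟩ := exists_layer hx
  have hamp := fun i => h.isAmp_prof L (hcoef i) i
  have hf : ∀ ξ, f (IsVerticalRotation.toLinearMap R ξ) = f ξ := fun ξ =>
    h.profile.radial _ _ (hR.norm_toLinearMap ξ)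
  have hm' : ∀ ξ, m (IsVerticalRotation.toLinearMap R ξ) = m ξ := fun ξ =>
    hm _ _ (hR.norm_toLinearMap ξ)
  have hd := fun ξ => direction_rotate hR ξ
  have hcase : ∀ i : Fin 3, i = 0 ∨ i = 1 ∨ i = 2 := fun i => by fin_cases i <;> simp
  ext i
  rw [hR.field_mulVec]
  rcases hcase i with rfl | rfl | rfl
  · rw [hR.mulVec_zero, mul_field, mul_field,
      field_add ((hamp 0).const_mul _) ((hamp 1).const_mul _) hL]
    refine field_congr (fun ξ => ?_) t
    simp only [modeAmp, hc, etaCoef, prof, Matrix.cons_val, hR.norm_toLinearMap, hf, hm', (hd ξ).1]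
    ring
  · rw [hR.mulVec_one, mul_field, mul_field,
      field_add ((hamp 0).const_mul _) ((hamp 1).const_mul _) hL]
    refine field_congr (fun ξ => ?_) t
    simp only [modeAmp, hc, etaCoef, prof, Matrix.cons_val, hR.norm_toLinearMap, hf, hm', (hd ξ).2]
    ring
  · rw [hR.mulVec_two]
    refine field_congr (fun ξ => ?_) t
    simp only [modeAmp, hc, etaCoef, prof, Matrix.cons_val, hR.norm_toLinearMap, hf, hm']

theorem etaField_mulVec (h : IsPacket S φ ψ p κ r₀ R₂ R₃ f) (hR : IsVerticalRotation R) {x : Space}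
    (hx : x ∈ upperFluid S ∪ lowerFluid S) (t : ℝ) :
    etaField S φ ψ f (R *ᵥ x) t = R *ᵥ etaField S φ ψ f x t :=
  h.rotate hR (m := fun _ => 1) (fun _ _ _ => rfl) (fun _ _ => (one_mul _).symm)
    h.profile.isCoef_eta hx t

theorem vField_mulVec (h : IsPacket S φ ψ p κ r₀ R₂ R₃ f) (hR : IsVerticalRotation R) {x : Space}
    (hx : x ∈ upperFluid S ∪ lowerFluid S) (t : ℝ) :
    vField S φ ψ f (R *ᵥ x) t = R *ᵥ vField S φ ψ f x t :=
  h.rotate hR (m := weightT S) (fun ξ ζ e => by rw [weightT, weightT, e]) (fun _ _ => rfl)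
    h.profile.isCoef_v hx t

theorem qField_mulVec (h : IsPacket S φ ψ p κ r₀ R₂ R₃ f) (hR : IsVerticalRotation R) (x : Space)
    (t : ℝ) : qField S p f (R *ᵥ x) t = qField S p f x t := by
  rw [qField, hR.field_mulVec]
  refine field_congr (fun ξ => ?_) t
  simp only [modeAmp, qCoef, hR.norm_toLinearMap, h.profile.radial _ _ (hR.norm_toLinearMap ξ)]

end IsPacket

end RayleighTaylor

end

noncomputable section

namespace RayleighTaylor

variable {S : Params}

/-! ### Sobolev norms of the synthesized solution -/

theorem IsPacket.isEvolution {φ ψ p : ℝ → ℝ → ℝ} {κ r₀ R₂ R₃ : ℝ} {f : Plane → ℝ}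
    (h : IsPacket S φ ψ p κ r₀ R₂ R₃ f) (L : Layer S) {c : Plane → ℂ} (hc : IsCoef R₂ R₃ c)
    (hconj : ∀ ξ, c (-ξ) = (starRingEnd ℂ) (c ξ)) {a b w : ℝ → ℝ → ℝ}
    (hw : IsCombination L ψ p a b w) :
    IsEvolution L c a b ψ p fun t p' => field S (modeAmp c w) ![p'.1 0, p'.1 1, p'.2] t := by
  intro t x s hs
  rw [ofReal_field fun ξ => by
    rw [modeAmp, hconj, norm_neg, modeAmp, map_mul, Complex.conj_ofReal], cfield, synth,
    planeSynth]
  congr 2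
  ext ξ
  have e := ModeData.modeAmp_eq h.growth h.le hc hw ξ hs
  simp only [Matrix.cons_val] at e ⊢
  rw [e, amp, amp, evolve, wave]
  simp only [Matrix.cons_val]
  ring

/-- Sobolev bounds for one scalar component. -/
theorem exists_hkSq_bound {κ r₀ : ℝ} (hG : GrowthBound S κ r₀) {a b : Layer S → ℝ → ℝ → ℝ}
    (ha : ∀ L, Symbol L.J r₀ 0 (a L)) (hb : ∀ L, Symbol L.J r₀ 0 (b L)) (k : ℕ) :
    ∃ K, 0 < K ∧ ∀ φ ψ p R₂ R₃ f, IsPacket S φ ψ p κ r₀ R₂ R₃ f → ∀ c, IsCoef R₂ R₃ c →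
      (∀ ξ, c (-ξ) = (starRingEnd ℂ) (c ξ)) →
      (∀ ξ, ‖c ξ‖ ^ 2 ≤ (1 + S.g * ‖ξ‖) * |f ξ| ^ 2) →
      ∀ w, (∀ L, IsCombination L ψ p (a L) (b L) w) →
      hkSq S k (fun x => field S (modeAmp c w) x 0)
          ≤ ENNReal.ofReal K * ∫⁻ ξ, ENNReal.ofReal ((1 + ‖ξ‖ ^ 2) ^ (k + 1) * |f ξ| ^ 2) ∧
      ∀ t, hkSq S k (fun x => field S (modeAmp c w) x t) < ⊤ ∧
        ∀ α β, 0 < t → (∀ r, R₂ ≤ r → r ≤ R₃ → α ≤ growthRate S r ∧ growthRate S r ≤ β) →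
          ENNReal.ofReal (Real.exp (t * α)) ^ 2 * hkSq S k (fun x => field S (modeAmp c w) x 0)
            ≤ hkSq S k (fun x => field S (modeAmp c w) x t) ∧
          hkSq S k (fun x => field S (modeAmp c w) x t)
            ≤ ENNReal.ofReal (Real.exp (t * β)) ^ 2 *
              hkSq S k (fun x => field S (modeAmp c w) x 0) := by
  have hex := fun L => exists_hkSqOn_bound hG L (ha L) (hb L) k
  obtain ⟨K, hK0, hK⟩ := hex (upperLayer S)
  obtain ⟨K', hK'0, hK'⟩ := hex (lowerLayer S)
  refine ⟨K + K', by positivity, fun φ ψ p R₂ R₃ f h c hc hconj hcf w hw => ?_⟩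
  obtain ⟨u1, u2⟩ := hK φ ψ p h.data R₂ R₃ h.le c hc _ (h.isEvolution _ hc hconj (hw _))
  obtain ⟨l1, l2⟩ := hK' φ ψ p h.data R₂ R₃ h.le c hc _ (h.isEvolution _ hc hconj (hw _))
  refine ⟨?_, fun t => ⟨ENNReal.add_lt_top.2 ⟨(u2 t).1, (l2 t).1⟩, fun α β ht hαβ => ?_⟩⟩
  · rw [ENNReal.ofReal_add hK0.le hK'0.le, add_mul]
    exact add_le_add (u1 f hcf) (l1 f hcf)
  · obtain ⟨u3, u4⟩ := (u2 t).2 α β ht hαβ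
    obtain ⟨l3, l4⟩ := (l2 t).2 α β ht hαβ
    simp only [hkSq, mul_add]
    exact ⟨add_le_add u3 l3, add_le_add u4 l4⟩

theorem sqrt_mono {x y : ℝ≥0∞} (h : x ≤ y) : x ^ (1 / 2 : ℝ) ≤ y ^ (1 / 2 : ℝ) :=
  ENNReal.rpow_le_rpow h (by norm_num)

theorem sqrt_sq_mul (e x : ℝ≥0∞) : (e ^ 2 * x) ^ (1 / 2 : ℝ) = e * x ^ (1 / 2 : ℝ) := by
  rw [ENNReal.mul_rpow_of_nonneg _ _ (by norm_num), ← ENNReal.rpow_natCast, ← ENNReal.rpow_mul]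
  norm_num

theorem sqrt_ofReal_mul {K : ℝ} (hK : 0 ≤ K) (x : ℝ≥0∞) :
    (ENNReal.ofReal K * x) ^ (1 / 2 : ℝ) = ENNReal.ofReal √K * x ^ (1 / 2 : ℝ) := by
  rw [← sqrt_sq_mul, ← ENNReal.ofReal_pow (Real.sqrt_nonneg _), Real.sq_sqrt hK]

theorem norm_etaCoef_le (f : Plane → ℝ) (i : Fin 3) (ξ : Plane) : ‖etaCoef f i ξ‖ ≤ |f ξ| := by
  have h : ∀ j, ‖direction j ξ * (f ξ : ℂ)‖ ≤ |f ξ| := fun j => by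
    rw [norm_mul, Complex.norm_real, Real.norm_eq_abs]
    exact mul_le_of_le_one_left (abs_nonneg _) (norm_direction_le j ξ)
  fin_cases i
  · exact h 0
  · exact h 1
  · exact (Complex.norm_real _).le

theorem sq_etaCoef_le (f : Plane → ℝ) (i : Fin 3) (ξ : Plane) :
    ‖etaCoef f i ξ‖ ^ 2 ≤ (1 + S.g * ‖ξ‖) * |f ξ| ^ 2 := by
  have h1 : ‖etaCoef f i ξ‖ ^ 2 ≤ |f ξ| ^ 2 := by
    have := norm_etaCoef_le f i ξ
    gcongr
  have h2 : 0 ≤ S.g * ‖ξ‖ * |f ξ| ^ 2 := by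
    have := S.g_pos
    positivity
  linarith

/-- The velocity carries an additional factor `λ`, and `λ² ≤ g |ξ|`; the common bound for all
coefficients is shaped to accommodate it. -/
theorem sq_vCoef_le (f : Plane → ℝ) (i : Fin 3) (ξ : Plane) :
    ‖vCoef S f i ξ‖ ^ 2 ≤ (1 + S.g * ‖ξ‖) * |f ξ| ^ 2 := by
  have h1 : ‖etaCoef f i ξ‖ ^ 2 ≤ |f ξ| ^ 2 := by
    have := norm_etaCoef_le f i ξ
    gcongr
  have h2 : growthRate S ‖ξ‖ ^ 2 ≤ S.g * ‖ξ‖ := by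
    simpa using growthRate_sq_le_abs (S := S) ‖ξ‖
  rw [vCoef, norm_mul, mul_pow, weightT, Complex.norm_real, Real.norm_eq_abs, sq_abs]
  have h3 : 0 ≤ S.g * ‖ξ‖ := mul_nonneg S.g_pos.le (norm_nonneg _)
  exact mul_le_mul (by linarith) h1 (by positivity) (by positivity)

theorem sq_qCoef_le (f : Plane → ℝ) (ξ : Plane) :
    ‖qCoef f ξ‖ ^ 2 ≤ (1 + S.g * ‖ξ‖) * |f ξ| ^ 2 := by
  have := sq_etaCoef_le (S := S) f 2 ξ
  simpa [qCoef, etaCoef] using this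

/-- Sobolev bounds for the synthesized solution. -/
theorem exists_sobolev_bound {κ r₀ : ℝ} (hG : GrowthBound S κ r₀) (k : ℕ) :
    ∃ C, 0 < C ∧ ∀ φ ψ p R₂ R₃ f, IsPacket S φ ψ p κ r₀ R₂ R₃ f →
      hkNormVec S k (fun x => etaField S φ ψ f x 0) + hkNormVec S k (fun x => vField S φ ψ f x 0)
          + hkNorm S k (fun x => qField S p f x 0) ≤ ENNReal.ofReal C * weightNorm k f ∧
      ∀ t, (hkNormVec S k (fun x => etaField S φ ψ f x t) < ⊤ ∧
          hkNormVec S k (fun x => vField S φ ψ f x t) < ⊤ ∧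
          hkNorm S k (fun x => qField S p f x t) < ⊤) ∧
        ∀ α β, 0 < t → (∀ r, R₂ ≤ r → r ≤ R₃ → α ≤ growthRate S r ∧ growthRate S r ≤ β) →
          GrowsBetween α β (fun τ => hkNormVec S k (fun x => etaField S φ ψ f x τ)) t ∧
          GrowsBetween α β (fun τ => hkNormVec S k (fun x => vField S φ ψ f x τ)) t ∧
          GrowsBetween α β (fun τ => hkNorm S k (fun x => qField S p f x τ)) t := by
  choose K hK0 hK using fun i : Fin 3 => exists_hkSq_bound hG (a := fun _ => profA S i)
    (b := fun L => profB L i) (fun L => symbol_profA hG L.J i) (fun L => symbol_profB hG L i) k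
  obtain ⟨Q, hQ0, hQ⟩ := exists_hkSq_bound hG (a := fun _ _ _ => 0)
    (b := fun L => fun _ s => (L.D s)⁻¹) (fun _ => Symbol.const 0) (fun L => symbol_D_inv L r₀) k
  have hKs : 0 ≤ ∑ i, K i := Finset.sum_nonneg fun i _ => (hK0 i).le
  -- Displacement and velocity have the same vertical profiles and satisfy the same coefficient
  -- bound, so they share one constant.
  refine ⟨√(∑ i, K i) + √(∑ i, K i) + √Q, by positivity, fun φ ψ p R₂ R₃ f h => ?_⟩
  have hcomb := fun i L => h.data.isCombination_prof L i
  have hηconj := fun i => IsPacket.etaCoef_neg h.profile i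
  have hvconj : ∀ i ξ, vCoef S f i (-ξ) = (starRingEnd ℂ) (vCoef S f i ξ) := fun i ξ => by
    rw [vCoef, hηconj, weightT, norm_neg, vCoef, weightT, map_mul, Complex.conj_ofReal]
  have hqconj : ∀ ξ, qCoef f (-ξ) = (starRingEnd ℂ) (qCoef f ξ) := fun ξ => by
    rw [qCoef, h.profile.radial _ _ (norm_neg ξ), qCoef, map_mul, map_neg, map_one,
      Complex.conj_ofReal]
  have vec : ∀ c : Fin 3 → Plane → ℂ, (∀ i, IsCoef R₂ R₃ (c i)) →
      (∀ i ξ, c i (-ξ) = (starRingEnd ℂ) (c i ξ)) →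
      (∀ i ξ, ‖c i ξ‖ ^ 2 ≤ (1 + S.g * ‖ξ‖) * |f ξ| ^ 2) →
      hkNormVec S k (fun x i => field S (modeAmp (c i) (prof φ ψ i)) x 0)
        ≤ ENNReal.ofReal √(∑ i, K i) * weightNorm k f ∧
      ∀ t, hkNormVec S k (fun x i => field S (modeAmp (c i) (prof φ ψ i)) x t) < ⊤ ∧
        ∀ α β, 0 < t → (∀ r, R₂ ≤ r → r ≤ R₃ → α ≤ growthRate S r ∧ growthRate S r ≤ β) →
          GrowsBetween α β
            (fun τ => hkNormVec S k (fun x i => field S (modeAmp (c i) (prof φ ψ i)) x τ)) t := by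
    intro c h1 h2 h3
    have H := fun i => hK i φ ψ p R₂ R₃ f h (c i) (h1 i) (h2 i) (h3 i) _ (hcomb i)
    refine ⟨?_, fun t => ⟨?_, fun α β ht hαβ => ⟨?_, ?_⟩⟩⟩
    · rw [hkNormVec, weightNorm, ← sqrt_ofReal_mul hKs,
        ENNReal.ofReal_sum_of_nonneg fun i _ => (hK0 i).le, Finset.sum_mul]
      exact sqrt_mono (Finset.sum_le_sum fun i _ => (H i).1)
    · exact ENNReal.rpow_lt_top_of_nonneg (by norm_num)
        (ENNReal.sum_lt_top.2 fun i _ => ((H i).2 t).1).ne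
    · simp only [hkNormVec]
      rw [← sqrt_sq_mul, Finset.mul_sum]
      exact sqrt_mono (Finset.sum_le_sum fun i _ => (((H i).2 t).2 α β ht hαβ).1)
    · simp only [hkNormVec]
      rw [← sqrt_sq_mul, Finset.mul_sum]
      exact sqrt_mono (Finset.sum_le_sum fun i _ => (((H i).2 t).2 α β ht hαβ).2)
  obtain ⟨η1, η2⟩ := vec _ h.profile.isCoef_eta hηconj (sq_etaCoef_le f)
  obtain ⟨v1, v2⟩ := vec _ h.profile.isCoef_v hvconj (sq_vCoef_le f)
  obtain ⟨q1, q2⟩ := hQ φ ψ p R₂ R₃ f h (qCoef f) h.profile.isCoef_q hqconj (sq_qCoef_le f)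
    (qProf S p) ModeData.isCombination_qProf
  refine ⟨?_, fun t => ⟨⟨(η2 t).1, (v2 t).1, ENNReal.rpow_lt_top_of_nonneg (by norm_num)
    (q2 t).1.ne⟩, fun α β ht hαβ => ⟨(η2 t).2 α β ht hαβ, (v2 t).2 α β ht hαβ, ?_, ?_⟩⟩⟩
  · rw [ENNReal.ofReal_add (by positivity) (by positivity),
      ENNReal.ofReal_add (by positivity) (by positivity), add_mul, add_mul]
    refine add_le_add (add_le_add η1 v1) ?_
    rw [weightNorm, ← sqrt_ofReal_mul hQ0.le]
    exact sqrt_mono q1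
  · simp only [hkNorm]
    rw [← sqrt_sq_mul]
    exact sqrt_mono ((q2 t).2 α β ht hαβ).1
  · simp only [hkNorm]
    rw [← sqrt_sq_mul]
    exact sqrt_mono ((q2 t).2 α β ht hαβ).2

/-! ### Smooth radial profiles -/

theorem hasCompactSupport_of_annulus {f : Plane → ℝ} {R₂ R₃ : ℝ}
    (hs : tsupport f ⊆ {ξ | R₂ ≤ ‖ξ‖ ∧ ‖ξ‖ ≤ R₃}) : HasCompactSupport f :=
  (isCompact_closedBall (0 : Plane) R₃).of_isClosed_subset (isClosed_tsupport f) fun ξ hξ => by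
    simpa using (hs hξ).2

theorem isProfile_of_contDiff {f : Plane → ℝ} {R₂ R₃ : ℝ} (hf : ContDiff ℝ ∞ f)
    (hr : ∀ ξ ζ : Plane, ‖ξ‖ = ‖ζ‖ → f ξ = f ζ)
    (hs : tsupport f ⊆ {ξ | R₂ ≤ ‖ξ‖ ∧ ‖ξ‖ ≤ R₃}) : IsProfile R₂ R₃ f where
  meas := hf.continuous.measurable
  bdd := hf.continuous.bounded_above_of_compact_support (hasCompactSupport_of_annulus hs)
  radial := hr
  supp _ hξ := hs (subset_tsupport _ hξ)

theorem weightNorm_lt_top (k : ℕ) {f : Plane → ℝ} {R₂ R₃ : ℝ} (hf : ContDiff ℝ ∞ f)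
    (hs : tsupport f ⊆ {ξ | R₂ ≤ ‖ξ‖ ∧ ‖ξ‖ ≤ R₃}) : weightNorm k f < ⊤ := by
  have hfc := hf.continuous
  have hc : Continuous fun ξ : Plane => (1 + ‖ξ‖ ^ 2) ^ (k + 1) * |f ξ| ^ 2 := by fun_prop
  have hcs : HasCompactSupport fun ξ : Plane => (1 + ‖ξ‖ ^ 2) ^ (k + 1) * |f ξ| ^ 2 :=
    ((hasCompactSupport_of_annulus hs).comp_left (g := fun y : ℝ => |y| ^ 2) (by simp)).mul_left
  exact ENNReal.rpow_lt_top_of_nonneg (by norm_num)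
    (hc.integrable_of_hasCompactSupport hcs).lintegral_lt_top.ne

end RayleighTaylor

end

/-! ### The theorem. -/

theorem theorem3p8 (S : Params) :
    (∃ φ ψ : ℝ → ℝ → ℝ, IsModeFamily S φ ψ) ∧
    ∃ C₀ C₁ C₂ : ℝ, 0 < C₀ ∧ 0 < C₁ ∧ 0 < C₂ ∧
      (∀ r, C₀ ≤ r → C₁ * r - C₂ ≤ growthRate S r ^ 2) ∧
    ∃ Cbar : ℕ → ℝ, (∀ k, 0 < Cbar k) ∧
    ∀ φ ψ : ℝ → ℝ → ℝ, IsModeFamily S φ ψ →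
    ∀ R₁ R₂ R₃ : ℝ, max C₀ (2 * C₂ / C₁) < R₁ → R₁ ≤ R₂ → R₂ < R₃ →
    ∀ f : Plane → ℝ, ContDiff ℝ ∞ f →
      (∀ ξ ζ : Plane, ‖ξ‖ = ‖ζ‖ → f ξ = f ζ) →
      tsupport f ⊆ {ξ | R₂ ≤ ‖ξ‖ ∧ ‖ξ‖ ≤ R₃} →
    -- the synthesis integrals converge absolutely in both fluids
    (∀ x ∈ upperFluid S ∪ lowerFluid S, ∀ t,
      Integrable (etaIntegrand S φ ψ f x t) ∧ Integrable (vIntegrand S φ ψ f x t) ∧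
      Integrable (qIntegrand S φ ψ f x t)) ∧
    -- they are real-valued
    ∃ (η v : Space → ℝ → Space) (q : Space → ℝ → ℝ),
      (∀ x ∈ upperFluid S ∪ lowerFluid S, ∀ t,
        (∀ i, (η x t i : ℂ) = etaSynth S φ ψ f x t i) ∧
        (∀ i, (v x t i : ℂ) = vSynth S φ ψ f x t i) ∧
        (q x t : ℂ) = qSynth S φ ψ f x t) ∧
      IsLinearizedSolution S η v q ∧
      -- equivariance under rotations about the vertical axis
      (∀ R ∈ Matrix.specialOrthogonalGroup (Fin 3) ℝ,
        R *ᵥ (Pi.single 2 1 : Fin 3 → ℝ) = Pi.single 2 1 →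
        ∀ x ∈ upperFluid S ∪ lowerFluid S, ∀ t,
          η (R *ᵥ x) t = R *ᵥ η x t ∧ v (R *ᵥ x) t = R *ᵥ v x t ∧ q (R *ᵥ x) t = q x t) ∧
      0 < √(C₁ * R₂ - C₂) ∧
      ∀ k : ℕ,
        (hkNormVec S k (fun x => η x 0) + hkNormVec S k (fun x => v x 0)
            + hkNorm S k (fun x => q x 0) ≤ ENNReal.ofReal (Cbar k) * weightNorm k f ∧
          weightNorm k f < ⊤) ∧
        ∀ t, 0 < t →
          (hkNormVec S k (fun x => η x t) < ⊤ ∧ hkNormVec S k (fun x => v x t) < ⊤ ∧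
            hkNorm S k (fun x => q x t) < ⊤) ∧
          GrowsBetween √(C₁ * R₂ - C₂) √(S.g * R₃)
            (fun τ => hkNormVec S k (fun x => η x τ)) t ∧
          GrowsBetween √(C₁ * R₂ - C₂) √(S.g * R₃)
            (fun τ => hkNormVec S k (fun x => v x τ)) t ∧
          GrowsBetween √(C₁ * R₂ - C₂) √(S.g * R₃)
            (fun τ => hkNorm S k (fun x => q x τ)) t := by
  refine ⟨exists_family, ?_⟩
  obtain ⟨C₀, C₁, C₂, h0, h1, h2, hgrow⟩ := exists_growth_bound S
  -- For `r ≥ 2C₂/C₁` the constant `C₂` is at most `C₁ r / 2`, which leaves `C₁ r - C₂ ≥ (C₁/2) r`.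
  -- The threshold depends on the parameters only, hence so do the Sobolev constants.
  have hG : GrowthBound S (C₁ / 2) (max C₀ (2 * C₂ / C₁)) := by
    refine ⟨by positivity, h0.trans (le_max_left _ _), fun r hr => ?_⟩
    have a1 := hgrow r ((le_max_left _ _).trans hr)
    have a2 := (le_max_right _ _).trans hr
    rw [div_le_iff₀ h1] at a2
    linarith
  choose Cbar hCpos hC using fun k => exists_sobolev_bound hG k
  refine ⟨C₀, C₁, C₂, by linarith, h1, h2, hgrow, Cbar, hCpos,
    fun φ ψ hfam R₁ R₂ R₃ hR₁ hR₁₂ hR₂₃ f hf hrad hsupp => ?_⟩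
  obtain ⟨p, hp⟩ := hfam.exists_data
  have hP : IsPacket S φ ψ p (C₁ / 2) (max C₀ (2 * C₂ / C₁)) R₂ R₃ f :=
    ⟨hp, hG, (hR₁.trans_le hR₁₂).le, isProfile_of_contDiff hf hrad hsupp⟩
  have hR₂ : C₂ < C₁ * R₂ := by
    have a2 := (le_max_right C₀ (2 * C₂ / C₁)).trans (hR₁.trans_le hR₁₂).le
    rw [div_le_iff₀ h1] at a2
    linarith
  -- The lower bound for `λ²` increases with `r` and is evaluated at the inner radius; the upper
  -- bound `g r` is evaluated at the outer one.
  have hαβ : ∀ r, R₂ ≤ r → r ≤ R₃ → √(C₁ * R₂ - C₂) ≤ growthRate S r ∧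
      growthRate S r ≤ √(S.g * R₃) := by
    intro r hr hr'
    have a1 : max C₀ (2 * C₂ / C₁) ≤ r := hP.le.trans hr
    refine ⟨Real.sqrt_le_iff.2 ⟨growthRate_nonneg r, ?_⟩, Real.le_sqrt_of_sq_le ?_⟩
    · have a2 := hgrow r ((le_max_left _ _).trans a1)
      have a3 : C₁ * R₂ ≤ C₁ * r := by gcongr
      linarith
    · refine (growthRate_sq_le S (by linarith [hG.one_le])).trans ?_
      exact mul_le_mul_of_nonneg_left hr' S.g_pos.le
  refine ⟨fun x hx t => ⟨hP.integrable_etaIntegrand hx t, hP.integrable_vIntegrand hx t,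
    hP.integrable_qIntegrand hx t⟩, etaField S φ ψ f, vField S φ ψ f, qField S p f,
    fun x hx t => ⟨hP.ofReal_etaField hx t, hP.ofReal_vField hx t, hP.ofReal_qField hx t⟩,
    hP.isLinearizedSolution, fun R hR hfix x hx t => ?_, Real.sqrt_pos.2 (by linarith),
    fun k => ?_⟩
  · have hrot := isVerticalRotation hR hfix
    exact ⟨hP.etaField_mulVec hrot hx t, hP.vField_mulVec hrot hx t, hP.qField_mulVec hrot x t⟩
  · obtain ⟨hb, hg⟩ := hC k φ ψ p R₂ R₃ f hP
    exact ⟨⟨hb, weightNorm_lt_top k hf hsupp⟩, fun t ht => ⟨(hg t).1, (hg t).2 _ _ ht hαβ⟩⟩
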